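/- Let $R$ be an integral domain; $\otimes=\otimes_R$, and coalgebras are coassociative counital $R$-coalgebras. **Simplicial coalgebras.** A simplicial cocommutative coalgebra $C$ is a simplicial object in cocommutative $R$-coalgebras; write $\Delta(x)=\sum \widetilde x\otimes\overline x$ and $\epsilon$ for the coproduct and counit of each $C_n$, and $d_i$, $s_j$ for faces and degeneracies. It is *connected* if $C_0\cong R$ as coalgebras, and *$R$-flat* if every $C_n$ is a flat $R$-module. Let $\mathbf{scCoalg}_R$ and $\mathbf{scCoalg}^0_R$ denote the categories of simplicial cocommutative coalgebras and of connected ones, with all maps of simplicial coalgebras as morphisms. Let $N_*(C)$ be the normalized chain complex (the quotient of $(C_*,\sum(-1)^id_i)$ by the subcomplex generated by degenerate elements), with the coproduct $N_*(C)\to N_*(C\otimes C)\xrightarrow{AW}N_*(C)\otimes N_*(C)$ given by $\Delta$ followed by the Alexander–Whitney map $AW(x\otimes y)=\sum_{p+q=n}(\text{front }p\text{-face of }x)\otimes(\text{last }q\text{-face of }y)$. A map $f$ of simplicial coalgebras is a *quasi-isomorphism* if $N_*(f)$ induces isomorphisms on homology. **Cobar construction.** For connected $C$ let $K=N_*(C)$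 and let $\Omega K$ be the tensor algebra on $s^{-1}(K/K_0)$, with monomials $\{x_1|\dots|x_k\}$ in degree $\sum|x_i|-k$, and with differential the graded derivation $D$ of degree $-1$ with $D\{x\}=-\{\partial x\}+\sum(-1)^{|x'|}\{x'|x''\}$, where $\sum x'\otimes x''$ is the coproduct of $x$ in $K$. A map $f:C\to C'$ of connected simplicial cocommutative coalgebras is an *$\Omega$-quasi-isomorphism* if $\Omega N_*(f):\Omega N_*(C)\to\Omega N_*(C')$ is a quasi-isomorphism. **Fundamental bialgebra.** For $C\in\mathbf{scCoalg}^0_R$ let $\pi(C)=H_0(\Omega N_*(C))$, with unit $e$. It is a cocommutative bialgebra, natural in $C$, whose coproduct and counit are the algebra maps determined by $$\nabla[\{x\}]=\sum[\{\widetilde x\}]\otimes[\{\overline x\}]+e\otimes[\{x\}]+[\{x\}]\otimes e,\qquad \epsilon[\{x\}]=0\qquad(x\in C_1).$$ For $n\ge1$ define $\tau:C_n\to\pi(C)$ by $\tau(x)=[\{d_2\cdots d_n x\}]+\epsilon(x)e$. **Universal cover.** The universal cover $\widetilde C=C\otimes_\tau\pi(C)$ is the simplicial cocommutative coalgebra with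 $\widetilde C_n=C_n\otimes\pi(C)$ as a coalgebra (the tensor product of coalgebras), with structure maps $$d_0(x\otimes g)=\sum d_0\widetilde x\otimes g\cdot\tau(\overline x),\qquad d_i(x\otimes g)=d_ix\otimes g\ \ (i\ge1),\qquad s_j(x\otimes g)=s_jx\otimes g.$$ A map $f:C\to C'$ induces $\widetilde f$ with components $f_n\otimes\pi(f)$; this defines the universal cover functor $\mathbf{scCoalg}^0_R\to\mathbf{scCoalg}_R$. **Theorem.** Let $f:C\to C'$ be an $\Omega$-quasi-isomorphism between connected simplicial cocommutative $R$-flat coalgebras. Then $\widetilde f:\widetilde C\to\widetilde{C'}$ is a quasi-isomorphism. In other words, the universal cover functor sends $\Omega$-quasi-isomorphisms between connected simplicial cocommutative $R$-flat coalgebras to quasi-isomorphisms. -/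

import Mathlib

open CategoryTheory TensorProduct Simplicial

universe u v

noncomputable section

/-- A connected differential graded coassociative counital `R`-coalgebra, non-negatively graded,
with differential of degree `-1`.  The coproduct is recorded through its components
`X_n → X_p ⊗ X_q`, which are only meaningful (and are zero otherwise) for `p + q = n`.
Connectedness says that the counit identifies the degree zero part with `R`. -/
structure ConnDGCoalg (R : Type u) [CommRing R] where
  /-- the underlying chain complex -/
  cx : ChainComplex (ModuleCat.{v} R) ℕ
  /-- the component `X_n → X_p ⊗ X_q` of the coproduct -/
  comul : ∀ p q n : ℕ, cx.X n →ₗ[R] cx.X p ⊗[R] cx.X q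
  /-- the counit, which is zero outside degree zero -/
  counit : cx.X 0 →ₗ[R] R
  comul_shape : ∀ p q n, p + q ≠ n → comul p q n = 0
  /-- the coproduct is a chain map -/
  leibniz : ∀ p q n, p + q = n → ∀ x : cx.X (n + 1),
    comul p q n ((cx.d (n + 1) n).hom x) =
      (cx.d (p + 1) p).hom.rTensor (cx.X q) (comul (p + 1) q (n + 1) x) +
        (-1 : R) ^ p • (cx.d (q + 1) q).hom.lTensor (cx.X p) (comul p (q + 1) (n + 1) x)
  coassoc : ∀ a b c n, a + b + c = n → ∀ x : cx.X n,
    TensorProduct.assoc R (cx.X a) (cx.X b) (cx.X c)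
        ((comul a b (a + b)).rTensor (cx.X c) (comul (a + b) c n x)) =
      (comul b c (b + c)).lTensor (cx.X a) (comul a (b + c) n x)
  counit_d : ∀ x : cx.X 1, counit ((cx.d 1 0).hom x) = 0
  counit_left : ∀ n (x : cx.X n),
    TensorProduct.lid R (cx.X n) (counit.rTensor (cx.X n) (comul 0 n n x)) = x
  counit_right : ∀ n (x : cx.X n),
    TensorProduct.rid R (cx.X n) (counit.lTensor (cx.X n) (comul n 0 n x)) = x
  connected : Function.Bijective counit

namespace ConnDGCoalg

variable {R : Type u} [CommRing R]

/-- A morphism of connected dg coalgebras. -/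
structure Hom (K K' : ConnDGCoalg.{u, v} R) where
  /-- the underlying chain map -/
  f : K.cx ⟶ K'.cx
  comul_comm : ∀ p q n (x : K.cx.X n),
    K'.comul p q n ((f.f n).hom x) =
      TensorProduct.map (f.f p).hom (f.f q).hom (K.comul p q n x)
  counit_comm : ∀ x : K.cx.X 0, K'.counit ((f.f 0).hom x) = K.counit x

variable (K : ConnDGCoalg.{u, v} R)

/-- The graded module `s⁻¹ (X / X_0)`; its summand with index `n` is `X_{n+1}`, in degree `n`. -/
abbrev Desusp : Type v := DirectSum ℕ fun n => K.cx.X (n + 1)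

/-- The underlying algebra of the cobar construction, the tensor algebra of `s⁻¹ (X / X_0)`. -/
abbrev Cobar : Type (max u v) := TensorAlgebra R K.Desusp

/-- The element `{x}` of the cobar construction, for `x` in `X_n`; it is zero for `n = 0`. -/
def br (n : ℕ) : K.cx.X n →ₗ[R] K.Cobar :=
  match n with
  | 0 => 0
  | n + 1 => TensorAlgebra.ι R ∘ₗ DirectSum.lof R ℕ (fun n => K.cx.X (n + 1)) n

/-- The linear map `x ⊗ y ↦ {x | y}`. -/
def br₂ (p q : ℕ) : K.cx.X p ⊗[R] K.cx.X q →ₗ[R] K.Cobar :=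
  LinearMap.mul' R K.Cobar ∘ₗ TensorProduct.map (K.br p) (K.br q)

/-- The cobar differential on generators,
`D {x} = - {∂ x} + ∑ (-1)^|x'| {x' | x''}` for `x` in `X_{n+1}`. -/
def diffGen (n : ℕ) : K.cx.X (n + 1) →ₗ[R] K.Cobar :=
  - K.br n ∘ₗ (K.cx.d (n + 1) n).hom +
    ∑ pq ∈ Finset.HasAntidiagonal.antidiagonal (n + 1),
      (-1 : R) ^ pq.1 • K.br₂ pq.1 pq.2 ∘ₗ K.comul pq.1 pq.2 (n + 1)

/-- The grading involution `a ↦ (-1)^|a| a`. -/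
def sgn : K.Cobar →ₐ[R] K.Cobar :=
  TensorAlgebra.lift R (DirectSum.toModule R ℕ K.Cobar fun n => (-1 : R) ^ n • K.br (n + 1))

/-- The algebra map `a ↦ !![(-1)^|a| a, D a; 0, a]` which encodes the cobar differential. -/
def diffMatrix : K.Cobar →ₐ[R] Matrix (Fin 2) (Fin 2) K.Cobar :=
  TensorAlgebra.lift R (DirectSum.toModule R ℕ _ fun n =>
    { toFun := fun x => !![(-1 : R) ^ n • K.br (n + 1) x, K.diffGen n x; 0, K.br (n + 1) x]
      map_add' := fun x y => by
        ext i j; fin_cases i <;> fin_cases j <;> simp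
      map_smul' := fun r x => by
        ext i j
        fin_cases i <;> fin_cases j <;>
          simp only [map_smul, smul_comm _ r, RingHom.id_apply, Matrix.smul_apply] <;> simp })

/-- The differential of the cobar construction: the unique graded derivation of degree `-1`
which is given by `diffGen` on generators (see `diff_br` and `diff_mul`). -/
def diff : K.Cobar →ₗ[R] K.Cobar :=
  { toFun := fun a => K.diffMatrix a 0 1
    map_add' := fun x y => by simp
    map_smul' := fun r x => by simp }

lemma sgn_br (n : ℕ) (x : K.cx.X (n + 1)) :
    K.sgn (K.br (n + 1) x) = (-1 : R) ^ n • K.br (n + 1) x := by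
  simp [sgn, br]

lemma diffMatrix_br (n : ℕ) (x : K.cx.X (n + 1)) :
    K.diffMatrix (K.br (n + 1) x) =
      !![(-1 : R) ^ n • K.br (n + 1) x, K.diffGen n x; 0, K.br (n + 1) x] := by
  conv_lhs => rw [br]
  simp [diffMatrix]

lemma diff_br (n : ℕ) (x : K.cx.X (n + 1)) : K.diff (K.br (n + 1) x) = K.diffGen n x := by
  change K.diffMatrix _ 0 1 = _
  rw [diffMatrix_br]; rfl

variable {K} in
@[elab_as_elim]
lemma cobar_induction {P : K.Cobar → Prop} (halg : ∀ r, P (algebraMap R _ r))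
    (hbr : ∀ n (x : K.cx.X (n + 1)), P (K.br (n + 1) x))
    (hmul : ∀ a b, P a → P b → P (a * b)) (hadd : ∀ a b, P a → P b → P (a + b))
    (a : K.Cobar) : P a := by
  induction a using TensorAlgebra.induction with
  | algebraMap r => exact halg r
  | mul a b ha hb => exact hmul a b ha hb
  | add a b ha hb => exact hadd a b ha hb
  | ι x =>
    induction x using DirectSum.induction_on with
    | zero => simpa using halg 0
    | of n x => exact hbr n x
    | add x y hx hy => rw [map_add]; exact hadd _ _ hx hy

lemma cobar_algHom_ext {B : Type*} [Ring B] [Algebra R B] (f g : K.Cobar →ₐ[R] B)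
    (h : ∀ n (x : K.cx.X (n + 1)), f (K.br (n + 1) x) = g (K.br (n + 1) x)) : f = g := by
  refine AlgHom.ext fun a => ?_
  induction a using cobar_induction with
  | halg r => simp
  | hbr n x => exact h n x
  | hmul a b ha hb => simp [ha, hb]
  | hadd a b ha hb => simp [ha, hb]

lemma diffMatrix_eq (a : K.Cobar) :
    K.diffMatrix a = !![K.sgn a, K.diff a; 0, a] := by
  have key : K.diffMatrix a 0 0 = K.sgn a ∧ K.diffMatrix a 1 0 = 0 ∧ K.diffMatrix a 1 1 = a := by
    induction a using cobar_induction with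
    | halg r => simp [Matrix.algebraMap_matrix_apply]
    | hbr n x => simp [diffMatrix_br, sgn_br]
    | hmul a b ha hb => simp [Matrix.mul_apply, Fin.sum_univ_two, ha, hb]
    | hadd a b ha hb => simp [ha, hb]
  ext i j
  fin_cases i <;> fin_cases j
  · exact key.1
  · rfl
  · exact key.2.1
  · exact key.2.2

lemma diff_mul (a b : K.Cobar) : K.diff (a * b) = K.diff a * b + K.sgn a * K.diff b := by
  have h : K.diffMatrix (a * b) 0 1 = (K.diffMatrix a * K.diffMatrix b) 0 1 := by rw [map_mul]
  rw [diffMatrix_eq, diffMatrix_eq, diffMatrix_eq] at h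
  simpa [Matrix.mul_apply, Fin.sum_univ_two, add_comm] using h

lemma diff_algebraMap (r : R) : K.diff (algebraMap R _ r) = 0 := by
  change K.diffMatrix (algebraMap R K.Cobar r) 0 1 = 0
  simp [Matrix.algebraMap_matrix_apply]

lemma diff_one : K.diff 1 = 0 := by simpa using K.diff_algebraMap 1

lemma br_zero : K.br 0 = 0 := rfl

lemma br₂_tmul (p q : ℕ) (u : K.cx.X p) (v : K.cx.X q) :
    K.br₂ p q (u ⊗ₜ v) = K.br p u * K.br q v := by
  simp [br₂]

lemma br₂_zero_left (q : ℕ) : K.br₂ 0 q = 0 := by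
  simp [br₂, br_zero]

lemma br₂_zero_right (p : ℕ) : K.br₂ p 0 = 0 := by
  simp [br₂, br_zero]

/-- The quadratic part of the differential on generators. -/
def quad (n : ℕ) : K.cx.X n →ₗ[R] K.Cobar :=
  ∑ pq ∈ Finset.HasAntidiagonal.antidiagonal n,
    (-1 : R) ^ pq.1 • K.br₂ pq.1 pq.2 ∘ₗ K.comul pq.1 pq.2 n

lemma diff_br_all (n : ℕ) (x : K.cx.X n) :
    K.diff (K.br n x) = - K.br (n - 1) ((K.cx.d n (n - 1)).hom x) + K.quad n x := by
  cases n with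
  | zero => simp [br_zero, quad, br₂_zero_left]
  | succ n => rw [diff_br]; rfl

lemma sgn_br_all (n : ℕ) (x : K.cx.X n) :
    K.sgn (K.br n x) = (-1 : R) ^ (n + 1) • K.br n x := by
  cases n with
  | zero => simp [br_zero]
  | succ n => rw [sgn_br]; simp [pow_succ]

lemma sum_antidiagonal_assoc {M : Type*} [AddCommMonoid M] (n : ℕ) (F : ℕ → ℕ → ℕ → M) :
    ∑ pq ∈ Finset.HasAntidiagonal.antidiagonal n,
        ∑ ac ∈ Finset.HasAntidiagonal.antidiagonal pq.1, F ac.1 ac.2 pq.2 =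
      ∑ pq ∈ Finset.HasAntidiagonal.antidiagonal n,
        ∑ ce ∈ Finset.HasAntidiagonal.antidiagonal pq.2, F pq.1 ce.1 ce.2 := by
  rw [Finset.sum_sigma', Finset.sum_sigma']
  refine Finset.sum_nbij' (fun s => ⟨(s.2.1, s.2.2 + s.1.2), (s.2.2, s.1.2)⟩)
    (fun s => ⟨(s.1.1 + s.2.1, s.2.2), (s.1.1, s.2.1)⟩) ?_ ?_ ?_ ?_ ?_
  all_goals
    rintro ⟨⟨a, b⟩, ⟨c, d⟩⟩ h
    simp only [Finset.mem_sigma, Finset.HasAntidiagonal.mem_antidiagonal] at h ⊢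
  · exact ⟨by omega, by dsimp only⟩
  · exact ⟨by omega, by dsimp only⟩
  · obtain ⟨rfl, rfl⟩ := h; rfl
  · obtain ⟨rfl, rfl⟩ := h; rfl

lemma diff_br₂ (p q : ℕ) (w : K.cx.X p ⊗[R] K.cx.X q) :
    K.diff (K.br₂ p q w) =
      - K.br₂ (p - 1) q ((K.cx.d p (p - 1)).hom.rTensor _ w) +
        (-1 : R) ^ p • K.br₂ p (q - 1) ((K.cx.d q (q - 1)).hom.lTensor _ w) +
      (LinearMap.mul' R K.Cobar (TensorProduct.map (K.quad p) (K.br q) w) -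
        (-1 : R) ^ p • LinearMap.mul' R K.Cobar (TensorProduct.map (K.br p) (K.quad q) w)) := by
  induction w using TensorProduct.induction_on with
  | zero => simp
  | add x y hx hy =>
    simp only [map_add, hx, hy, smul_add]; abel
  | tmul u v =>
    simp only [br₂_tmul, diff_mul, diff_br_all, sgn_br_all, LinearMap.rTensor_tmul,
      LinearMap.lTensor_tmul, TensorProduct.map_tmul, LinearMap.mul'_apply, pow_succ, mul_neg,
      mul_one, neg_smul, add_mul, mul_add, neg_mul, smul_mul_assoc, neg_neg]
    abel

/-- The cubic term `x ↦ ± {x' | x'' | x'''}`. -/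
def cubic (n a c e : ℕ) (x : K.cx.X n) : K.Cobar :=
  LinearMap.mul' R K.Cobar (TensorProduct.map (K.br₂ a c ∘ₗ K.comul a c (a + c)) (K.br e)
    (K.comul (a + c) e n x))

lemma cubic_eq {n a c e : ℕ} (h : a + c + e = n) (x : K.cx.X n) :
    K.cubic n a c e x =
      LinearMap.mul' R K.Cobar (TensorProduct.map (K.br a) (K.br₂ c e ∘ₗ K.comul c e (c + e))
        (K.comul a (c + e) n x)) := by
  have h1 : ∀ w : (K.cx.X a ⊗[R] K.cx.X c) ⊗[R] K.cx.X e,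
      LinearMap.mul' R K.Cobar (TensorProduct.map (K.br₂ a c) (K.br e) w) =
        LinearMap.mul' R K.Cobar (TensorProduct.map (K.br a) (K.br₂ c e)
          (TensorProduct.assoc R _ _ _ w)) := by
    intro w
    induction w using TensorProduct.induction_on with
    | zero => simp
    | add x y hx hy => simp only [map_add, hx, hy]
    | tmul w z =>
      induction w using TensorProduct.induction_on with
      | zero => simp
      | add x y hx hy => simp only [map_add, hx, hy, add_tmul]
      | tmul x y => simp [br₂_tmul, mul_assoc]
  have h2 := h1 ((K.comul a c (a + c)).rTensor (K.cx.X e) (K.comul (a + c) e n x))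
  rw [K.coassoc a c e n h x] at h2
  rw [cubic]
  rw [LinearMap.rTensor, LinearMap.lTensor, TensorProduct.map_map, TensorProduct.map_map] at h2
  simpa using h2

lemma map_quad_left (n p q : ℕ) (x : K.cx.X n) :
    LinearMap.mul' R K.Cobar (TensorProduct.map (K.quad p) (K.br q) (K.comul p q n x)) =
      ∑ ac ∈ Finset.HasAntidiagonal.antidiagonal p, (-1 : R) ^ ac.1 • K.cubic n ac.1 ac.2 q x := by
  have : TensorProduct.map (K.quad p) (K.br q) =
      ∑ ac ∈ Finset.HasAntidiagonal.antidiagonal p, (-1 : R) ^ ac.1 •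
        TensorProduct.map (K.br₂ ac.1 ac.2 ∘ₗ K.comul ac.1 ac.2 p) (K.br q) := by
    rw [quad, ← TensorProduct.mapBilinear_apply, map_sum, LinearMap.sum_apply]
    simp
  rw [this]
  simp only [LinearMap.sum_apply, map_sum, LinearMap.smul_apply, map_smul]
  refine Finset.sum_congr rfl fun ac hac => ?_
  obtain rfl := Finset.HasAntidiagonal.mem_antidiagonal.1 hac
  rfl

lemma map_quad_right (n p q : ℕ) (h : p + q = n) (x : K.cx.X n) :
    LinearMap.mul' R K.Cobar (TensorProduct.map (K.br p) (K.quad q) (K.comul p q n x)) =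
      ∑ ce ∈ Finset.HasAntidiagonal.antidiagonal q, (-1 : R) ^ ce.1 • K.cubic n p ce.1 ce.2 x := by
  have : TensorProduct.map (K.br p) (K.quad q) =
      ∑ ac ∈ Finset.HasAntidiagonal.antidiagonal q, (-1 : R) ^ ac.1 •
        TensorProduct.map (K.br p) (K.br₂ ac.1 ac.2 ∘ₗ K.comul ac.1 ac.2 q) := by
    rw [quad, ← TensorProduct.mapBilinear_apply, map_sum]
    simp
  rw [this]
  simp only [LinearMap.sum_apply, map_sum, LinearMap.smul_apply, map_smul]
  refine Finset.sum_congr rfl fun ac hac => ?_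
  obtain rfl := Finset.HasAntidiagonal.mem_antidiagonal.1 hac
  rw [K.cubic_eq (by omega)]

lemma neg_one_pow_mul_self' (p : ℕ) : (-1 : R) ^ p * (-1) ^ p = 1 := by
  rw [← mul_pow]; simp

lemma diff_diff_br (n : ℕ) (x : K.cx.X (n + 1)) : K.diff (K.diff (K.br (n + 1) x)) = 0 := by
  have hd : (K.cx.d n (n - 1)).hom ((K.cx.d (n + 1) n).hom x) = 0 := by
    rw [← LinearMap.comp_apply, ← ModuleCat.hom_comp, K.cx.d_comp_d]; rfl
  have hquad : K.diff (K.quad (n + 1) x) = K.quad n ((K.cx.d (n + 1) n).hom x) := by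
    have e1 : K.diff (K.quad (n + 1) x) =
        ∑ pq ∈ Finset.HasAntidiagonal.antidiagonal (n + 1), (-1 : R) ^ pq.1 •
          K.diff (K.br₂ pq.1 pq.2 (K.comul pq.1 pq.2 (n + 1) x)) := by
      simp [quad]
    have e2 : ∑ pq ∈ Finset.HasAntidiagonal.antidiagonal (n + 1), (-1 : R) ^ pq.1 •
        (LinearMap.mul' R K.Cobar (TensorProduct.map (K.quad pq.1) (K.br pq.2)
            (K.comul pq.1 pq.2 (n + 1) x)) -
          (-1 : R) ^ pq.1 • LinearMap.mul' R K.Cobar (TensorProduct.map (K.br pq.1)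
            (K.quad pq.2) (K.comul pq.1 pq.2 (n + 1) x))) = 0 := by
      have e3 := sum_antidiagonal_assoc (n + 1)
        (fun a c e => (-1 : R) ^ c • K.cubic (n + 1) a c e x)
      simp only [smul_sub, Finset.sum_sub_distrib]
      rw [sub_eq_zero]
      calc _ = _ := Finset.sum_congr rfl fun pq hpq => ?_
        _ = _ := e3
        _ = _ := Finset.sum_congr rfl fun pq hpq => ?_
      · rw [map_quad_left, Finset.smul_sum]
        refine Finset.sum_congr rfl fun ac hac => ?_
        rw [← Finset.HasAntidiagonal.mem_antidiagonal.1 hac, smul_smul, pow_add,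
          mul_comm ((-1 : R) ^ ac.1) ((-1) ^ ac.2), mul_assoc, neg_one_pow_mul_self', mul_one]
      · rw [map_quad_right _ _ _ _ (Finset.HasAntidiagonal.mem_antidiagonal.1 hpq), smul_smul,
          neg_one_pow_mul_self', one_smul]
    rw [e1]
    simp only [diff_br₂, smul_add, Finset.sum_add_distrib, smul_neg]
    rw [e2, add_zero]
    have s1 := Finset.Nat.sum_antidiagonal_succ (n := n) (f := fun pq : ℕ × ℕ =>
      -((-1 : R) ^ pq.1 • K.br₂ (pq.1 - 1) pq.2 ((K.cx.d pq.1 (pq.1 - 1)).hom.rTensor _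
        (K.comul pq.1 pq.2 (n + 1) x))))
    have s2 := Finset.Nat.sum_antidiagonal_succ' (n := n) (f := fun pq : ℕ × ℕ =>
      (-1 : R) ^ pq.1 • (-1 : R) ^ pq.1 • K.br₂ pq.1 (pq.2 - 1)
        ((K.cx.d pq.2 (pq.2 - 1)).hom.lTensor _ (K.comul pq.1 pq.2 (n + 1) x)))
    have z1 : K.br₂ (0 - 1) (n + 1) = 0 := K.br₂_zero_left _
    have z2 : K.br₂ (n + 1) (0 - 1) = 0 := K.br₂_zero_right _
    dsimp only at s1 s2
    rw [z1, LinearMap.zero_apply, smul_zero, neg_zero, zero_add] at s1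
    rw [z2, LinearMap.zero_apply, smul_zero, smul_zero, zero_add] at s2
    rw [s1, s2, quad, LinearMap.sum_apply, ← Finset.sum_add_distrib]
    refine Finset.sum_congr rfl fun pq hpq => ?_
    rw [LinearMap.smul_apply, LinearMap.comp_apply,
      K.leibniz _ _ _ (Finset.HasAntidiagonal.mem_antidiagonal.1 hpq), map_add, map_smul, smul_add]
    simp [pow_succ]
  rw [diff_br_all, map_add, map_neg, hquad]
  change -K.diff (K.br n ((K.cx.d (n + 1) n).hom x)) + _ = 0
  rw [diff_br_all, hd]
  simp

lemma sgn_diff (a : K.Cobar) : K.sgn (K.diff a) = - K.diff (K.sgn a) := by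
  induction a using cobar_induction with
  | halg r => simp [diff_algebraMap]
  | hadd a b ha hb => simp [ha, hb, add_comm]
  | hmul a b ha hb =>
    simp only [diff_mul, map_mul, map_add, ha, hb]
    simp [add_comm]
  | hbr n x =>
    rw [sgn_br, map_smul, diff_br_all, map_add, map_neg]
    have h1 : K.sgn (K.quad (n + 1) x) = (-1 : R) ^ (n + 1) • K.quad (n + 1) x := by
      simp only [quad, LinearMap.sum_apply, map_sum, LinearMap.smul_apply, LinearMap.comp_apply,
        map_smul, Finset.smul_sum]
      refine Finset.sum_congr rfl fun pq hpq => ?_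
      rw [smul_comm]
      congr 1
      generalize K.comul pq.1 pq.2 (n + 1) x = w
      induction w using TensorProduct.induction_on with
      | zero => simp
      | add x y hx hy => simp only [map_add, hx, hy, smul_add]
      | tmul u v =>
        rw [br₂_tmul, map_mul, sgn_br_all, sgn_br_all, smul_mul_smul_comm, ← pow_add,
          ← Finset.HasAntidiagonal.mem_antidiagonal.1 hpq]
        congr 1
        rw [show pq.1 + 1 + (pq.2 + 1) = pq.1 + pq.2 + 2 by ring, pow_add]; simp
    rw [h1, sgn_br_all]
    simp only [Nat.add_sub_cancel, pow_succ]
    simp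
    abel

lemma diff_diff (a : K.Cobar) : K.diff (K.diff a) = 0 := by
  induction a using cobar_induction with
  | halg r => simp [diff_algebraMap]
  | hbr n x => exact K.diff_diff_br n x
  | hadd a b ha hb => simp [ha, hb]
  | hmul a b ha hb => simp [diff_mul, ha, hb, sgn_diff]


/-- The monomial `{x₁ | ... | x_k}`. -/
def monomial (L : List (Σ n : ℕ, K.cx.X (n + 1))) : K.Cobar :=
  (L.map fun s => K.br (s.1 + 1) s.2).prod

/-- The degree `n` part of the cobar construction, spanned by the monomials
`{x₁ | ... | x_k}` with `|x₁| + ... + |x_k| - k = n`. -/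
def deg (n : ℕ) : Submodule R K.Cobar :=
  Submodule.span R (K.monomial '' {L | (L.map Sigma.fst).sum = n})

lemma monomial_mem (L : List (Σ n : ℕ, K.cx.X (n + 1))) :
    K.monomial L ∈ K.deg (L.map Sigma.fst).sum :=
  Submodule.subset_span ⟨L, rfl, rfl⟩

lemma monomial_nil : K.monomial [] = 1 := rfl

lemma monomial_cons (n : ℕ) (x : K.cx.X (n + 1)) (L : List (Σ n : ℕ, K.cx.X (n + 1))) :
    K.monomial (⟨n, x⟩ :: L) = K.br (n + 1) x * K.monomial L := by
  simp [monomial]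

lemma one_mem_deg : (1 : K.Cobar) ∈ K.deg 0 := K.monomial_mem []

lemma br_mem_deg (n : ℕ) (x : K.cx.X (n + 1)) : K.br (n + 1) x ∈ K.deg n := by
  simpa [monomial] using K.monomial_mem [⟨n, x⟩]

lemma mul_mem_deg {m n : ℕ} {a b : K.Cobar} (ha : a ∈ K.deg m) (hb : b ∈ K.deg n) :
    a * b ∈ K.deg (m + n) := by
  have h : K.deg m * K.deg n ≤ K.deg (m + n) := by
    rw [deg, deg, Submodule.span_mul_span, Submodule.span_le]
    rintro _ ⟨_, ⟨L, hL, rfl⟩, _, ⟨L', hL', rfl⟩, rfl⟩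
    refine Submodule.subset_span ⟨L ++ L', ?_, ?_⟩
    · simpa using congrArg₂ (· + ·) hL hL'
    · simp [monomial]
  exact h (Submodule.mul_mem_mul ha hb)

lemma sgn_of_mem {n : ℕ} {a : K.Cobar} (ha : a ∈ K.deg n) : K.sgn a = (-1 : R) ^ n • a := by
  have h : K.deg n ≤ LinearMap.eqLocus K.sgn.toLinearMap ((-1 : R) ^ n • LinearMap.id) := by
    rw [deg, Submodule.span_le]
    rintro _ ⟨L, hL, rfl⟩
    change K.sgn (K.monomial L) = (-1 : R) ^ n • K.monomial L
    clear ha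
    subst hL
    induction L with
    | nil => simp [monomial_nil]
    | cons s L ih =>
      obtain ⟨k, x⟩ := s
      rw [monomial_cons, map_mul, ih, sgn_br]
      simp [pow_add, smul_smul, mul_comm]
  exact h ha

lemma br₂_mem_deg {p q n : ℕ} (h : p + q = n + 2) (w : K.cx.X p ⊗[R] K.cx.X q) :
    K.br₂ p q w ∈ K.deg n := by
  induction w using TensorProduct.induction_on with
  | zero => simp
  | add x y hx hy => rw [map_add]; exact add_mem hx hy
  | tmul u v =>
    rw [br₂_tmul]
    match p, q with
    | 0, _ => simp [br_zero]
    | _ + 1, 0 => simp [br_zero]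
    | p + 1, q + 1 =>
      obtain rfl : n = p + q := by omega
      exact K.mul_mem_deg (K.br_mem_deg p u) (K.br_mem_deg q v)

lemma diff_br_one (x : K.cx.X 1) : K.diff (K.br 1 x) = 0 := by
  rw [diff_br, diffGen]
  simp [br_zero, Finset.Nat.antidiagonal_succ, br₂_zero_left, br₂_zero_right]

lemma diff_br_mem (n : ℕ) (x : K.cx.X (n + 2)) : K.diff (K.br (n + 2) x) ∈ K.deg n := by
  rw [diff_br, diffGen]
  refine add_mem (neg_mem (K.br_mem_deg _ _)) ?_
  rw [LinearMap.sum_apply]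
  exact sum_mem fun pq hpq => Submodule.smul_mem _ _
    (K.br₂_mem_deg (Finset.HasAntidiagonal.mem_antidiagonal.1 hpq) _)

lemma diff_monomial (L : List (Σ n : ℕ, K.cx.X (n + 1))) :
    ((L.map Sigma.fst).sum = 0 → K.diff (K.monomial L) = 0) ∧
      ∀ n, (L.map Sigma.fst).sum = n + 1 → K.diff (K.monomial L) ∈ K.deg n := by
  induction L with
  | nil => simp [monomial_nil, diff_one]
  | cons s L ih =>
    obtain ⟨k, x⟩ := s
    rw [monomial_cons, diff_mul, sgn_br]
    simp only [List.map_cons, List.sum_cons]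
    refine ⟨fun h => ?_, fun n h => ?_⟩
    · obtain rfl : k = 0 := by omega
      rw [ih.1 (by omega), diff_br_one]
      simp
    · refine add_mem ?_ ?_
      · match k, x with
        | 0, x => rw [diff_br_one]; simp
        | k + 1, x =>
          obtain rfl : n = k + (L.map Sigma.fst).sum := by omega
          exact K.mul_mem_deg (K.diff_br_mem k x) (K.monomial_mem L)
      · rw [smul_mul_assoc]
        refine Submodule.smul_mem _ _ ?_
        rcases Nat.eq_zero_or_pos (L.map Sigma.fst).sum with h0 | h0
        · rw [ih.1 h0]; simp
        · obtain ⟨m, hm⟩ := Nat.exists_eq_succ_of_ne_zero h0.ne'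
          obtain rfl : n = k + m := by omega
          exact K.mul_mem_deg (K.br_mem_deg k x) (ih.2 m hm)

lemma diff_of_mem_zero {a : K.Cobar} (ha : a ∈ K.deg 0) : K.diff a = 0 := by
  have h : K.deg 0 ≤ LinearMap.ker K.diff := by
    rw [deg, Submodule.span_le]
    rintro _ ⟨L, hL, rfl⟩
    exact (K.diff_monomial L).1 hL
  exact h ha

lemma diff_mem {n : ℕ} {a : K.Cobar} (ha : a ∈ K.deg (n + 1)) : K.diff a ∈ K.deg n := by
  have h : K.deg (n + 1) ≤ (K.deg n).comap K.diff := by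
    conv_lhs => rw [deg]
    rw [Submodule.span_le]
    rintro _ ⟨L, hL, rfl⟩
    exact (K.diff_monomial L).2 n hL
  exact h ha

/-- The underlying chain complex of the cobar construction. -/
def cobar : ChainComplex (ModuleCat.{max u v} R) ℕ :=
  ChainComplex.of (fun n => ModuleCat.of R (K.deg n))
    (fun _ => ModuleCat.ofHom (K.diff.restrict fun _ ha => K.diff_mem ha))
    (fun _ => ModuleCat.hom_ext (LinearMap.ext fun a => Subtype.ext (K.diff_diff a.1)))

variable {K} {K' K'' : ConnDGCoalg.{u, v} R}

namespace Hom

/-- The algebra map `{x₁ | ... | x_k} ↦ {f x₁ | ... | f x_k}` of cobar constructions. -/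
def cobarAlgHom (f : Hom K K') : K.Cobar →ₐ[R] K'.Cobar :=
  TensorAlgebra.lift R (DirectSum.toModule R ℕ K'.Cobar fun n =>
    K'.br (n + 1) ∘ₗ (f.f.f (n + 1)).hom)

lemma cobarAlgHom_br (f : Hom K K') (n : ℕ) (x : K.cx.X n) :
    f.cobarAlgHom (K.br n x) = K'.br n ((f.f.f n).hom x) := by
  cases n with
  | zero => simp [br_zero]
  | succ n =>
    conv_lhs => rw [br]
    simp [cobarAlgHom]

lemma comm_d (f : Hom K K') (m n : ℕ) (x : K.cx.X m) :
    (f.f.f n).hom ((K.cx.d m n).hom x) = (K'.cx.d m n).hom ((f.f.f m).hom x) := by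
  rw [← LinearMap.comp_apply, ← ModuleCat.hom_comp, ← f.f.comm]; rfl

lemma cobarAlgHom_diff (f : Hom K K') (a : K.Cobar) :
    f.cobarAlgHom (K.diff a) = K'.diff (f.cobarAlgHom a) := by
  induction a using cobar_induction with
  | halg r => simp [diff_algebraMap]
  | hadd a b ha hb => simp [ha, hb]
  | hmul a b ha hb =>
    have hs : f.cobarAlgHom (K.sgn a) = K'.sgn (f.cobarAlgHom a) := by
      have := cobar_algHom_ext K (f.cobarAlgHom.comp K.sgn) (K'.sgn.comp f.cobarAlgHom)
        (fun n x => by simp [sgn_br, cobarAlgHom_br])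
      exact DFunLike.congr_fun this a
    simp [diff_mul, ha, hb, hs]
  | hbr n x =>
    rw [diff_br_all, cobarAlgHom_br, diff_br_all, map_add, map_neg, cobarAlgHom_br, comm_d]
    congr 1
    simp only [quad, LinearMap.sum_apply, map_sum, LinearMap.smul_apply, LinearMap.comp_apply,
      map_smul]
    refine Finset.sum_congr rfl fun pq _ => ?_
    rw [f.comul_comm]
    congr 1
    generalize K.comul pq.1 pq.2 (n + 1) x = w
    induction w using TensorProduct.induction_on with
    | zero => simp
    | add x y hx hy => simp only [map_add, hx, hy]
    | tmul u v => simp [br₂_tmul, cobarAlgHom_br]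

lemma cobarAlgHom_mem (f : Hom K K') {n : ℕ} {a : K.Cobar} (ha : a ∈ K.deg n) :
    f.cobarAlgHom a ∈ K'.deg n := by
  have h : K.deg n ≤ (K'.deg n).comap f.cobarAlgHom.toLinearMap := by
    conv_lhs => rw [deg]
    rw [Submodule.span_le]
    rintro _ ⟨L, hL, rfl⟩
    refine Submodule.subset_span ⟨L.map fun s => ⟨s.1, (f.f.f (s.1 + 1)).hom s.2⟩, ?_, ?_⟩
    · simpa [Function.comp_def] using hL
    · simp [monomial, map_list_prod, Function.comp_def, cobarAlgHom_br]
  exact h ha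

lemma _root_.ConnDGCoalg.cobar_d (K : ConnDGCoalg.{u, v} R) (n : ℕ) :
    K.cobar.d (n + 1) n =
      ModuleCat.ofHom (K.diff.restrict fun _ ha => K.diff_mem (n := n) ha) := by
  simp [cobar]

/-- The chain map of cobar constructions induced by a morphism of dg coalgebras. -/
def cobarMap (f : Hom K K') : K.cobar ⟶ K'.cobar :=
  ChainComplex.ofHom
    (fun _ => ModuleCat.ofHom (f.cobarAlgHom.toLinearMap.restrict fun _ ha => f.cobarAlgHom_mem ha))
    (fun n => by
      rw [cobar_d, cobar_d]
      exact ModuleCat.hom_ext (LinearMap.ext fun a => Subtype.ext (f.cobarAlgHom_diff a.1).symm))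

/-- A morphism of connected dg coalgebras is an `Ω`-quasi-isomorphism if it induces a
quasi-isomorphism of cobar constructions. -/
def IsOmegaQuasiIso (f : Hom K K') : Prop := QuasiIso f.cobarMap

end Hom

variable (K)

/-- The algebra of degree zero elements of the cobar construction. -/
def cobarZero : Subalgebra R K.Cobar where
  carrier := {a | a ∈ K.deg 0}
  mul_mem' ha hb := by simpa using K.mul_mem_deg ha hb
  add_mem' ha hb := (K.deg 0).add_mem ha hb
  algebraMap_mem' r := by
    have h : algebraMap R K.Cobar r = r • 1 := Algebra.algebraMap_eq_smul_one r
    exact h ▸ (K.deg 0).smul_mem r K.one_mem_deg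

/-- The ideal of boundaries `D (Ω_1)` of `Ω_0`. -/
def boundaries : Ideal K.cobarZero where
  carrier := {a | ∃ b ∈ K.deg 1, K.diff b = a}
  add_mem' := by
    rintro _ _ ⟨b, hb, h⟩ ⟨b', hb', h'⟩
    exact ⟨b + b', add_mem hb hb', by simp [h, h']⟩
  zero_mem' := ⟨0, zero_mem _, by simp⟩
  smul_mem' := by
    rintro ⟨c, hc⟩ _ ⟨b, hb, h⟩
    exact ⟨c * b, by simpa using K.mul_mem_deg hc hb, by
      simp [diff_mul, K.diff_of_mem_zero hc, K.sgn_of_mem hc, h]⟩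

instance : K.boundaries.IsTwoSided where
  mul_mem_of_left := by
    rintro _ ⟨c, hc⟩ ⟨b, hb, h⟩
    exact ⟨b * c, by simpa using K.mul_mem_deg hb hc, by
      simp [diff_mul, K.diff_of_mem_zero hc, h]⟩

/-- The algebra `H_0 = Ω_0 / D (Ω_1)`. -/
abbrev HZero : Type (max u v) := K.cobarZero ⧸ K.boundaries

/-- The class `[{x}]` in `H_0` of an element `x` of degree one. -/
def cls : K.cx.X 1 →ₗ[R] K.HZero :=
  (Ideal.Quotient.mkₐ R K.boundaries).toLinearMap ∘ₗ
    (K.br 1).codRestrict (Subalgebra.toSubmodule K.cobarZero) (K.br_mem_deg 0)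

/-- `x ⊗ y ↦ g x * g y`. -/
def sq {M B : Type*} [AddCommGroup M] [Module R M] [Ring B] [Algebra R B] (g : M →ₗ[R] B) :
    M ⊗[R] M →ₗ[R] B :=
  LinearMap.mul' R B ∘ₗ TensorProduct.map g g

lemma diff_br_two (y : K.cx.X 2) :
    K.diff (K.br 2 y) = - (K.br 1 ((K.cx.d 2 1).hom y) + K.br₂ 1 1 (K.comul 1 1 2 y)) := by
  rw [diff_br, diffGen]
  simp [Finset.Nat.antidiagonal_succ, br₂_zero_left, br₂_zero_right, add_comm]

lemma cls_rel (y : K.cx.X 2) :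
    K.cls ((K.cx.d 2 1).hom y) + sq K.cls (K.comul 1 1 2 y) = 0 := by
  have h1 : ∀ w : K.cx.X 1 ⊗[R] K.cx.X 1, ∃ h : K.br₂ 1 1 w ∈ K.cobarZero,
      sq K.cls w = Ideal.Quotient.mk K.boundaries ⟨K.br₂ 1 1 w, h⟩ := by
    intro w
    refine ⟨K.br₂_mem_deg (by rfl) w, ?_⟩
    induction w using TensorProduct.induction_on with
    | zero => simp only [map_zero]; exact (map_zero _).symm
    | add x y hx hy =>
      rw [map_add, hx, hy, ← map_add]
      congr 1
      exact Subtype.ext (map_add _ _ _).symm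
    | tmul u v =>
      simp only [sq, LinearMap.comp_apply, TensorProduct.map_tmul, LinearMap.mul'_apply]
      change Ideal.Quotient.mk K.boundaries _ * Ideal.Quotient.mk K.boundaries _ = _
      rw [← map_mul]
      exact congrArg _ (Subtype.ext (K.br₂_tmul 1 1 u v).symm)
  obtain ⟨h, e⟩ := h1 (K.comul 1 1 2 y)
  rw [e]
  change Ideal.Quotient.mk K.boundaries _ + _ = _
  rw [← map_add, Ideal.Quotient.eq_zero_iff_mem]
  refine ⟨- K.br 2 y, neg_mem (K.br_mem_deg 1 y), ?_⟩
  rw [map_neg, diff_br_two, neg_neg]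
  rfl

section lift

variable {K} {B : Type*} [Ring B] [Algebra R B] (g : K.cx.X 1 →ₗ[R] B)

/-- The algebra map on the cobar construction which extends `g` and is zero on the generators of
positive degree. -/
def liftAux : K.Cobar →ₐ[R] B :=
  TensorAlgebra.lift R (DirectSum.toModule R ℕ B fun n =>
    match n with
    | 0 => g
    | _ + 1 => 0)

lemma liftAux_one (x : K.cx.X 1) : liftAux g (K.br 1 x) = g x := by
  conv_lhs => rw [br]
  simp [liftAux]

lemma liftAux_ne (n : ℕ) (hn : n ≠ 1) (x : K.cx.X n) : liftAux g (K.br n x) = 0 := by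
  match n, hn with
  | 0, _ => simp [br_zero]
  | n + 2, _ =>
    conv_lhs => rw [br]
    simp [liftAux]

lemma liftAux_br₂_ne (p q : ℕ) (h : p + q ≠ 2) (w : K.cx.X p ⊗[R] K.cx.X q) :
    liftAux g (K.br₂ p q w) = 0 := by
  induction w using TensorProduct.induction_on with
  | zero => simp
  | add x y hx hy => simp [hx, hy]
  | tmul u v =>
    rw [br₂_tmul, map_mul]
    by_cases hp : p = 1
    · rw [liftAux_ne g q (by omega), mul_zero]
    · rw [liftAux_ne g p hp, zero_mul]

lemma liftAux_br₂ (w : K.cx.X 1 ⊗[R] K.cx.X 1) : liftAux g (K.br₂ 1 1 w) = sq g w := by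
  induction w using TensorProduct.induction_on with
  | zero => simp
  | add x y hx hy => simp [hx, hy]
  | tmul u v => rw [br₂_tmul, map_mul, liftAux_one, liftAux_one]; simp [sq]

lemma liftAux_diff (hg : ∀ y : K.cx.X 2, g ((K.cx.d 2 1).hom y) + sq g (K.comul 1 1 2 y) = 0)
    (a : K.Cobar) : liftAux g (K.diff a) = 0 := by
  induction a using cobar_induction with
  | halg r => simp [diff_algebraMap]
  | hadd a b ha hb => simp [ha, hb]
  | hmul a b ha hb => simp [diff_mul, ha, hb]
  | hbr n x =>
    match n, x with
    | 0, x => rw [diff_br_one, map_zero]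
    | 1, x => rw [diff_br_two, map_neg, map_add, liftAux_one, liftAux_br₂, hg, neg_zero]
    | n + 2, x =>
      rw [diff_br, diffGen]
      simp only [LinearMap.add_apply, LinearMap.neg_apply, LinearMap.comp_apply, map_add, map_neg,
        LinearMap.sum_apply, map_sum, LinearMap.smul_apply, map_smul]
      rw [liftAux_ne g _ (by omega), neg_zero, zero_add]
      refine Finset.sum_eq_zero fun pq hpq => ?_
      have := Finset.HasAntidiagonal.mem_antidiagonal.1 hpq
      rw [liftAux_br₂_ne g _ _ (by omega), smul_zero]

/-- The algebra map `H_0 → B` determined by its values `g x` on the classes `[{x}]`. -/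
def HZero.lift (hg : ∀ y : K.cx.X 2, g ((K.cx.d 2 1).hom y) + sq g (K.comul 1 1 2 y) = 0) :
    K.HZero →ₐ[R] B :=
  Ideal.Quotient.liftₐ K.boundaries ((liftAux g).comp K.cobarZero.val) (by
    rintro a ⟨b, -, h⟩
    change liftAux g (a : K.Cobar) = 0
    rw [← h, liftAux_diff g hg])

lemma HZero.lift_cls
    (hg : ∀ y : K.cx.X 2, g ((K.cx.d 2 1).hom y) + sq g (K.comul 1 1 2 y) = 0) (x : K.cx.X 1) :
    HZero.lift g hg (K.cls x) = g x :=
  liftAux_one g x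

lemma HZero.algHom_ext {f g : K.HZero →ₐ[R] B} (h : ∀ x, f (K.cls x) = g (K.cls x)) : f = g := by
  refine Ideal.Quotient.algHom_ext R (AlgHom.ext fun a => ?_)
  let S : Subalgebra R K.Cobar := (AlgHom.equalizer
    (f.comp (Ideal.Quotient.mkₐ R K.boundaries))
    (g.comp (Ideal.Quotient.mkₐ R K.boundaries))).map K.cobarZero.val
  have hbr : ∀ x : K.cx.X 1, K.br 1 x ∈ S := fun x =>
    ⟨⟨K.br 1 x, K.br_mem_deg 0 x⟩, h x, rfl⟩
  have hS : K.deg 0 ≤ Subalgebra.toSubmodule S := by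
    rw [deg, Submodule.span_le]
    rintro _ ⟨L, hL, rfl⟩
    change K.monomial L ∈ S
    induction L with
    | nil => exact S.one_mem
    | cons s L ih =>
      obtain ⟨k, x⟩ := s
      change k + (List.map Sigma.fst L).sum = 0 at hL
      obtain rfl : k = 0 := by omega
      rw [monomial_cons]
      exact S.mul_mem (hbr x) (ih (show (List.map Sigma.fst L).sum = 0 by omega))
  obtain ⟨a', ha', e⟩ := hS a.2
  obtain rfl : a' = a := Subtype.ext e
  exact ha'

end lift

end ConnDGCoalg

namespace SimplicialCoalg

section NormalizedChains

variable {R : Type u} [CommRing R]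

/-- The submodule generated by the degenerate `n`-simplices of a simplicial module. -/
def degenerateSubmodule (X : SimplicialObject (ModuleCat.{v} R)) (n : ℕ) :
    Submodule R (X _⦋n⦌) :=
  match n with
  | 0 => ⊥
  | m + 1 => ⨆ i : Fin (m + 1), LinearMap.range (X.σ i).hom

variable (X Y Z : SimplicialObject (ModuleCat.{v} R))

lemma map_mem_degenerateSubmodule {n : ℕ} {Δ : SimplexCategory} (φ : ⦋n⦌ ⟶ Δ)
    (h : ¬ Function.Injective φ.toOrderHom) (y : X.obj (Opposite.op Δ)) :
    (X.map φ.op).hom y ∈ degenerateSubmodule X n := by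
  match n, φ, h with
  | 0, φ, h => exact absurd (Function.injective_of_subsingleton (α := Fin 1) _) h
  | m + 1, φ, h =>
    obtain ⟨i, θ, rfl⟩ := SimplexCategory.eq_σ_comp_of_not_injective φ h
    refine Submodule.mem_iSup_of_mem i ⟨(X.map θ.op).hom y, ?_⟩
    rw [op_comp, X.map_comp]
    rfl

lemma not_injective_δ_comp_σ {n : ℕ} (i : Fin (n + 2)) (j : Fin (n + 1)) (h1 : i ≠ j.castSucc)
    (h2 : i ≠ j.succ) :
    ¬ Function.Injective (SimplexCategory.δ i ≫ SimplexCategory.σ j).toOrderHom := by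
  intro hinj
  obtain ⟨a, ha⟩ := Fin.exists_succAbove_eq h1.symm
  obtain ⟨b, hb⟩ := Fin.exists_succAbove_eq h2.symm
  have hab : a = b := by
    apply hinj
    change Fin.predAbove j (i.succAbove a) = Fin.predAbove j (i.succAbove b)
    rw [ha, hb]
    simp
  subst hab
  exact (Fin.castSucc_lt_succ (i := j)).ne (ha.symm.trans hb)

lemma alternatingFace_mem (n : ℕ) (x : X _⦋n + 1⦌) (hx : x ∈ degenerateSubmodule X (n + 1)) :
    (AlgebraicTopology.AlternatingFaceMapComplex.objD X n).hom x ∈ degenerateSubmodule X n := by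
  have h : degenerateSubmodule X (n + 1) ≤ (degenerateSubmodule X n).comap
      (AlgebraicTopology.AlternatingFaceMapComplex.objD X n).hom := by
    refine iSup_le fun j => ?_
    rintro _ ⟨y, rfl⟩
    rw [Submodule.mem_comap, ← Submodule.Quotient.mk_eq_zero, ← Submodule.mkQ_apply]
    simp only [AlgebraicTopology.AlternatingFaceMapComplex.objD, ModuleCat.hom_sum,
      LinearMap.sum_apply, map_sum, ModuleCat.hom_zsmul, LinearMap.smul_apply, map_zsmul]
    rw [Fintype.sum_eq_add j.castSucc j.succ (Fin.castSucc_lt_succ (i := j)).ne]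
    · have e1 : (X.δ j.castSucc).hom ((X.σ j).hom y) = y := by
        rw [← LinearMap.comp_apply, ← ModuleCat.hom_comp, X.δ_comp_σ_self]; rfl
      have e2 : (X.δ j.succ).hom ((X.σ j).hom y) = y := by
        rw [← LinearMap.comp_apply, ← ModuleCat.hom_comp, X.δ_comp_σ_succ]; rfl
      rw [e1, e2]
      simp [pow_succ]
    · rintro i ⟨h1, h2⟩
      have e : (X.δ i).hom ((X.σ j).hom y) =
          (X.map (SimplexCategory.δ i ≫ SimplexCategory.σ j).op).hom y := by
        rw [op_comp, X.map_comp]; rfl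
      rw [e, Submodule.mkQ_apply, (Submodule.Quotient.mk_eq_zero _).2
        (map_mem_degenerateSubmodule X _ (not_injective_δ_comp_σ i j h1 h2) y), smul_zero]
  exact h hx

/-- The normalized chain complex of a simplicial module: the quotient of the complex of all
simplices, with differential `∑ (-1)^i d_i`, by the subcomplex generated by degenerate simplices. -/
def normalizedComplex : ChainComplex (ModuleCat.{v} R) ℕ :=
  ChainComplex.of (fun n => ModuleCat.of R (X _⦋n⦌ ⧸ degenerateSubmodule X n))
    (fun n => ModuleCat.ofHom (Submodule.mapQ _ _
      (AlgebraicTopology.AlternatingFaceMapComplex.objD X n).hom (alternatingFace_mem X n)))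
    (fun n => by
      refine ModuleCat.hom_ext (Submodule.linearMap_qext _ (LinearMap.ext fun x => ?_))
      have h := AlgebraicTopology.AlternatingFaceMapComplex.d_squared X n
      have h' := LinearMap.congr_fun (congrArg ModuleCat.Hom.hom h) x
      exact congrArg (Submodule.mkQ (degenerateSubmodule X n)) h')

/-- The projection from all `n`-simplices to normalized `n`-chains. -/
def toNormalized (n : ℕ) : X _⦋n⦌ →ₗ[R] (normalizedComplex X).X n :=
  (degenerateSubmodule X n).mkQ

lemma toNormalized_surjective (n : ℕ) : Function.Surjective (toNormalized X n) :=
  Submodule.mkQ_surjective _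

lemma toNormalized_eq_zero {n : ℕ} {x : X _⦋n⦌} (hx : x ∈ degenerateSubmodule X n) :
    toNormalized X n x = 0 :=
  (Submodule.Quotient.mk_eq_zero _).2 hx

lemma normalizedComplex_d (n : ℕ) (x : X _⦋n + 1⦌) :
    ((normalizedComplex X).d (n + 1) n).hom (toNormalized X (n + 1) x) =
      ∑ i : Fin (n + 2), (-1 : R) ^ (i : ℕ) • toNormalized X n ((X.δ i).hom x) := by
  have h : (normalizedComplex X).d (n + 1) n = ModuleCat.ofHom (Submodule.mapQ _ _
      (AlgebraicTopology.AlternatingFaceMapComplex.objD X n).hom (alternatingFace_mem X n)) := by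
    simp [normalizedComplex]
  rw [h]
  change toNormalized X n ((AlgebraicTopology.AlternatingFaceMapComplex.objD X n).hom x) = _
  simp only [AlgebraicTopology.AlternatingFaceMapComplex.objD, ModuleCat.hom_sum,
      LinearMap.sum_apply, map_sum, ModuleCat.hom_zsmul, LinearMap.smul_apply, map_zsmul]
  refine Finset.sum_congr rfl fun i _ => ?_
  rcases neg_one_pow_eq_or ℤ (i : ℕ) with e | e <;>
  rcases Nat.even_or_odd (i : ℕ) with e' | e' <;> simp [e'.neg_one_pow]

variable {X Y Z}

lemma map_degenerateSubmodule (f : X ⟶ Y) (n : ℕ) :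
    degenerateSubmodule X n ≤
      (degenerateSubmodule Y n).comap (f.app (Opposite.op ⦋n⦌)).hom := by
  match n with
  | 0 => exact bot_le
  | m + 1 =>
    refine iSup_le fun j => ?_
    rintro _ ⟨y, rfl⟩
    refine Submodule.mem_iSup_of_mem j ⟨(f.app (Opposite.op ⦋m⦌)).hom y, ?_⟩
    have h := f.naturality (SimplexCategory.σ j).op
    exact (LinearMap.congr_fun (congrArg ModuleCat.Hom.hom h) y).symm

/-- The map of normalized chain complexes induced by a map of simplicial modules. -/
def normalizedMap (f : X ⟶ Y) : normalizedComplex X ⟶ normalizedComplex Y :=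
  ChainComplex.ofHom
    (fun n => ModuleCat.ofHom (Submodule.mapQ _ _ (f.app (Opposite.op ⦋n⦌)).hom
      (map_degenerateSubmodule f n)))
    (fun n => by
      refine ModuleCat.hom_ext (Submodule.linearMap_qext _ (LinearMap.ext fun x => ?_))
      change ((normalizedComplex Y).d (n + 1) n).hom
          (toNormalized Y (n + 1) ((f.app (Opposite.op ⦋n + 1⦌)).hom x)) =
        (Submodule.mapQ _ _ (f.app (Opposite.op ⦋n⦌)).hom (map_degenerateSubmodule f n))
          (((normalizedComplex X).d (n + 1) n).hom (toNormalized X (n + 1) x))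
      rw [normalizedComplex_d, normalizedComplex_d]
      erw [map_sum]
      refine Finset.sum_congr rfl fun i _ => ?_
      erw [map_smul]
      congr 1
      have h := f.naturality (SimplexCategory.δ i).op
      exact congrArg (toNormalized Y n)
        (LinearMap.congr_fun (congrArg ModuleCat.Hom.hom h) x).symm)

lemma normalizedMap_apply (f : X ⟶ Y) (n : ℕ) (x : X _⦋n⦌) :
    ((normalizedMap f).f n).hom (toNormalized X n x) =
      toNormalized Y n ((f.app (Opposite.op ⦋n⦌)).hom x) :=
  rfl

variable (R) in
/-- The normalized chains functor from simplicial modules to chain complexes. -/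
def normalizedChains : SimplicialObject (ModuleCat.{v} R) ⥤ ChainComplex (ModuleCat.{v} R) ℕ where
  obj X := normalizedComplex X
  map f := normalizedMap f
  map_id X := by
    ext n : 1
    exact ModuleCat.hom_ext (Submodule.linearMap_qext _ rfl)
  map_comp f g := by
    ext n : 1
    exact ModuleCat.hom_ext (Submodule.linearMap_qext _ rfl)

end NormalizedChains

section NormalizedCoalgebra

variable {R : Type u} [CommRing R]

/-- The simplicial module underlying a simplicial coalgebra. -/
abbrev underlyingModule (C : SimplicialObject (CoalgCat.{v} R)) :
    SimplicialObject (ModuleCat.{v} R) :=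
  ((SimplicialObject.whiskering (CoalgCat.{v} R) (ModuleCat.{v} R)).obj
    (forget₂ (CoalgCat.{v} R) (ModuleCat.{v} R))).obj C

variable (C : SimplicialObject (CoalgCat.{v} R))

/-- The coalgebra map `φ^* : C_n → C_m` induced by `φ : [m] ⟶ [n]`. -/
def act {m n : ℕ} (φ : ⦋m⦌ ⟶ ⦋n⦌) : C _⦋n⦌ →ₗc[R] C _⦋m⦌ := (C.map φ.op).toCoalgHom

lemma act_comp {l m n : ℕ} (ψ : ⦋l⦌ ⟶ ⦋m⦌) (φ : ⦋m⦌ ⟶ ⦋n⦌) (x : C _⦋n⦌) :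
    act C (ψ ≫ φ) x = act C ψ (act C φ x) := by
  simp only [act, op_comp, C.map_comp]
  rfl

lemma act_id {n : ℕ} (x : C _⦋n⦌) : act C (𝟙 ⦋n⦌) x = x := by
  simp only [act, op_id, C.map_id]
  rfl

/-- The projection from `C_n` to normalized `n`-chains. -/
def nmk (n : ℕ) : (C _⦋n⦌ : Type v) →ₗ[R] (normalizedComplex (underlyingModule C)).X n :=
  toNormalized (underlyingModule C) n

lemma nmk_surjective (n : ℕ) (x : (normalizedComplex (underlyingModule C)).X n) :
    ∃ y : C _⦋n⦌, nmk C n y = x :=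
  toNormalized_surjective (underlyingModule C) n x

/-- The submodule of `C_n` generated by degenerate simplices. -/
def ndeg (n : ℕ) : Submodule R (C _⦋n⦌ : Type v) := degenerateSubmodule (underlyingModule C) n

/-- The linear map on normalized chains induced by a linear map which is zero on degenerate
simplices. -/
def nlift {n : ℕ} {M : Type*} [AddCommGroup M] [Module R M] (f : (C _⦋n⦌ : Type v) →ₗ[R] M)
    (hf : ∀ x ∈ ndeg C n, f x = 0) : (normalizedComplex (underlyingModule C)).X n →ₗ[R] M :=
  (ndeg C n).liftQ f hf

lemma nlift_nmk {n : ℕ} {M : Type*} [AddCommGroup M] [Module R M]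
    (f : (C _⦋n⦌ : Type v) →ₗ[R] M) (hf : ∀ x ∈ ndeg C n, f x = 0) (x : C _⦋n⦌) :
    nlift C f hf (nmk C n x) = f x :=
  rfl

lemma linearMap_ndeg {n : ℕ} {M : Type*} [AddCommGroup M] [Module R M]
    (f : (C _⦋n + 1⦌ : Type v) →ₗ[R] M)
    (hf : ∀ (j : Fin (n + 1)) (y : C _⦋n⦌), f (act C (SimplexCategory.σ j) y) = 0)
    (x : C _⦋n + 1⦌) (hx : x ∈ ndeg C (n + 1)) : f x = 0 := by
  have h : ndeg C (n + 1) ≤ LinearMap.ker f := by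
    refine iSup_le fun j => ?_
    rintro _ ⟨y, rfl⟩
    exact hf j y
  exact h hx

/-- The map `x ↦ [α^* x]` to normalized chains. -/
def nact {p n : ℕ} (α : ⦋p⦌ ⟶ ⦋n⦌) :
    (C _⦋n⦌ : Type v) →ₗ[R] (normalizedComplex (underlyingModule C)).X p :=
  nmk C p ∘ₗ (act C α : (C _⦋n⦌ : Type v) →ₗ[R] (C _⦋p⦌ : Type v))

/-- The map `x ↦ ∑ [α^* x'] ⊗ [β^* x'']`, where `∑ x' ⊗ x''` is the coproduct of `x`. -/
def nactPair {p q n : ℕ} (α : ⦋p⦌ ⟶ ⦋n⦌) (β : ⦋q⦌ ⟶ ⦋n⦌) :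
    (C _⦋n⦌ : Type v) →ₗ[R] (normalizedComplex (underlyingModule C)).X p ⊗[R]
      (normalizedComplex (underlyingModule C)).X q :=
  TensorProduct.map (nact C α) (nact C β) ∘ₗ Coalgebra.comul

lemma nact_comp {l m n : ℕ} (ψ : ⦋l⦌ ⟶ ⦋m⦌) (φ : ⦋m⦌ ⟶ ⦋n⦌) :
    nact C (ψ ≫ φ) = nact C ψ ∘ₗ (act C φ : (C _⦋n⦌ : Type v) →ₗ[R] (C _⦋m⦌ : Type v)) := by
  ext x
  exact congrArg (nmk C l) (act_comp C ψ φ x)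

lemma nactPair_comp {p q m n : ℕ} (α : ⦋p⦌ ⟶ ⦋m⦌) (β : ⦋q⦌ ⟶ ⦋m⦌) (φ : ⦋m⦌ ⟶ ⦋n⦌)
    (x : C _⦋n⦌) : nactPair C (α ≫ φ) (β ≫ φ) x = nactPair C α β (act C φ x) := by
  have h := CoalgHomClass.map_comp_comul_apply (act C φ) x
  simp only [nactPair, LinearMap.comp_apply]
  rw [← h, nact_comp, nact_comp, TensorProduct.map_comp]
  rfl

lemma nact_of_not_injective {p n : ℕ} (α : ⦋p⦌ ⟶ ⦋n⦌)
    (h : ¬ Function.Injective α.toOrderHom) : nact C α = 0 := by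
  ext x
  exact toNormalized_eq_zero _ (map_mem_degenerateSubmodule (underlyingModule C) α h x)

lemma nactPair_degenerate {p q n : ℕ} (α : ⦋p⦌ ⟶ ⦋n⦌) (β : ⦋q⦌ ⟶ ⦋n⦌)
    (h : ∀ i : Fin n, (∃ a b, a ≠ b ∧ ((α.toOrderHom a : ℕ) = i ∧ (α.toOrderHom b : ℕ) = i + 1)) ∨
      ∃ a b, a ≠ b ∧ ((β.toOrderHom a : ℕ) = i ∧ (β.toOrderHom b : ℕ) = i + 1))
    (x : C _⦋n⦌) (hx : x ∈ ndeg C n) : nactPair C α β x = 0 := by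
  match n, α, β, h, x, hx with
  | 0, α, β, h, x, hx =>
    obtain rfl : x = 0 := hx
    exact map_zero _
  | m + 1, α, β, h, x, hx =>
    refine linearMap_ndeg C _ (fun j y => ?_) x hx
    rw [← nactPair_comp]
    have hni : ∀ {r : ℕ} (γ : ⦋r⦌ ⟶ ⦋m + 1⦌),
        (∃ a b, a ≠ b ∧ ((γ.toOrderHom a : ℕ) = j ∧ (γ.toOrderHom b : ℕ) = j + 1)) →
          ¬ Function.Injective (γ ≫ SimplexCategory.σ j).toOrderHom := by
      rintro r γ ⟨a, b, hab, ha, hb⟩ hinj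
      apply hab
      apply hinj
      change Fin.predAbove j (γ.toOrderHom a) = Fin.predAbove j (γ.toOrderHom b)
      have ha' : γ.toOrderHom a = j.castSucc := Fin.ext ha
      have hb' : γ.toOrderHom b = j.succ := Fin.ext (by simpa using hb)
      rw [ha', hb']
      simp
    rcases h j with h | h
    · simp [nactPair, nact_of_not_injective C _ (hni α h)]
    · simp [nactPair, nact_of_not_injective C _ (hni β h)]

/-- The inclusion `[p] → [n]`, `i ↦ i` of the front `p`-face. -/
abbrev frontFace {p n : ℕ} (h : p ≤ n) : ⦋p⦌ ⟶ ⦋n⦌ :=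
  SimplexCategory.subinterval 0 p (by omega)

/-- The inclusion `[q] → [n]`, `i ↦ i + p` of the last `q`-face, where `p + q = n`. -/
abbrev lastFace {p q n : ℕ} (h : p + q = n) : ⦋q⦌ ⟶ ⦋n⦌ :=
  SimplexCategory.subinterval p q (by omega)

/-- The component `N_n → N_p ⊗ N_q` of the coproduct on normalized chains: the
Alexander-Whitney map applied to the coproduct of the simplicial coalgebra. -/
def awComul (p q n : ℕ) : (normalizedComplex (underlyingModule C)).X n →ₗ[R]
    (normalizedComplex (underlyingModule C)).X p ⊗[R]
      (normalizedComplex (underlyingModule C)).X q :=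
  if h : p + q = n then
    nlift C (nactPair C (frontFace (by omega)) (lastFace h)) (fun x hx => by
        refine nactPair_degenerate C _ _ (fun i => ?_) x hx
        by_cases hi : (i : ℕ) < p
        · exact Or.inl ⟨⟨i, by simp; omega⟩, ⟨i + 1, by simp; omega⟩, by simp, rfl, rfl⟩
        · refine Or.inr ⟨⟨i - p, by simp; omega⟩, ⟨i - p + 1, by simp; omega⟩, by simp, ?_, ?_⟩
          · change (i : ℕ) - p + p = i
            omega
          · change (i : ℕ) - p + 1 + p = i + 1
            omega)
  else 0

lemma awComul_nmk {p q n : ℕ} (h : p + q = n) (x : C _⦋n⦌) :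
    awComul C p q n (nmk C n x) = nactPair C (frontFace (by omega)) (lastFace h) x := by
  rw [awComul, dif_pos h, nlift_nmk]

/-- The face `δ_i` with a natural number as index. -/
def natδ {n : ℕ} (i : ℕ) : ⦋n⦌ ⟶ ⦋n + 1⦌ := SimplexCategory.δ (Fin.ofNat (n + 2) i)

lemma natδ_apply {n : ℕ} (i : ℕ) (hi : i < n + 2) (j : Fin (n + 1)) :
    ((natδ (n := n) i).toOrderHom j : ℕ) = if (j : ℕ) < i then (j : ℕ) else j + 1 := by
  change ((Fin.ofNat (n + 2) i).succAbove j : ℕ) = _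
  simp only [Fin.succAbove, Fin.lt_def, Fin.val_castSucc, Fin.val_ofNat, Nat.mod_eq_of_lt hi]
  split_ifs <;> simp

lemma nd_nmk (n : ℕ) (x : C _⦋n + 1⦌) :
    ((normalizedComplex (underlyingModule C)).d (n + 1) n).hom (nmk C (n + 1) x) =
      ∑ i ∈ Finset.range (n + 2), (-1 : R) ^ i • nact C (natδ i) x := by
  rw [Finset.sum_range]
  refine (normalizedComplex_d (underlyingModule C) n x).trans ?_
  refine Finset.sum_congr rfl fun i _ => ?_
  congr 1
  have : natδ (n := n) i = SimplexCategory.δ i := by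
    rw [natδ]; congr 1; exact Fin.ext (Nat.mod_eq_of_lt i.2)
  rw [this]
  rfl

lemma nd_nact (n m : ℕ) (α : ⦋n + 1⦌ ⟶ ⦋m⦌) (x : C _⦋m⦌) :
    ((normalizedComplex (underlyingModule C)).d (n + 1) n).hom (nact C α x) =
      ∑ i ∈ Finset.range (n + 2), (-1 : R) ^ i • nact C (natδ i ≫ α) x := by
  simp only [nact_comp]
  exact nd_nmk C n _

lemma hom_ext_val {m n : ℕ} {f g : ⦋m⦌ ⟶ ⦋n⦌}
    (h : ∀ j, (f.toOrderHom j : ℕ) = g.toOrderHom j) : f = g :=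
  SimplexCategory.Hom.ext _ _ (OrderHom.ext _ _ (funext fun j => Fin.ext (h j)))

lemma awComul_leibniz (p q n : ℕ) (h : p + q = n)
    (x : (normalizedComplex (underlyingModule C)).X (n + 1)) :
    awComul C p q n (((normalizedComplex (underlyingModule C)).d (n + 1) n).hom x) =
      ((normalizedComplex (underlyingModule C)).d (p + 1) p).hom.rTensor _
          (awComul C (p + 1) q (n + 1) x) +
        (-1 : R) ^ p • ((normalizedComplex (underlyingModule C)).d (q + 1) q).hom.lTensor _
          (awComul C p (q + 1) (n + 1) x) := by
  obtain ⟨x, rfl⟩ := nmk_surjective C (n + 1) x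
  rw [awComul_nmk C (by omega), awComul_nmk C (by omega), nd_nmk]
  have hL : awComul C p q n (∑ i ∈ Finset.range (n + 2), (-1 : R) ^ i • nact C (natδ i) x) =
      ∑ i ∈ Finset.range (n + 2), (-1 : R) ^ i •
        nactPair C (frontFace (show p ≤ n by omega) ≫ natδ i) (lastFace h ≫ natδ i) x := by
    rw [map_sum]
    refine Finset.sum_congr rfl fun i _ => ?_
    rw [map_smul, nactPair_comp, ← awComul_nmk C h]
    rfl
  have hR : ∀ (α : ⦋p + 1⦌ ⟶ ⦋n + 1⦌) (β : ⦋q⦌ ⟶ ⦋n + 1⦌),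
      ((normalizedComplex (underlyingModule C)).d (p + 1) p).hom.rTensor _ (nactPair C α β x) =
        ∑ i ∈ Finset.range (p + 2), (-1 : R) ^ i • nactPair C (natδ i ≫ α) β x := by
    intro α β
    simp only [nactPair, LinearMap.comp_apply]
    generalize (Coalgebra.comul (R := R) x) = w
    induction w using TensorProduct.induction_on with
    | zero => simp
    | add a b ha hb => simp only [map_add, ha, hb, smul_add, Finset.sum_add_distrib]
    | tmul a b =>
      simp only [TensorProduct.map_tmul, LinearMap.rTensor_tmul, nd_nact, TensorProduct.sum_tmul,
        TensorProduct.smul_tmul']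
  have hR' : ∀ (α : ⦋p⦌ ⟶ ⦋n + 1⦌) (β : ⦋q + 1⦌ ⟶ ⦋n + 1⦌),
      ((normalizedComplex (underlyingModule C)).d (q + 1) q).hom.lTensor _ (nactPair C α β x) =
        ∑ i ∈ Finset.range (q + 2), (-1 : R) ^ i • nactPair C α (natδ i ≫ β) x := by
    intro α β
    simp only [nactPair, LinearMap.comp_apply]
    generalize (Coalgebra.comul (R := R) x) = w
    induction w using TensorProduct.induction_on with
    | zero => simp
    | add a b ha hb => simp only [map_add, ha, hb, smul_add, Finset.sum_add_distrib]
    | tmul a b =>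
      simp only [TensorProduct.map_tmul, LinearMap.lTensor_tmul, nd_nact, TensorProduct.tmul_sum,
        TensorProduct.tmul_smul]
  rw [hL, hR, hR']
  have e1 : ∀ i ∈ Finset.range (p + 1), (-1 : R) ^ i •
      nactPair C (frontFace (show p ≤ n by omega) ≫ natδ i) (lastFace h ≫ natδ i) x =
      (-1 : R) ^ i • nactPair C (natδ i ≫ frontFace (show p + 1 ≤ n + 1 by omega))
        (lastFace (show p + 1 + q = n + 1 by omega)) x := by
    intro i hi
    have hi := Finset.mem_range.1 hi
    congr 2
    congr 1
    · refine hom_ext_val fun j => ?_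
      change ((natδ (n := n) i).toOrderHom _ : ℕ) = ((natδ (n := p) i).toOrderHom j : ℕ) + 0
      rw [natδ_apply i (by omega), natδ_apply i (by omega)]
      rfl
    · refine hom_ext_val fun j => ?_
      change ((natδ (n := n) i).toOrderHom _ : ℕ) = (j : ℕ) + (p + 1)
      rw [natδ_apply i (by omega)]
      change (if (j : ℕ) + p < i then (j : ℕ) + p else (j : ℕ) + p + 1) = _
      rw [if_neg (by omega)]
      rfl
  have e2 : ∀ i ∈ Finset.range (q + 1), (-1 : R) ^ (p + 1 + i) •
      nactPair C (frontFace (show p ≤ n by omega) ≫ natδ (p + 1 + i))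
        (lastFace h ≫ natδ (p + 1 + i)) x =
      (-1 : R) ^ p • (-1 : R) ^ (i + 1) • nactPair C (frontFace (show p ≤ n + 1 by omega))
        (natδ (i + 1) ≫ lastFace (show p + (q + 1) = n + 1 by omega)) x := by
    intro i hi
    have hi := Finset.mem_range.1 hi
    rw [smul_smul, ← pow_add, show p + 1 + i = p + (i + 1) by ring]
    congr 2
    congr 1
    · refine hom_ext_val fun j => ?_
      change ((natδ (n := n) _).toOrderHom _ : ℕ) = (j : ℕ) + 0
      rw [natδ_apply _ (by omega)]
      have := j.2
      simp only [SimplexCategory.len_mk] at this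
      change (if (j : ℕ) + 0 < p + (i + 1) then (j : ℕ) + 0 else (j : ℕ) + 0 + 1) = _
      rw [if_pos (by omega)]
    · refine hom_ext_val fun j => ?_
      change ((natδ (n := n) _).toOrderHom _ : ℕ) = ((natδ (n := q) (i + 1)).toOrderHom j : ℕ) + p
      rw [natδ_apply _ (by omega), natδ_apply _ (by omega)]
      change (if (j : ℕ) + p < p + (i + 1) then (j : ℕ) + p else (j : ℕ) + p + 1) = _
      split_ifs <;> omega
  have e3 : nactPair C (natδ (p + 1) ≫ frontFace (show p + 1 ≤ n + 1 by omega))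
        (lastFace (show p + 1 + q = n + 1 by omega)) x =
      nactPair C (frontFace (show p ≤ n + 1 by omega))
        (natδ 0 ≫ lastFace (show p + (q + 1) = n + 1 by omega)) x := by
    congr 1
    congr 1
    · refine hom_ext_val fun j => ?_
      change ((natδ (n := p) _).toOrderHom _ : ℕ) + 0 = (j : ℕ) + 0
      rw [natδ_apply _ (by omega)]
      have := j.2
      simp only [SimplexCategory.len_mk] at this
      rw [if_pos (by omega)]
    · refine hom_ext_val fun j => ?_
      change (j : ℕ) + (p + 1) = ((natδ (n := q) 0).toOrderHom j : ℕ) + p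
      rw [natδ_apply _ (by omega), if_neg (by omega)]
      omega
  rw [show n + 2 = (p + 1) + (q + 1) by omega, Finset.sum_range_add, Finset.sum_congr rfl e1,
    Finset.sum_congr rfl e2, Finset.sum_range_succ _ (p + 1), Finset.sum_range_succ' _ (q + 1),
    smul_add, Finset.smul_sum, e3, pow_succ]
  simp only [pow_zero, one_smul, mul_neg, mul_one, neg_smul]
  abel

lemma awComul_coassoc (a b c n : ℕ) (h : a + b + c = n)
    (x : (normalizedComplex (underlyingModule C)).X n) :
    TensorProduct.assoc R _ _ _ ((awComul C a b (a + b)).rTensor _ (awComul C (a + b) c n x)) =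
      (awComul C b c (b + c)).lTensor _ (awComul C a (b + c) n x) := by
  obtain ⟨x, rfl⟩ := nmk_surjective C n x
  rw [awComul_nmk C h, awComul_nmk C (show a + (b + c) = n by omega)]
  have hL : ∀ (α : ⦋a + b⦌ ⟶ ⦋n⦌) (β : ⦋c⦌ ⟶ ⦋n⦌) (w : C _⦋n⦌ ⊗[R] C _⦋n⦌),
      (awComul C a b (a + b)).rTensor _ (TensorProduct.map (nact C α) (nact C β) w) =
      TensorProduct.map (nactPair C (frontFace (by omega) ≫ α) (lastFace rfl ≫ α)) (nact C β) w := by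
    intro α β w
    rw [LinearMap.rTensor, TensorProduct.map_map]
    congr 2
    ext y
    rw [nactPair_comp, ← awComul_nmk C rfl]
    rfl
  have hR : ∀ (α : ⦋a⦌ ⟶ ⦋n⦌) (β : ⦋b + c⦌ ⟶ ⦋n⦌) (w : C _⦋n⦌ ⊗[R] C _⦋n⦌),
      (awComul C b c (b + c)).lTensor _ (TensorProduct.map (nact C α) (nact C β) w) =
      TensorProduct.map (nact C α) (nactPair C (frontFace (by omega) ≫ β) (lastFace rfl ≫ β)) w := by
    intro α β w
    rw [LinearMap.lTensor, TensorProduct.map_map]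
    congr 2
    ext y
    rw [nactPair_comp, ← awComul_nmk C rfl]
    rfl
  conv_lhs => rw [nactPair, LinearMap.comp_apply, hL]
  conv_rhs => rw [nactPair, LinearMap.comp_apply, hR]
  have f1 : frontFace (show a ≤ a + b by omega) ≫ frontFace (show a + b ≤ n by omega) =
      frontFace (show a ≤ n by omega) := hom_ext_val fun j => rfl
  have f2 : lastFace (show a + b = a + b from rfl) ≫ frontFace (show a + b ≤ n by omega) =
      frontFace (show b ≤ b + c by omega) ≫ lastFace (show a + (b + c) = n by omega) :=
    hom_ext_val fun j => rfl
  have f3 : lastFace (show b + c = b + c from rfl) ≫ lastFace (show a + (b + c) = n by omega) =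
      lastFace h := hom_ext_val fun j => by
    change (j : ℕ) + b + a = (j : ℕ) + (a + b)
    omega
  rw [f1, f2, f3]
  simp only [nactPair]
  rw [← LinearMap.comp_id (nact C (lastFace h)), TensorProduct.map_comp,
    ← LinearMap.comp_id (nact C (frontFace (show a ≤ n by omega))), TensorProduct.map_comp,
    LinearMap.comp_apply, LinearMap.comp_apply, LinearMap.comp_id, LinearMap.comp_id]
  change _ = TensorProduct.map _ _ (Coalgebra.comul.lTensor _ _)
  rw [← Coalgebra.coassoc_apply]
  change TensorProduct.assoc R _ _ _ (TensorProduct.map (TensorProduct.map _ _) _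
    (Coalgebra.comul.rTensor _ _)) = _
  generalize (Coalgebra.comul.rTensor _ (Coalgebra.comul (R := R) x)) = w
  exact LinearMap.congr_fun (TensorProduct.map_map_comp_assoc_eq _ _ _).symm w

/-- A simplicial coalgebra is connected if there is an isomorphism of coalgebras `C_0 ≅ R`. -/
def IsConnectedCoalg : Prop := Nonempty ((C _⦋0⦌ : Type v) ≃ₗc[R] R)

/-- The counit of normalized chains, induced by the counit of `C_0`. -/
def ncounit : (normalizedComplex (underlyingModule C)).X 0 →ₗ[R] R :=
  nlift C Coalgebra.counit (fun x hx => by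
    obtain rfl : x = 0 := hx
    exact map_zero _)

lemma ncounit_nact {n : ℕ} (α : ⦋0⦌ ⟶ ⦋n⦌) :
    ncounit C ∘ₗ nact C α = (Coalgebra.counit : (C _⦋n⦌ : Type v) →ₗ[R] R) := by
  ext y
  exact CoalgHomClass.counit_comp_apply (act C α) y

/-- The dg coalgebra of normalized chains on a connected simplicial coalgebra. -/
def normalizedCoalg (hC : IsConnectedCoalg C) : ConnDGCoalg.{u, v} R where
  cx := normalizedComplex (underlyingModule C)
  comul := awComul C
  counit := ncounit C
  comul_shape p q n h := dif_neg h
  leibniz := awComul_leibniz C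
  coassoc := awComul_coassoc C
  counit_d x := by
    obtain ⟨x, rfl⟩ := nmk_surjective C 1 x
    rw [nd_nmk, map_sum]
    have h : ∀ i, ncounit C (nact C (natδ i) x) = Coalgebra.counit x := fun i =>
      LinearMap.congr_fun (ncounit_nact C (natδ i)) x
    simp only [map_smul, h]
    simp [Finset.sum_range_succ]
  counit_left n x := by
    obtain ⟨x, rfl⟩ := nmk_surjective C n x
    rw [awComul_nmk C (by omega), nactPair, LinearMap.comp_apply, LinearMap.rTensor,
      TensorProduct.map_map]
    have h2 : nact C (lastFace (Nat.zero_add n)) = nmk C n := by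
      have : lastFace (Nat.zero_add n) = 𝟙 ⦋n⦌ := hom_ext_val fun j => rfl
      rw [this]
      ext y
      exact congrArg (nmk C n) (act_id C y)
    rw [ncounit_nact, LinearMap.id_comp, h2]
    have h3 := congrArg (TensorProduct.map LinearMap.id (nmk C n))
      (Coalgebra.rTensor_counit_comul (R := R) x)
    rw [LinearMap.rTensor, TensorProduct.map_map] at h3
    simp only [LinearMap.id_comp, LinearMap.comp_id] at h3
    rw [h3]
    simp
  counit_right n x := by
    obtain ⟨x, rfl⟩ := nmk_surjective C n x
    rw [awComul_nmk C (by omega), nactPair, LinearMap.comp_apply, LinearMap.lTensor,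
      TensorProduct.map_map]
    have h2 : nact C (frontFace (le_refl n)) = nmk C n := by
      have : frontFace (le_refl n) = 𝟙 ⦋n⦌ := hom_ext_val fun j => rfl
      rw [this]
      ext y
      exact congrArg (nmk C n) (act_id C y)
    rw [ncounit_nact, LinearMap.id_comp, h2]
    have h3 := congrArg (TensorProduct.map (nmk C n) LinearMap.id)
      (Coalgebra.lTensor_counit_comul (R := R) x)
    rw [LinearMap.lTensor, TensorProduct.map_map] at h3
    simp only [LinearMap.id_comp, LinearMap.comp_id] at h3
    rw [h3]
    simp
  connected := by
    obtain ⟨e⟩ := hC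
    have h : ∀ y : C _⦋0⦌, e y = Coalgebra.counit (R := R) y := fun y => by
      have := CoalgHomClass.counit_comp_apply e y
      simpa using this
    constructor
    · intro x y hxy
      obtain ⟨x, rfl⟩ := nmk_surjective C 0 x
      obtain ⟨y, rfl⟩ := nmk_surjective C 0 y
      exact congrArg _ (e.injective ((h x).trans (hxy.trans (h y).symm)))
    · intro r
      exact ⟨nmk C 0 (e.symm r), (h _).symm.trans (e.apply_symm_apply r)⟩

variable {C} {C' : SimplicialObject (CoalgCat.{v} R)}

/-- The map of simplicial modules underlying a map of simplicial coalgebras. -/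
abbrev underlyingMap (f : C ⟶ C') : underlyingModule C ⟶ underlyingModule C' :=
  ((SimplicialObject.whiskering (CoalgCat.{v} R) (ModuleCat.{v} R)).obj
    (forget₂ (CoalgCat.{v} R) (ModuleCat.{v} R))).map f

/-- The components of a map of simplicial coalgebras. -/
def comp (f : C ⟶ C') (n : ℕ) : C _⦋n⦌ →ₗc[R] C' _⦋n⦌ :=
  (f.app (Opposite.op ⦋n⦌)).toCoalgHom

lemma comp_act (f : C ⟶ C') {m n : ℕ} (φ : ⦋m⦌ ⟶ ⦋n⦌) (x : C _⦋n⦌) :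
    comp f m (act C φ x) = act C' φ (comp f n x) :=
  DFunLike.congr_fun (congrArg CoalgCat.Hom.toCoalgHom (f.naturality φ.op)) x

/-- The morphism of dg coalgebras of normalized chains induced by a map of connected simplicial
coalgebras. -/
def normalizedCoalgMap (hC : IsConnectedCoalg C) (hC' : IsConnectedCoalg C') (f : C ⟶ C') :
    ConnDGCoalg.Hom (normalizedCoalg C hC) (normalizedCoalg C' hC') where
  f := normalizedMap (underlyingMap f)
  comul_comm p q n x := by
    obtain ⟨x, rfl⟩ := nmk_surjective C n x
    by_cases h : p + q = n
    · change awComul C' p q n (nmk C' n (comp f n x)) = TensorProduct.map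
        ((normalizedMap (underlyingMap f)).f p).hom ((normalizedMap (underlyingMap f)).f q).hom
        (awComul C p q n (nmk C n x))
      rw [awComul_nmk C h, awComul_nmk C' h, nactPair, nactPair, LinearMap.comp_apply,
        LinearMap.comp_apply, ← CoalgHomClass.map_comp_comul_apply (comp f n) x,
        TensorProduct.map_map, TensorProduct.map_map]
      have hn : ∀ {r : ℕ} (α : ⦋r⦌ ⟶ ⦋n⦌), nact C' α ∘ₗ (comp f n : _ →ₗ[R] _) =
          ((normalizedMap (underlyingMap f)).f r).hom ∘ₗ nact C α := by
        intro r α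
        ext y
        exact congrArg (nmk C' r) (comp_act f α y).symm
      rw [← hn, ← hn]
    · have e1 : awComul C p q n = 0 := dif_neg h
      have e2 : awComul C' p q n = 0 := dif_neg h
      change awComul C' p q n _ = TensorProduct.map
        ((normalizedMap (underlyingMap f)).f p).hom ((normalizedMap (underlyingMap f)).f q).hom
        (awComul C p q n _)
      rw [e1, e2]
      simp only [LinearMap.zero_apply, map_zero]
      rfl
  counit_comm x := by
    obtain ⟨x, rfl⟩ := nmk_surjective C 0 x
    exact CoalgHomClass.counit_comp_apply (comp f 0) x

end NormalizedCoalgebra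

section Twisted

open Coalgebra

variable {R : Type*} [CommRing R]
variable {X Y Z A : Type*} [AddCommGroup X] [Module R X] [Coalgebra R X]
  [AddCommGroup Y] [Module R Y] [Coalgebra R Y] [AddCommGroup Z] [Module R Z] [Coalgebra R Z]
  [Ring A]

/-- The convolution product `x ↦ ∑ f x' * g x''` of linear maps from a coalgebra to an algebra. -/
def convMul [Algebra R A] (f g : X →ₗ[R] A) : X →ₗ[R] A :=
  LinearMap.mul' R A ∘ₗ TensorProduct.map f g ∘ₗ comul

lemma convMul_comp [Algebra R A] (f g : Y →ₗ[R] A) (h : X →ₗc[R] Y) :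
    convMul f g ∘ₗ (h : X →ₗ[R] Y) =
      convMul (f ∘ₗ (h : X →ₗ[R] Y)) (g ∘ₗ (h : X →ₗ[R] Y)) := by
  rw [convMul, convMul, TensorProduct.map_comp, LinearMap.comp_assoc, LinearMap.comp_assoc,
    LinearMap.comp_assoc, CoalgHomClass.map_comp_comul]

/-- If `d : X → Y` is a coalgebra map to a cocommutative coalgebra and
`t ∘ d = (t ∘ a) * (t ∘ b)`, then the same is true for `(t ⊗ t) ∘ Δ` in place of `t`. -/
lemma convMul_comul [Algebra R A] [IsCocomm R X] (a b d : X →ₗc[R] Y) (t : Y →ₗ[R] A)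
    (h : t ∘ₗ (d : X →ₗ[R] Y) = convMul (t ∘ₗ (a : X →ₗ[R] Y)) (t ∘ₗ (b : X →ₗ[R] Y))) :
    (TensorProduct.map t t ∘ₗ comul) ∘ₗ (d : X →ₗ[R] Y) =
      convMul ((TensorProduct.map t t ∘ₗ comul) ∘ₗ (a : X →ₗ[R] Y))
        ((TensorProduct.map t t ∘ₗ comul) ∘ₗ (b : X →ₗ[R] Y)) := by
  have e : ∀ c : X →ₗc[R] Y, (TensorProduct.map t t ∘ₗ comul) ∘ₗ (c : X →ₗ[R] Y) =
      TensorProduct.map (t ∘ₗ (c : X →ₗ[R] Y)) (t ∘ₗ (c : X →ₗ[R] Y)) ∘ₗ comul := by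
    intro c
    rw [LinearMap.comp_assoc, ← CoalgHomClass.map_comp_comul, ← LinearMap.comp_assoc,
      ← TensorProduct.map_comp]
  rw [e, e, e, h]
  set f := t ∘ₗ (a : X →ₗ[R] Y)
  set g := t ∘ₗ (b : X →ₗ[R] Y)
  ext x
  have hc := CoalgHomClass.map_comp_comul_apply (comulCoalgHom R X) x
  change TensorProduct.map comul comul (comul x) =
    TensorProduct.AlgebraTensorModule.tensorTensorTensorComm R R R R X X X X
      (TensorProduct.map comul comul (comul x)) at hc
  have hL : ∀ w : X ⊗[R] X, TensorProduct.map (convMul f g) (convMul f g) w =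
      TensorProduct.map (LinearMap.mul' R A ∘ₗ TensorProduct.map f g)
        (LinearMap.mul' R A ∘ₗ TensorProduct.map f g) (TensorProduct.map comul comul w) := by
    intro w
    rw [TensorProduct.map_map]
    rfl
  have hR : ∀ w : X ⊗[R] X, TensorProduct.map (TensorProduct.map f f ∘ₗ comul)
      (TensorProduct.map g g ∘ₗ comul) w = TensorProduct.map (TensorProduct.map f f)
        (TensorProduct.map g g) (TensorProduct.map comul comul w) := by
    intro w
    rw [TensorProduct.map_map]
  change TensorProduct.map (convMul f g) (convMul f g) (comul x) =
    LinearMap.mul' R (A ⊗[R] A) (TensorProduct.map (TensorProduct.map f f ∘ₗ comul)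
      (TensorProduct.map g g ∘ₗ comul) (comul x))
  rw [hL, hR]
  conv_lhs => rw [hc]
  generalize TensorProduct.map comul comul (comul (R := R) x) = w
  have key : (TensorProduct.map (LinearMap.mul' R A ∘ₗ TensorProduct.map f g)
        (LinearMap.mul' R A ∘ₗ TensorProduct.map f g)) ∘ₗ
      (TensorProduct.AlgebraTensorModule.tensorTensorTensorComm R R R R X X X X).toLinearMap =
      LinearMap.mul' R (A ⊗[R] A) ∘ₗ TensorProduct.map (TensorProduct.map f f)
        (TensorProduct.map g g) := by
    ext a b c d
    simp
  exact LinearMap.congr_fun key w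

variable [Bialgebra R A]

/-- The coalgebra map `X ⊗ A → Y ⊗ A`, `x ⊗ g ↦ ∑ h x' ⊗ g * t x''`, for coalgebra maps
`h : X → Y` and `t : X → A`, where `X` is cocommutative. -/
def twistedMap [IsCocomm R X] (h : X →ₗc[R] Y) (t : X →ₗc[R] A) : X ⊗[R] A →ₗc[R] Y ⊗[R] A :=
  (Coalgebra.TensorProduct.map h
      (((Bialgebra.mulCoalgHom R A).comp
        (Bialgebra.TensorProduct.comm R A A : A ⊗[R] A →ₗc[R] A ⊗[R] A)).comp
          (Coalgebra.TensorProduct.map t (CoalgHom.id R A)))).comp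
    ((Coalgebra.TensorProduct.assoc R R X X A : (X ⊗[R] X) ⊗[R] A →ₗc[R] X ⊗[R] (X ⊗[R] A)).comp
      (Coalgebra.TensorProduct.map (comulCoalgHom R X) (CoalgHom.id R A)))

lemma twistedMap_tmul [IsCocomm R X] (h : X →ₗc[R] Y) (t : X →ₗc[R] A) (x : X) (g : A) :
    twistedMap h t (x ⊗ₜ[R] g) =
      TensorProduct.map (h : X →ₗ[R] Y) (LinearMap.mulLeft R g ∘ₗ (t : X →ₗ[R] A)) (comul x) := by
  change Coalgebra.TensorProduct.map h _ (Coalgebra.TensorProduct.assoc R R X X A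
    (comul (R := R) x ⊗ₜ[R] g)) = _
  generalize comul (R := R) x = w
  induction w using TensorProduct.induction_on with
  | zero => simp
  | add a b ha hb => simp only [map_add, TensorProduct.add_tmul, ha, hb]
  | tmul a b =>
    rfl

lemma twistedMap_comp [IsCocomm R X] [IsCocomm R Y] (h : X →ₗc[R] Y) (t : X →ₗc[R] A)
    (h' : Y →ₗc[R] Z) (t' : Y →ₗc[R] A) (s : X →ₗc[R] A)
    (hs : ∀ x, convMul (t : X →ₗ[R] A) (t'.comp h : X →ₗ[R] A) x = s x) :
    (twistedMap h' t').comp (twistedMap h t) = twistedMap (h'.comp h) s := by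
  refine CoalgHom.coe_linearMap_injective (TensorProduct.ext' fun x g => ?_)
  change twistedMap h' t' (twistedMap h t (x ⊗ₜ[R] g)) = twistedMap (h'.comp h) s (x ⊗ₜ[R] g)
  rw [twistedMap_tmul, twistedMap_tmul]
  let F : X ⊗[R] (X ⊗[R] X) →ₗ[R] Z ⊗[R] A :=
    TensorProduct.map ((h'.comp h : X →ₗc[R] Z) : X →ₗ[R] Z) (LinearMap.mulLeft R g ∘ₗ
      LinearMap.mul' R A ∘ₗ TensorProduct.map (t : X →ₗ[R] A) (t'.comp h : X →ₗ[R] A))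
  have h1 : ∀ a b : X, twistedMap h' t' (h a ⊗ₜ[R] (g * t b)) =
      F (TensorProduct.map LinearMap.id (TensorProduct.comm R X X).toLinearMap
        (TensorProduct.assoc R X X X (comul a ⊗ₜ[R] b))) := by
    intro a b
    rw [twistedMap_tmul, ← CoalgHomClass.map_comp_comul_apply h a, TensorProduct.map_map]
    generalize comul (R := R) a = w
    induction w using TensorProduct.induction_on with
    | zero => simp
    | add u v hu hv => simp only [map_add, TensorProduct.add_tmul, hu, hv]
    | tmul u v =>
      simp [F]
  have h2 : ∀ w : X ⊗[R] X, twistedMap h' t' (TensorProduct.map (h : X →ₗ[R] Y)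
      (LinearMap.mulLeft R g ∘ₗ (t : X →ₗ[R] A)) w) =
      F (TensorProduct.map LinearMap.id (TensorProduct.comm R X X).toLinearMap
        (TensorProduct.assoc R X X X (comul.rTensor X w))) := by
    intro w
    induction w using TensorProduct.induction_on with
    | zero => simp
    | add u v hu hv => simp only [map_add, hu, hv]
    | tmul u v => exact h1 u v
  have h3 : ∀ w : X ⊗[R] X, F (TensorProduct.map LinearMap.id
      (TensorProduct.comm R X X).toLinearMap (comul.lTensor X w)) =
      TensorProduct.map ((h'.comp h : X →ₗc[R] Z) : X →ₗ[R] Z)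
        (LinearMap.mulLeft R g ∘ₗ (s : X →ₗ[R] A)) w := by
    intro w
    induction w using TensorProduct.induction_on with
    | zero => simp
    | add u v hu hv => simp only [map_add, hu, hv]
    | tmul u v =>
      have e : TensorProduct.comm R X X (comul (R := R) v) = comul v := comm_comul R v
      have e' := hs v
      simp only [convMul, LinearMap.comp_apply] at e'
      simp only [F, LinearMap.lTensor_tmul, TensorProduct.map_tmul, LinearMap.id_apply,
        LinearEquiv.coe_coe, e, LinearMap.comp_apply]
      exact congrArg (fun z => h' (h u) ⊗ₜ[R] (g * z)) e'
  rw [h2, coassoc_apply, h3]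

lemma twistedMap_counit [IsCocomm R X] (h : X →ₗc[R] Y) (t : X →ₗc[R] A)
    (ht : ∀ x, t x = algebraMap R A (counit x)) (x : X) (g : A) :
    twistedMap h t (x ⊗ₜ[R] g) = h x ⊗ₜ[R] g := by
  rw [twistedMap_tmul]
  have e : TensorProduct.map (h : X →ₗ[R] Y) (LinearMap.mulLeft R g ∘ₗ (t : X →ₗ[R] A)) =
      TensorProduct.map (h : X →ₗ[R] Y) (LinearMap.toSpanSingleton R A g) ∘ₗ
        TensorProduct.map LinearMap.id (counit : X →ₗ[R] R) := by
    rw [← TensorProduct.map_comp]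
    congr 1
    ext y
    simp [ht, Algebra.smul_def, Algebra.commutes]
  rw [e, LinearMap.comp_apply]
  have h3 := Coalgebra.lTensor_counit_comul (R := R) x
  rw [LinearMap.lTensor] at h3
  rw [h3]
  simp

lemma twistedMap_natural {X' Y' A' : Type*} [AddCommGroup X'] [Module R X'] [Coalgebra R X']
    [AddCommGroup Y'] [Module R Y'] [Coalgebra R Y'] [Ring A'] [Bialgebra R A']
    [IsCocomm R X] [IsCocomm R X'] (h : X →ₗc[R] Y) (t : X →ₗc[R] A) (h' : X' →ₗc[R] Y')
    (t' : X' →ₗc[R] A') (k : X →ₗc[R] X') (l : Y →ₗc[R] Y') (p : A →ₐc[R] A')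
    (hh : ∀ x, l (h x) = h' (k x)) (ht : ∀ x, p (t x) = t' (k x)) :
    (Coalgebra.TensorProduct.map l (p : A →ₗc[R] A')).comp (twistedMap h t) =
      (twistedMap h' t').comp (Coalgebra.TensorProduct.map k (p : A →ₗc[R] A')) := by
  refine CoalgHom.coe_linearMap_injective (TensorProduct.ext' fun x g => ?_)
  change Coalgebra.TensorProduct.map l (p : A →ₗc[R] A') (twistedMap h t (x ⊗ₜ[R] g)) =
    twistedMap h' t' (k x ⊗ₜ[R] p g)
  rw [twistedMap_tmul, twistedMap_tmul, ← CoalgHomClass.map_comp_comul_apply k x]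
  generalize comul (R := R) x = w
  induction w using TensorProduct.induction_on with
  | zero => simp
  | add u v hu hv => simp only [map_add, hu, hv]
  | tmul u v =>
    change l (h u) ⊗ₜ[R] p (g * t v) = h' (k u) ⊗ₜ[R] (p g * t' (k v))
    rw [hh, map_mul, ht]

end Twisted

section FundamentalBialgebra

variable {R : Type u} [CommRing R] (C : SimplicialObject (CoalgCat.{v} R))

lemma frontFace_one_two : frontFace (show 1 ≤ 2 by omega) = natδ 2 :=
  hom_ext_val fun j => by rw [natδ_apply _ (by omega)]; fin_cases j <;> rfl

lemma lastFace_one_two : lastFace (show 1 + 1 = 2 by omega) = natδ 0 :=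
  hom_ext_val fun j => by rw [natδ_apply _ (by omega)]; fin_cases j <;> rfl

/-- The face `d_i : C_2 → C_1`. -/
def face₂ (i : ℕ) : C _⦋2⦌ →ₗc[R] C _⦋1⦌ := act C (natδ i)

lemma cobar_relation {B : Type*} [Ring B] [Algebra R B]
    (g : (normalizedComplex (underlyingModule C)).X 1 →ₗ[R] B) (G : (C _⦋1⦌ : Type v) →ₗ[R] B)
    (hG : ∀ x : C _⦋1⦌, g (nmk C 1 x) = G x - algebraMap R B (Coalgebra.counit x)) (z : C _⦋2⦌) :
    g (((normalizedComplex (underlyingModule C)).d 2 1).hom (nmk C 2 z)) +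
        ConnDGCoalg.sq g (awComul C 1 1 2 (nmk C 2 z)) =
      convMul (G ∘ₗ (face₂ C 2).toLinearMap)
        (G ∘ₗ (face₂ C 0).toLinearMap) z -
          G (face₂ C 1 z) := by
  have hε : ∀ i (y : C _⦋2⦌), Coalgebra.counit (R := R) (face₂ C i y) =
      Coalgebra.counit y := fun i y => CoalgHomClass.counit_comp_apply _ y
  have hg : ∀ i (y : C _⦋2⦌), g (nact C (natδ (n := 1) i) y) =
      G (face₂ C i y) - algebraMap R B (Coalgebra.counit y) := fun i y => by
    rw [← hε i y]
    exact hG _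
  have hf : ∀ i (y : C _⦋2⦌), (face₂ C i).toLinearMap y = face₂ C i y := fun i y => rfl
  have h1 : ∀ w : (C _⦋2⦌ : Type v) ⊗[R] (C _⦋2⦌ : Type v),
      ConnDGCoalg.sq g (TensorProduct.map (nact C (natδ 2)) (nact C (natδ 0)) w) =
      LinearMap.mul' R B (TensorProduct.map
        (G ∘ₗ (face₂ C 2).toLinearMap)
        (G ∘ₗ (face₂ C 0).toLinearMap) w) -
      G (face₂ C 2 (TensorProduct.rid R _ (Coalgebra.counit.lTensor _ w))) -
      G (face₂ C 0 (TensorProduct.lid R _ (Coalgebra.counit.rTensor _ w))) +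
      algebraMap R B (Coalgebra.counit (TensorProduct.rid R _ (Coalgebra.counit.lTensor _ w))) := by
    intro w
    induction w using TensorProduct.induction_on with
    | zero => simp
    | add u v hu hv => simp only [map_add, hu, hv]; abel
    | tmul u v =>
      simp only [ConnDGCoalg.sq, LinearMap.comp_apply, TensorProduct.map_tmul,
        LinearMap.mul'_apply, hg, LinearMap.lTensor_tmul, LinearMap.rTensor_tmul,
        TensorProduct.rid_tmul, TensorProduct.lid_tmul, map_smul, Algebra.smul_def,
        map_mul, Algebra.algebraMap_self, RingHom.id_apply, hf]
      rw [sub_mul, mul_sub, mul_sub, Algebra.commutes (Coalgebra.counit (R := R) v),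
        Algebra.commutes (Coalgebra.counit (R := R) v)]
      abel
  rw [awComul_nmk C rfl, frontFace_one_two, lastFace_one_two, nactPair, LinearMap.comp_apply, h1,
    Coalgebra.lTensor_counit_comul, Coalgebra.rTensor_counit_comul, nd_nmk, map_sum]
  simp only [map_smul, hg, Finset.sum_range_succ, Finset.sum_range_zero, TensorProduct.rid_tmul,
    TensorProduct.lid_tmul, one_smul, convMul, LinearMap.comp_apply]
  simp only [pow_zero, one_smul, pow_one, neg_smul, Nat.reduceAdd, neg_one_sq]
  abel

variable (hC : IsConnectedCoalg C)

/-- The algebra `π(C) = H_0 (Ω N_* C)`. -/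
def FundBialg : Type (max u v) := (normalizedCoalg C hC).HZero

namespace FundBialg

instance : Ring (FundBialg C hC) := inferInstanceAs (Ring (normalizedCoalg C hC).HZero)

instance : Algebra R (FundBialg C hC) := inferInstanceAs (Algebra R (normalizedCoalg C hC).HZero)

/-- The map `x ↦ [{x}]` from normalized `1`-chains to `π(C)`. -/
def cls : (normalizedComplex (underlyingModule C)).X 1 →ₗ[R] FundBialg C hC :=
  (normalizedCoalg C hC).cls

/-- The map `C_1 → π(C)`, `x ↦ [{x}] + ε(x) e`. -/
def edge : (C _⦋1⦌ : Type v) →ₗ[R] FundBialg C hC :=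
  cls C hC ∘ₗ nmk C 1 + Algebra.linearMap R (FundBialg C hC) ∘ₗ Coalgebra.counit

lemma cls_nmk (x : C _⦋1⦌) : cls C hC (nmk C 1 x) =
    edge C hC x - algebraMap R (FundBialg C hC) (Coalgebra.counit x) := by
  simp [edge]

lemma edge_face_one :
    edge C hC ∘ₗ (face₂ C 1).toLinearMap =
      convMul (edge C hC ∘ₗ (face₂ C 2).toLinearMap)
        (edge C hC ∘ₗ (face₂ C 0).toLinearMap) := by
  ext z
  have h := cobar_relation C (cls C hC) (edge C hC) (cls_nmk C hC) z
  have h' : cls C hC (((normalizedComplex (underlyingModule C)).d 2 1).hom (nmk C 2 z)) +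
        ConnDGCoalg.sq (cls C hC) (awComul C 1 1 2 (nmk C 2 z)) = 0 :=
    (normalizedCoalg C hC).cls_rel (nmk C 2 z)
  rw [h'] at h
  exact (sub_eq_zero.1 h.symm).symm

lemma edge_degenerate (y : C _⦋0⦌) (j : Fin 1) : edge C hC (act C (SimplexCategory.σ j) y) =
    algebraMap R (FundBialg C hC) (Coalgebra.counit y) := by
  have h : nmk C 1 (act C (SimplexCategory.σ j) y) = 0 :=
    toNormalized_eq_zero _ (Submodule.mem_iSup_of_mem j ⟨y, rfl⟩)
  have e : Coalgebra.counit (R := R) (act C (SimplexCategory.σ j) y) = Coalgebra.counit y :=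
    CoalgHomClass.counit_comp_apply _ y
  simp [edge, h, e]

section lift

variable {C hC} {B : Type*} [Ring B] [Algebra R B]

lemma algHom_ext {f g : FundBialg C hC →ₐ[R] B}
    (h : ∀ x : C _⦋1⦌, f (edge C hC x) = g (edge C hC x)) : f = g := by
  refine ConnDGCoalg.HZero.algHom_ext (K := normalizedCoalg C hC) fun x => ?_
  obtain ⟨x, rfl⟩ := nmk_surjective C 1 x
  change f (cls C hC (nmk C 1 x)) = g (cls C hC (nmk C 1 x))
  rw [cls_nmk, map_sub, map_sub, h, AlgHom.commutes, AlgHom.commutes]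

variable (G : (C _⦋1⦌ : Type v) →ₗ[R] B)
  (h0 : ∀ (j : Fin 1) (y : C _⦋0⦌),
    G (act C (SimplexCategory.σ j) y) = algebraMap R B (Coalgebra.counit y))
  (h1 : G ∘ₗ (face₂ C 1).toLinearMap =
      convMul (G ∘ₗ (face₂ C 2).toLinearMap)
        (G ∘ₗ (face₂ C 0).toLinearMap))

/-- The algebra map `π(C) → B` with `[{x}] + ε(x) e ↦ G x` for all `x` in `C_1`, where
`G (s_0 y) = ε(y) 1` and `G (d_1 z) = ∑ G (d_2 z') G (d_0 z'')`. -/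
def lift : FundBialg C hC →ₐ[R] B :=
  ConnDGCoalg.HZero.lift (K := normalizedCoalg C hC)
    (nlift C (G - Algebra.linearMap R B ∘ₗ Coalgebra.counit)
      (linearMap_ndeg C _ fun j y => by
        have e : Coalgebra.counit (R := R) (act C (SimplexCategory.σ j) y) = Coalgebra.counit y :=
          CoalgHomClass.counit_comp_apply _ y
        simp [h0, e]))
    (fun y => by
      obtain ⟨z, rfl⟩ := nmk_surjective C 2 y
      refine (cobar_relation C _ G (fun x => rfl) z).trans ?_
      rw [← h1]
      exact sub_self _)

lemma lift_edge (x : C _⦋1⦌) : lift (hC := hC) G h0 h1 (edge C hC x) = G x := by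
  have h : lift (hC := hC) G h0 h1 (cls C hC (nmk C 1 x)) =
      G x - algebraMap R B (Coalgebra.counit x) :=
    ConnDGCoalg.HZero.lift_cls _ _ _
  rw [cls_nmk, map_sub, AlgHom.commutes] at h
  exact sub_left_injective h

end lift

end FundBialg
end FundamentalBialgebra

section UniversalCover

open Coalgebra

variable {R : Type u} [CommRing R] (C : SimplicialObject (CoalgCat.{v} R))
  (hC : IsConnectedCoalg C) [∀ n : ℕ, IsCocomm R (C _⦋n⦌ : Type v)]

namespace FundBialg

/-- The coproduct of `π(C)`; see `comul_cls` for its values on the classes `[{x}]`. -/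
def comulAlg : FundBialg C hC →ₐ[R] FundBialg C hC ⊗[R] FundBialg C hC :=
  lift (TensorProduct.map (edge C hC) (edge C hC) ∘ₗ comul)
    (fun j y => by
      have h : ∀ w : (C _⦋0⦌ : Type v) ⊗[R] (C _⦋0⦌ : Type v),
          TensorProduct.map (edge C hC) (edge C hC) (TensorProduct.map
            (act C (SimplexCategory.σ j) : (C _⦋0⦌ : Type v) →ₗ[R] (C _⦋1⦌ : Type v))
            (act C (SimplexCategory.σ j) : (C _⦋0⦌ : Type v) →ₗ[R] (C _⦋1⦌ : Type v)) w) =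
          algebraMap R _ (counit (TensorProduct.rid R _ (counit.lTensor _ w))) := by
        intro w
        induction w using TensorProduct.induction_on with
        | zero => simp
        | add u v hu hv => simp only [map_add, hu, hv]
        | tmul u v =>
          change edge C hC (act C (SimplexCategory.σ j) u) ⊗ₜ[R]
            edge C hC (act C (SimplexCategory.σ j) v) = _
          rw [edge_degenerate, edge_degenerate]
          simp [Algebra.algebraMap_eq_smul_one,
            TensorProduct.smul_tmul', TensorProduct.tmul_smul, smul_smul,
            Algebra.TensorProduct.one_def]
      rw [LinearMap.comp_apply, ← CoalgHomClass.map_comp_comul_apply, h, lTensor_counit_comul]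
      simp)
    (convMul_comul (face₂ C 2) (face₂ C 0) (face₂ C 1) (edge C hC) (edge_face_one C hC))

/-- The counit of `π(C)`, which is zero on the classes `[{x}]`; see `counit_cls`. -/
def counitAlg : FundBialg C hC →ₐ[R] R :=
  lift counit (fun j y => CoalgHomClass.counit_comp_apply _ y) (by
    have e : ∀ i, counit ∘ₗ (face₂ C i).toLinearMap = counit (R := R) := fun i =>
      (face₂ C i).counit_comp
    rw [e, e, e]
    ext x
    have h : ∀ w : (C _⦋2⦌ : Type v) ⊗[R] (C _⦋2⦌ : Type v),
        LinearMap.mul' R R (TensorProduct.map counit counit w) =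
          counit (TensorProduct.rid R _ (counit.lTensor _ w)) := by
      intro w
      induction w using TensorProduct.induction_on with
      | zero => simp
      | add u v hu hv => simp only [map_add, hu, hv]
      | tmul u v => simp [mul_comm]
    rw [convMul, LinearMap.comp_apply, LinearMap.comp_apply, h, lTensor_counit_comul]
    simp)

lemma comulAlg_edge (x : C _⦋1⦌) : comulAlg C hC (edge C hC x) =
    TensorProduct.map (edge C hC) (edge C hC) (comul x) :=
  lift_edge _ _ _ x

lemma counitAlg_edge (x : C _⦋1⦌) : counitAlg C hC (edge C hC x) = counit x :=
  lift_edge _ _ _ x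

/-- The bialgebra structure of `π(C)`. -/
instance : Bialgebra R (FundBialg C hC) :=
  Bialgebra.ofAlgHom (comulAlg C hC) (counitAlg C hC)
    (algHom_ext fun x => by
      have hL : ∀ w : (C _⦋1⦌ : Type v) ⊗[R] (C _⦋1⦌ : Type v), TensorProduct.assoc R _ _ _
          (Algebra.TensorProduct.map (comulAlg C hC) (.id R (FundBialg C hC))
            (TensorProduct.map (edge C hC) (edge C hC) w)) =
          TensorProduct.map (edge C hC) (TensorProduct.map (edge C hC) (edge C hC))
            (TensorProduct.assoc R _ _ _ (comul.rTensor _ w)) := by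
        intro w
        induction w using TensorProduct.induction_on with
        | zero => simp
        | add u v hu hv => simp only [map_add, hu, hv]
        | tmul u v =>
          change TensorProduct.assoc R _ _ _
            (comulAlg C hC (edge C hC u) ⊗ₜ[R] edge C hC v) =
              TensorProduct.map _ _ (TensorProduct.assoc R _ _ _ (comul (R := R) u ⊗ₜ[R] v))
          rw [comulAlg_edge]
          generalize comul (R := R) u = z
          induction z using TensorProduct.induction_on with
          | zero => simp
          | add a b ha hb => simp only [map_add, TensorProduct.add_tmul, ha, hb]
          | tmul a b => rfl
      have hR : ∀ w : (C _⦋1⦌ : Type v) ⊗[R] (C _⦋1⦌ : Type v),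
          Algebra.TensorProduct.map (.id R (FundBialg C hC)) (comulAlg C hC)
            (TensorProduct.map (edge C hC) (edge C hC) w) =
          TensorProduct.map (edge C hC) (TensorProduct.map (edge C hC) (edge C hC))
            (comul.lTensor _ w) := by
        intro w
        induction w using TensorProduct.induction_on with
        | zero => simp
        | add u v hu hv => simp only [map_add, hu, hv]
        | tmul u v =>
          change edge C hC u ⊗ₜ[R] comulAlg C hC (edge C hC v) = _
          rw [comulAlg_edge]
          rfl
      change TensorProduct.assoc R _ _ _
        (Algebra.TensorProduct.map (comulAlg C hC) (.id R (FundBialg C hC))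
          (comulAlg C hC (edge C hC x))) =
        Algebra.TensorProduct.map (.id R (FundBialg C hC)) (comulAlg C hC)
          (comulAlg C hC (edge C hC x))
      rw [comulAlg_edge, hL, hR, coassoc_apply])
    (algHom_ext fun x => by
      have h : ∀ w : (C _⦋1⦌ : Type v) ⊗[R] (C _⦋1⦌ : Type v),
          Algebra.TensorProduct.map (counitAlg C hC) (.id R (FundBialg C hC))
            (TensorProduct.map (edge C hC) (edge C hC) w) =
          TensorProduct.map LinearMap.id (edge C hC) (counit.rTensor _ w) := by
        intro w
        induction w using TensorProduct.induction_on with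
        | zero => simp
        | add u v hu hv => simp only [map_add, hu, hv]
        | tmul u v =>
          change counitAlg C hC (edge C hC u) ⊗ₜ[R] edge C hC v = _
          rw [counitAlg_edge]
          rfl
      change Algebra.TensorProduct.map (counitAlg C hC) (.id R (FundBialg C hC))
        (comulAlg C hC (edge C hC x)) = 1 ⊗ₜ[R] edge C hC x
      rw [comulAlg_edge, h, rTensor_counit_comul]
      rfl)
    (algHom_ext fun x => by
      have h : ∀ w : (C _⦋1⦌ : Type v) ⊗[R] (C _⦋1⦌ : Type v),
          Algebra.TensorProduct.map (.id R (FundBialg C hC)) (counitAlg C hC)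
            (TensorProduct.map (edge C hC) (edge C hC) w) =
          TensorProduct.map (edge C hC) LinearMap.id (counit.lTensor _ w) := by
        intro w
        induction w using TensorProduct.induction_on with
        | zero => simp
        | add u v hu hv => simp only [map_add, hu, hv]
        | tmul u v =>
          change edge C hC u ⊗ₜ[R] counitAlg C hC (edge C hC v) = _
          rw [counitAlg_edge]
          rfl
      change Algebra.TensorProduct.map (.id R (FundBialg C hC)) (counitAlg C hC)
        (comulAlg C hC (edge C hC x)) = edge C hC x ⊗ₜ[R] 1
      rw [comulAlg_edge, h, lTensor_counit_comul]
      rfl)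

lemma comul_edge (x : C _⦋1⦌) : comul (R := R) (edge C hC x) =
    TensorProduct.map (edge C hC) (edge C hC) (comul x) :=
  comulAlg_edge C hC x

lemma counit_edge (x : C _⦋1⦌) : counit (R := R) (edge C hC x) = counit (R := R) x :=
  counitAlg_edge C hC x

/-- `∇ [{x}] = ∑ [{x'}] ⊗ [{x''}] + 1 ⊗ [{x}] + [{x}] ⊗ 1`. -/
lemma comul_cls (x : C _⦋1⦌) : comul (R := R) (cls C hC (nmk C 1 x)) =
    TensorProduct.map (cls C hC ∘ₗ nmk C 1) (cls C hC ∘ₗ nmk C 1) (comul x) +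
      1 ⊗ₜ[R] cls C hC (nmk C 1 x) + cls C hC (nmk C 1 x) ⊗ₜ[R] 1 := by
  have h : ∀ w : (C _⦋1⦌ : Type v) ⊗[R] (C _⦋1⦌ : Type v),
      TensorProduct.map (edge C hC) (edge C hC) w =
      TensorProduct.map (cls C hC ∘ₗ nmk C 1) (cls C hC ∘ₗ nmk C 1) w +
      1 ⊗ₜ[R] cls C hC (nmk C 1 (TensorProduct.lid R _ (counit.rTensor _ w))) +
      cls C hC (nmk C 1 (TensorProduct.rid R _ (counit.lTensor _ w))) ⊗ₜ[R] 1 +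
      algebraMap R _ (counit (TensorProduct.rid R _ (counit.lTensor _ w))) := by
    intro w
    induction w using TensorProduct.induction_on with
    | zero => simp
    | add u v hu hv =>
      simp only [map_add, hu, hv, TensorProduct.add_tmul, TensorProduct.tmul_add]
      abel
    | tmul u v =>
      simp only [TensorProduct.map_tmul, edge, LinearMap.add_apply, LinearMap.comp_apply,
        Algebra.linearMap_apply, Algebra.algebraMap_eq_smul_one, LinearMap.rTensor_tmul,
        LinearMap.lTensor_tmul, TensorProduct.lid_tmul, TensorProduct.rid_tmul, map_smul,
        TensorProduct.add_tmul, TensorProduct.tmul_add, ← TensorProduct.smul_tmul',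
        TensorProduct.tmul_smul, smul_add, smul_smul, smul_eq_mul, Algebra.TensorProduct.one_def]
      abel
  have e : comul (R := R) (algebraMap R (FundBialg C hC) (counit x)) =
      algebraMap R (FundBialg C hC ⊗[R] FundBialg C hC) (counit x) := by
    simp
  conv_lhs => rw [cls_nmk, map_sub, comul_edge, h, lTensor_counit_comul, rTensor_counit_comul, e]
  simp

lemma counit_cls (x : C _⦋1⦌) : counit (R := R) (cls C hC (nmk C 1 x)) = 0 := by
  rw [cls_nmk, map_sub, counit_edge, Bialgebra.counit_algebraMap, sub_self]

instance : IsCocomm R (FundBialg C hC) where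
  comm_comp_comul := by
    have h : (Algebra.TensorProduct.comm R (FundBialg C hC) (FundBialg C hC)).toAlgHom.comp
        (comulAlg C hC) = comulAlg C hC := algHom_ext fun x => by
      change TensorProduct.comm R _ _ (comulAlg C hC (edge C hC x)) = _
      rw [comulAlg_edge]
      conv_rhs => rw [← comm_comul R x]
      generalize comul (R := R) x = w
      induction w using TensorProduct.induction_on with
      | zero => simp
      | add u v hu hv => simp only [map_add, hu, hv]
      | tmul u v => rfl
    exact congrArg AlgHom.toLinearMap h

/-- The coalgebra map `C_1 → π(C)`, `x ↦ [{x}] + ε(x) e`. -/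
def edgeHom : C _⦋1⦌ →ₗc[R] FundBialg C hC where
  toLinearMap := edge C hC
  counit_comp := LinearMap.ext (counit_edge C hC)
  map_comp_comul := LinearMap.ext fun x => (comul_edge C hC x).symm

/-- For `i ≤ j` in `[n]`, the map which sends an `n`-simplex `x` to the element
`[{e}] + ε(e) e` of `π(C)`, where `e` is the edge of `x` from `i` to `j`. -/
def edgeOf {n : ℕ} (i j : Fin (n + 1)) (h : i ≤ j) : C _⦋n⦌ →ₗc[R] FundBialg C hC :=
  (edgeHom C hC).comp (act C (SimplexCategory.mkOfLe i j h))

lemma edgeOf_act {m n : ℕ} (φ : ⦋m⦌ ⟶ ⦋n⦌) (i j : Fin (m + 1)) (h : i ≤ j) (x : C _⦋n⦌) :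
    edgeOf C hC i j h (act C φ x) =
      edgeOf C hC (φ.toOrderHom i) (φ.toOrderHom j) (φ.toOrderHom.monotone h) x := by
  change edgeHom C hC (act C _ (act C φ x)) = edgeHom C hC (act C _ x)
  rw [← act_comp]
  have e : SimplexCategory.mkOfLe i j h ≫ φ = SimplexCategory.mkOfLe (φ.toOrderHom i)
      (φ.toOrderHom j) (φ.toOrderHom.monotone h) :=
    SimplexCategory.Hom.ext_one_left _ _ rfl rfl
  rw [e]

lemma edgeOf_self {n : ℕ} (i : Fin (n + 1)) (x : C _⦋n⦌) :
    edgeOf C hC i i le_rfl x = algebraMap R (FundBialg C hC) (counit x) := by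
  have h : SimplexCategory.mkOfLe i i le_rfl =
      SimplexCategory.σ 0 ≫ SimplexCategory.const ⦋0⦌ ⦋n⦌ i :=
    SimplexCategory.Hom.ext_one_left _ _ rfl rfl
  change edge C hC (act C _ x) = _
  rw [h, act_comp, edge_degenerate]
  congr 1
  exact CoalgHomClass.counit_comp_apply _ x

lemma edgeOf_trans {n : ℕ} (i j k : Fin (n + 1)) (h₁ : i ≤ j) (h₂ : j ≤ k) (x : C _⦋n⦌) :
    convMul (edgeOf C hC i j h₁ : (C _⦋n⦌ : Type v) →ₗ[R] FundBialg C hC)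
      (edgeOf C hC j k h₂ : (C _⦋n⦌ : Type v) →ₗ[R] FundBialg C hC) x =
      edgeOf C hC i k (h₁.trans h₂) x := by
  let θ : ⦋2⦌ ⟶ ⦋n⦌ := SimplexCategory.mkOfLeComp i j k h₁ h₂
  have e2 : natδ 2 ≫ θ = SimplexCategory.mkOfLe i j h₁ :=
    SimplexCategory.Hom.ext_one_left _ _ rfl rfl
  have e1 : natδ 1 ≫ θ = SimplexCategory.mkOfLe i k (h₁.trans h₂) :=
    SimplexCategory.Hom.ext_one_left _ _ rfl rfl
  have e0 : natδ 0 ≫ θ = SimplexCategory.mkOfLe j k h₂ :=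
    SimplexCategory.Hom.ext_one_left _ _ rfl rfl
  have hm : ∀ w : (C _⦋n⦌ : Type v) ⊗[R] (C _⦋n⦌ : Type v),
      TensorProduct.map (edgeOf C hC i j h₁ : (C _⦋n⦌ : Type v) →ₗ[R] FundBialg C hC)
        (edgeOf C hC j k h₂ : (C _⦋n⦌ : Type v) →ₗ[R] FundBialg C hC) w =
      TensorProduct.map (edge C hC ∘ₗ (face₂ C 2).toLinearMap)
        (edge C hC ∘ₗ (face₂ C 0).toLinearMap) (TensorProduct.map
          (act C θ : (C _⦋n⦌ : Type v) →ₗ[R] (C _⦋2⦌ : Type v))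
          (act C θ : (C _⦋n⦌ : Type v) →ₗ[R] (C _⦋2⦌ : Type v)) w) := by
    intro w
    rw [TensorProduct.map_map]
    congr 2
    · ext y
      change edge C hC (act C _ y) = edge C hC (act C (natδ 2) (act C θ y))
      rw [← act_comp, e2]
    · ext y
      change edge C hC (act C _ y) = edge C hC (act C (natδ 0) (act C θ y))
      rw [← act_comp, e0]
  have h := LinearMap.congr_fun (edge_face_one C hC) (act C θ x)
  simp only [convMul, LinearMap.comp_apply] at h ⊢
  rw [hm, CoalgHomClass.map_comp_comul_apply, ← h]
  change edge C hC (act C (natδ 1) (act C θ x)) = edge C hC (act C _ x)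
  rw [← act_comp, e1]

end FundBialg

end UniversalCover

section UniversalCover

open Coalgebra

variable {R : Type u} [CommRing R]

section obj

variable (C : SimplicialObject (CoalgCat.{v} R)) (hC : IsConnectedCoalg C)
  [∀ n : ℕ, IsCocomm R (C _⦋n⦌ : Type v)]

/-- The fundamental twisting cochain `τ : C_n → π(C)`, `τ(x) = [{d_2 ⋯ d_n x}] + ε(x) e`, for
`n ≥ 1`, where `d_2 ⋯ d_n x` is the front `1`-face of `x`. -/
def twistingCochain (n : ℕ) : (C _⦋n + 1⦌ : Type v) →ₗ[R] FundBialg C hC :=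
  FundBialg.cls C hC ∘ₗ nact C (frontFace (show 1 ≤ n + 1 by omega)) +
    Algebra.linearMap R (FundBialg C hC) ∘ₗ counit

/-- The operator `C_n ⊗ π(C) → C_m ⊗ π(C)` of the universal cover which is induced by
`φ : [m] ⟶ [n]`.  It sends `x ⊗ g` to `∑ φ^* x' ⊗ g * ([{e''}] + ε(e'') 1)`, where `e''` is the
edge of `x''` from the vertex `0` to the vertex `φ 0`.  See `coverMap_δ_zero`, `coverMap_δ_succ`
and `coverMap_σ` for faces and degeneracies. -/
def coverMap {m n : ℕ} (φ : ⦋m⦌ ⟶ ⦋n⦌) :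
    C _⦋n⦌ ⊗[R] FundBialg C hC →ₗc[R] C _⦋m⦌ ⊗[R] FundBialg C hC :=
  twistedMap (act C φ) (FundBialg.edgeOf C hC 0 (φ.toOrderHom 0) (Fin.zero_le _))

lemma coverMap_of_zero {m n : ℕ} (φ : ⦋m⦌ ⟶ ⦋n⦌) (h : φ.toOrderHom 0 = 0) (x : C _⦋n⦌)
    (g : FundBialg C hC) : coverMap C hC φ (x ⊗ₜ[R] g) = act C φ x ⊗ₜ[R] g := by
  refine twistedMap_counit _ _ (fun y => ?_) x g
  have e : ∀ (j : Fin (n + 1)) (hj : j = 0), FundBialg.edgeOf C hC 0 j (Fin.zero_le _) y =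
      algebraMap R (FundBialg C hC) (counit y) := by
    rintro j rfl
    exact FundBialg.edgeOf_self C hC 0 y
  exact e _ h

lemma coverMap_id (n : ℕ) : coverMap C hC (𝟙 ⦋n⦌) = CoalgHom.id R _ := by
  refine CoalgHom.coe_linearMap_injective (TensorProduct.ext' fun x g => ?_)
  refine (coverMap_of_zero C hC _ rfl x g).trans ?_
  rw [act_id]
  rfl

lemma coverMap_comp {l m n : ℕ} (ψ : ⦋l⦌ ⟶ ⦋m⦌) (φ : ⦋m⦌ ⟶ ⦋n⦌) :
    coverMap C hC (ψ ≫ φ) = (coverMap C hC ψ).comp (coverMap C hC φ) := by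
  have e : act C (ψ ≫ φ) = (act C ψ).comp (act C φ) := CoalgHom.ext (act_comp C ψ φ)
  rw [coverMap, e]
  refine (twistedMap_comp _ _ _ _ _ fun x => ?_).symm
  have h : (FundBialg.edgeOf C hC 0 (ψ.toOrderHom 0) (Fin.zero_le _)).comp (act C φ) =
      FundBialg.edgeOf C hC (φ.toOrderHom 0) (φ.toOrderHom (ψ.toOrderHom 0))
        (φ.toOrderHom.monotone (Fin.zero_le _)) :=
    CoalgHom.ext fun y => FundBialg.edgeOf_act C hC φ _ _ (Fin.zero_le _) y
  rw [h, FundBialg.edgeOf_trans]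
  rfl

/-- `d_0 (x ⊗ g) = ∑ d_0 x' ⊗ g * τ(x'')`. -/
lemma coverMap_δ_zero (n : ℕ) (x : C _⦋n + 1⦌) (g : FundBialg C hC) :
    coverMap C hC (SimplexCategory.δ 0) (x ⊗ₜ[R] g) =
      TensorProduct.map (act C (SimplexCategory.δ (n := n) 0)).toLinearMap
        (LinearMap.mulLeft R g ∘ₗ twistingCochain C hC n) (comul x) := by
  refine (twistedMap_tmul _ _ x g).trans ?_
  congr 3
  refine LinearMap.ext fun y => ?_
  have h : SimplexCategory.mkOfLe 0
      ((SimplexCategory.δ (0 : Fin (n + 2))).toOrderHom 0) (Fin.zero_le _) =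
      frontFace (show 1 ≤ n + 1 by omega) :=
    SimplexCategory.Hom.ext_one_left _ _ rfl rfl
  change FundBialg.edge C hC (act C (SimplexCategory.mkOfLe 0
      ((SimplexCategory.δ (0 : Fin (n + 2))).toOrderHom 0) (Fin.zero_le _)) y) = _
  rw [h]
  have e : counit (R := R) (act C (frontFace (show 1 ≤ n + 1 by omega)) y) = counit y :=
    CoalgHomClass.counit_comp_apply _ y
  change _ + algebraMap R (FundBialg C hC) (counit (R := R)
    (act C (frontFace (show 1 ≤ n + 1 by omega)) y)) = _
  rw [e]
  rfl

/-- `d_i (x ⊗ g) = d_i x ⊗ g` for `i ≥ 1`. -/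
lemma coverMap_δ_succ (n : ℕ) (i : Fin (n + 1)) (x : C _⦋n + 1⦌) (g : FundBialg C hC) :
    coverMap C hC (SimplexCategory.δ i.succ) (x ⊗ₜ[R] g) =
      act C (SimplexCategory.δ i.succ) x ⊗ₜ[R] g :=
  coverMap_of_zero C hC _ (by
    change i.succ.succAbove 0 = 0
    exact Fin.succ_succAbove_zero i) x g

/-- `s_j (x ⊗ g) = s_j x ⊗ g`. -/
lemma coverMap_σ (n : ℕ) (j : Fin (n + 1)) (x : C _⦋n⦌) (g : FundBialg C hC) :
    coverMap C hC (SimplexCategory.σ j) (x ⊗ₜ[R] g) =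
      act C (SimplexCategory.σ j) x ⊗ₜ[R] g :=
  coverMap_of_zero C hC _ (by
    change Fin.predAbove j 0 = 0
    simp) x g

/-- The simplicial coalgebra `C ⊗_τ π(C)`. -/
def coverObj : SimplicialObject (CoalgCat.{max u v} R) where
  obj Δ := CoalgCat.of R (C _⦋Δ.unop.len⦌ ⊗[R] FundBialg C hC)
  map {Δ Δ'} φ := CoalgCat.ofHom (coverMap C hC (m := Δ'.unop.len) (n := Δ.unop.len) φ.unop)
  map_id Δ := CoalgCat.hom_ext _ _ (coverMap_id C hC Δ.unop.len)
  map_comp φ ψ := CoalgCat.hom_ext _ _ (coverMap_comp C hC ψ.unop φ.unop)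

instance (n : ℕ) : IsCocomm R (coverObj C hC _⦋n⦌ : Type (max u v)) :=
  inferInstanceAs (IsCocomm R (C _⦋n⦌ ⊗[R] FundBialg C hC))

end obj

section map

variable {C C' C'' : SimplicialObject (CoalgCat.{v} R)} (hC : IsConnectedCoalg C)
  (hC' : IsConnectedCoalg C') (hC'' : IsConnectedCoalg C'')
  [∀ n : ℕ, IsCocomm R (C _⦋n⦌ : Type v)] [∀ n : ℕ, IsCocomm R (C' _⦋n⦌ : Type v)]
  [∀ n : ℕ, IsCocomm R (C'' _⦋n⦌ : Type v)]

namespace FundBialg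

/-- The algebra map `π(f) : π(C) → π(C')`, `[{x}] ↦ [{f x}]`. -/
def mapAlg (f : C ⟶ C') : FundBialg C hC →ₐ[R] FundBialg C' hC' :=
  lift (edge C' hC' ∘ₗ (comp f 1 : (C _⦋1⦌ : Type v) →ₗ[R] (C' _⦋1⦌ : Type v)))
    (fun j y => by
      have e : counit (R := R) (comp f 0 y) = counit y := CoalgHomClass.counit_comp_apply _ y
      change edge C' hC' (comp f 1 (act C _ y)) = _
      rw [comp_act, edge_degenerate, e])
    (by
      have h : ∀ i, (edge C' hC' ∘ₗ (comp f 1 : (C _⦋1⦌ : Type v) →ₗ[R] (C' _⦋1⦌ : Type v))) ∘ₗ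
          (face₂ C i).toLinearMap = (edge C' hC' ∘ₗ (face₂ C' i).toLinearMap) ∘ₗ
            (comp f 2 : (C _⦋2⦌ : Type v) →ₗ[R] (C' _⦋2⦌ : Type v)) := by
        intro i
        ext y
        exact congrArg (edge C' hC') (comp_act f (natδ i) y)
      change (edge C' hC' ∘ₗ (comp f 1 : (C _⦋1⦌ : Type v) →ₗ[R] (C' _⦋1⦌ : Type v))) ∘ₗ
          (face₂ C 1).toLinearMap = _
      rw [h, h, h, edge_face_one]
      exact convMul_comp _ _ _)

lemma mapAlg_edge (f : C ⟶ C') (x : C _⦋1⦌) :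
    mapAlg hC hC' f (edge C hC x) = edge C' hC' (comp f 1 x) :=
  lift_edge _ _ _ x

lemma mapAlg_cls (f : C ⟶ C') (x : C _⦋1⦌) :
    mapAlg hC hC' f (cls C hC (nmk C 1 x)) = cls C' hC' (nmk C' 1 (comp f 1 x)) := by
  have e : counit (R := R) (comp f 1 x) = counit x := CoalgHomClass.counit_comp_apply _ x
  rw [cls_nmk, cls_nmk, map_sub, mapAlg_edge, AlgHom.commutes, e]

/-- The bialgebra map `π(f) : π(C) → π(C')`. -/
def map (f : C ⟶ C') : FundBialg C hC →ₐc[R] FundBialg C' hC' :=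
  BialgHom.ofAlgHom (mapAlg hC hC' f)
    (algHom_ext fun x => by
      change counit (R := R) (mapAlg hC hC' f (edge C hC x)) = counit (R := R) (edge C hC x)
      rw [mapAlg_edge, counit_edge, counit_edge]
      exact CoalgHomClass.counit_comp_apply _ x)
    (algHom_ext fun x => by
      change TensorProduct.map (mapAlg hC hC' f).toLinearMap (mapAlg hC hC' f).toLinearMap
        (comul (R := R) (edge C hC x)) = comul (R := R) (mapAlg hC hC' f (edge C hC x))
      rw [mapAlg_edge, comul_edge, comul_edge, ← CoalgHomClass.map_comp_comul_apply,
        TensorProduct.map_map, TensorProduct.map_map]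
      have e : (mapAlg hC hC' f).toLinearMap ∘ₗ edge C hC =
          edge C' hC' ∘ₗ (comp f 1 : (C _⦋1⦌ : Type v) →ₗ[R] (C' _⦋1⦌ : Type v)) :=
        LinearMap.ext (mapAlg_edge hC hC' f)
      rw [e])

lemma map_edge (f : C ⟶ C') (x : C _⦋1⦌) :
    map hC hC' f (edge C hC x) = edge C' hC' (comp f 1 x) :=
  mapAlg_edge hC hC' f x

lemma map_id (g : FundBialg C hC) : map hC hC (𝟙 C) g = g := by
  have h : mapAlg hC hC (𝟙 C) = AlgHom.id R _ := algHom_ext fun x => mapAlg_edge hC hC (𝟙 C) x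
  exact DFunLike.congr_fun h g

lemma map_comp (f : C ⟶ C') (f' : C' ⟶ C'') (g : FundBialg C hC) :
    map hC hC'' (f ≫ f') g = map hC' hC'' f' (map hC hC' f g) := by
  have h : mapAlg hC hC'' (f ≫ f') = (mapAlg hC' hC'' f').comp (mapAlg hC hC' f) :=
    algHom_ext fun x => by
      rw [AlgHom.comp_apply, mapAlg_edge, mapAlg_edge hC hC', mapAlg_edge]
      rfl
  exact DFunLike.congr_fun h g

end FundBialg

/-- The components `f_n ⊗ π(f)` of the map of universal covers induced by `f`. -/
def coverHom (f : C ⟶ C') (n : ℕ) :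
    C _⦋n⦌ ⊗[R] FundBialg C hC →ₗc[R] C' _⦋n⦌ ⊗[R] FundBialg C' hC' :=
  Coalgebra.TensorProduct.map (comp f n)
    (FundBialg.map hC hC' f : FundBialg C hC →ₗc[R] FundBialg C' hC')

lemma coverHom_id (n : ℕ) : coverHom hC hC (𝟙 C) n = CoalgHom.id R _ := by
  refine CoalgHom.coe_linearMap_injective (TensorProduct.ext' fun x g => ?_)
  change x ⊗ₜ[R] FundBialg.map hC hC (𝟙 C) g = x ⊗ₜ[R] g
  rw [FundBialg.map_id]

lemma coverHom_comp (f : C ⟶ C') (f' : C' ⟶ C'') (n : ℕ) :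
    coverHom hC hC'' (f ≫ f') n = (coverHom hC' hC'' f' n).comp (coverHom hC hC' f n) := by
  refine CoalgHom.coe_linearMap_injective (TensorProduct.ext' fun x g => ?_)
  change comp f' n (comp f n x) ⊗ₜ[R] FundBialg.map hC hC'' (f ≫ f') g =
    comp f' n (comp f n x) ⊗ₜ[R] FundBialg.map hC' hC'' f' (FundBialg.map hC hC' f g)
  rw [FundBialg.map_comp hC hC' hC'']

lemma coverHom_coverMap (f : C ⟶ C') {m n : ℕ} (φ : ⦋m⦌ ⟶ ⦋n⦌) :
    (coverHom hC hC' f m).comp (coverMap C hC φ) =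
      (coverMap C' hC' φ).comp (coverHom hC hC' f n) := by
  refine twistedMap_natural _ _ _ _ _ _ _ (comp_act f φ) (fun x => ?_)
  refine (FundBialg.map_edge hC hC' f _).trans ?_
  exact congrArg (FundBialg.edge C' hC') (comp_act f _ x)

/-- The map of universal covers induced by `f`. -/
def coverObjMap (f : C ⟶ C') : coverObj C hC ⟶ coverObj C' hC' where
  app Δ := CoalgCat.ofHom (coverHom hC hC' f Δ.unop.len)
  naturality _ _ φ := CoalgCat.hom_ext _ _ (coverHom_coverMap hC hC' f φ.unop)

end map

/-- The property of a simplicial coalgebra to be cocommutative. -/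
def cocommProperty (R : Type u) [CommRing R] :
    ObjectProperty (SimplicialObject (CoalgCat.{v} R)) :=
  fun C => ∀ n : ℕ, IsCocomm R (C _⦋n⦌ : Type v)

/-- The property of a simplicial coalgebra to be connected and cocommutative. -/
def connCocommProperty (R : Type u) [CommRing R] :
    ObjectProperty (SimplicialObject (CoalgCat.{v} R)) :=
  fun C => (∀ n : ℕ, IsCocomm R (C _⦋n⦌ : Type v)) ∧ IsConnectedCoalg C

/-- The category of simplicial cocommutative `R`-coalgebras. -/
abbrev SCCoalg (R : Type u) [CommRing R] := (cocommProperty.{u, v} R).FullSubcategory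

/-- The category of connected simplicial cocommutative `R`-coalgebras. -/
abbrev ConnSCCoalg (R : Type u) [CommRing R] := (connCocommProperty.{u, v} R).FullSubcategory

instance (C : ConnSCCoalg.{u, v} R) (n : ℕ) : IsCocomm R (C.obj _⦋n⦌ : Type v) := C.property.1 n

/-- The universal cover functor `C ↦ C ⊗_τ π(C)`. -/
def universalCover (R : Type u) [CommRing R] :
    ConnSCCoalg.{u, v} R ⥤ SCCoalg.{u, max u v} R where
  obj C := ⟨coverObj C.obj C.property.2, fun n => inferInstance⟩
  map {C C'} f := ObjectProperty.homMk (coverObjMap C.property.2 C'.property.2 f.hom)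
  map_id C := by
    refine ObjectProperty.hom_ext _ (NatTrans.ext (funext fun Δ => CoalgCat.hom_ext _ _ ?_))
    exact coverHom_id C.property.2 Δ.unop.len
  map_comp {C C' C''} f f' := by
    refine ObjectProperty.hom_ext _ (NatTrans.ext (funext fun Δ => CoalgCat.hom_ext _ _ ?_))
    exact coverHom_comp C.property.2 C'.property.2 C''.property.2 f.hom f'.hom Δ.unop.len

/-- A map of simplicial cocommutative coalgebras is a quasi-isomorphism if it induces a
quasi-isomorphism of normalized chain complexes. -/
def IsQuasiIso {C C' : SCCoalg.{u, v} R} (f : C ⟶ C') : Prop :=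
  QuasiIso ((normalizedChains R).map (underlyingMap f.hom))

/-- A map of connected simplicial cocommutative coalgebras is an `Ω`-quasi-isomorphism if it
induces a quasi-isomorphism of cobar constructions of the dg coalgebras of normalized chains. -/
def IsOmegaQuasiIso {C C' : ConnSCCoalg.{u, v} R} (f : C ⟶ C') : Prop :=
  (normalizedCoalgMap C.property.2 C'.property.2 f.hom).IsOmegaQuasiIso

/-- A simplicial coalgebra is `R`-flat if each of its terms is a flat `R`-module. -/
def IsFlatCoalg (C : SimplicialObject (CoalgCat.{v} R)) : Prop :=
  ∀ n : ℕ, Module.Flat R (C _⦋n⦌ : Type v)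

end UniversalCover

end SimplicialCoalg

end

-- Write `K` and `K'` for the dg coalgebras of normalized chains, `Ω` for the cobar construction,
-- and `π`, `π'` for the degree zero homology algebras. Normalized chains on a universal cover form
-- a twisted tensor product `π ⊗ K` (`coverEquiv`, `coverEquiv_d`): degeneracies and the faces `d_i`
-- with `i ≥ 1` act on the coalgebra factor alone, and `d_0` contributes the twisting term `g [{x'}]
-- ⊗ x''`. The theorem is thus a comparison theorem for twisted tensor products. Since `Ωf` is an
-- isomorphism on `H_0`, the map `π → π'` is bijective (`bijective_hZero`). It remains to compare `N
-- ⊗ K` with `N ⊗ K'` for the single algebra `N = π'`, where `K` is twisted through `Ωf`.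
--
-- The hypothesis speaks of `Ωf` and not of `f`, so the comparison passes through the larger complex
-- `N ⊗ K ⊗ ΩK' ⊗ K'`, in which adjacent factors are twisted together. The map `diagMap`, `n ⊗ x ↦ ∑
-- n ⊗ x' ⊗ 1 ⊗ f x''`, embeds `N ⊗ K` into it, and there are two ways out.
--
-- The first is the augmentation of `ΩK' ⊗ K'`. This universal twisted tensor product contracts onto
-- `R` (`qi_universal`), so the augmentation is a quasi-isomorphism to `N ⊗ K` (`qi_augTens`). Its
-- composite with `diagMap` is an isomorphism by the counit axiom, hence `diagMap` is a
-- quasi-isomorphism.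
--
-- The second applies the counit to `K` and multiplies `ΩK'` into `N`, with values in `N ⊗ K'`.
-- Filtering by the degree of `K'` reduces the claim to `N ⊗ K ⊗ ΩK' → N` with inert coefficients.
-- For `ΩK` in place of `ΩK'` an explicit contraction proves it (`qi_free`). The two cobar
-- constructions can be exchanged because `Ωf`, a quasi-isomorphism of bounded below complexes of
-- flat modules, remains one after tensoring with any module (`qi_cobar_rTensor`). The composite of
-- `diagMap` with this second map is `1 ⊗ f`, which is therefore a quasi-isomorphism (`qi_totMap`).
--
-- Complexes are replaced by their total modules with an endomorphism, and a quasi-isomorphism is a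
-- map with exact mapping cone (`QI`). Spectral sequence arguments become inductions over triangular
-- differentials (`QI.of_triangular`), and both contractions are instances of `QI.of_twoStep`.

universe w

noncomputable section

namespace DiffMod

/-! ### Quasi-isomorphisms of modules with an endomorphism. -/

section QI

variable {R : Type*} [CommRing R] {X Y Z : Type*} [AddCommGroup X] [Module R X]
  [AddCommGroup Y] [Module R Y] [AddCommGroup Z] [Module R Z]

/-- A map `f` of modules with endomorphisms `D` and `E` is a quasi-isomorphism if its mapping cone
is exact. -/
def QI (D : X →ₗ[R] X) (E : Y →ₗ[R] Y) (f : X →ₗ[R] Y) : Prop :=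
  ∀ x y, D x = 0 → f x = E y → ∃ x' y', x = D x' ∧ y = f x' + E y'

variable {D : X →ₗ[R] X} {E : Y →ₗ[R] Y} {F : Z →ₗ[R] Z} {f : X →ₗ[R] Y} {g : Y →ₗ[R] Z}

/-- This lemma and the next two are the two-out-of-three property. Compatibility with the
differentials is a separate hypothesis because `QI` does not contain it. -/
lemma QI.comp (hf : QI D E f) (hg : QI E F g) (hfD : ∀ x, f (D x) = E (f x))
    (hgE : ∀ y, g (E y) = F (g y)) : QI D F (g ∘ₗ f) := by
  intro x z hx hz
  obtain ⟨y', z', h1, rfl⟩ := hg (f x) z (by rw [← hfD, hx, map_zero]) hz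
  obtain ⟨x', y'', rfl, rfl⟩ := hf x y' hx h1
  exact ⟨x', g y'' + z', rfl, by simp [hgE, add_assoc]⟩

lemma QI.of_comp_left (h : QI D F (g ∘ₗ f)) (hf : QI D E f) (hfD : ∀ x, f (D x) = E (f x))
    (hgE : ∀ y, g (E y) = F (g y)) : QI E F g := by
  intro y z hy hz
  -- Exactness of the cone at the pair `(0, y)` is surjectivity on homology: the cycle `y` is the
  -- image of a cycle `x'` up to a boundary.
  obtain ⟨x', y', h1, rfl⟩ := hf 0 y (map_zero _) (by rw [map_zero, hy])
  obtain ⟨x'', z'', rfl, h3⟩ := h x' (z - g y') h1.symm (by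
    rw [map_sub, ← hz, ← hgE, map_add]; simp)
  exact ⟨f x'' + y', z'', by rw [hfD, map_add], by
    rw [map_add, sub_eq_iff_eq_add.1 h3, LinearMap.comp_apply]
    abel⟩

lemma QI.of_comp_right (h : QI D F (g ∘ₗ f)) (hg : QI E F g) (hfD : ∀ x, f (D x) = E (f x))
    (hgE : ∀ y, g (E y) = F (g y)) : QI D E f := by
  intro x y hx hy
  obtain ⟨x', z', rfl, h2⟩ := h x (g y) hx (by rw [LinearMap.comp_apply, hy, hgE])
  -- The element `y - f x'` is a cycle which `g` sends to the boundary of `z'`. Since `g` is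
  -- injective on homology, it bounds.
  obtain ⟨y', -, h3, -⟩ := hg (y - f x') z' (by rw [map_sub, ← hy, hfD, sub_self]) (by
    rw [map_sub, h2, LinearMap.comp_apply]; abel)
  exact ⟨x', y', rfl, by rw [← h3]; abel⟩

lemma QI.of_bijective (hf : Function.Bijective f) (hfD : ∀ x, f (D x) = E (f x)) : QI D E f := by
  intro x y _ hy
  obtain ⟨w, rfl⟩ := hf.2 y
  exact ⟨w, 0, hf.1 (by rw [hy, hfD]), by simp⟩

/-- Diagonal pieces of twisted differentials carry a sign `(-1)^n`, which this removes. -/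
lemma QI.smul (h : QI D E f) (c : R) (hc : c * c = 1) : QI (c • D) (c • E) f := by
  intro x y hx hy
  have e : ∀ y : Y, c • c • y = y := fun y => by rw [smul_smul, hc, one_smul]
  have e' : ∀ x : X, c • c • x = x := fun x => by rw [smul_smul, hc, one_smul]
  simp only [LinearMap.smul_apply] at hx hy ⊢
  obtain ⟨x', y', rfl, h2⟩ := h x (c • y) (by rw [← e' (D x), hx, smul_zero])
    (by rw [hy, map_smul])
  refine ⟨c • x', y', by rw [map_smul, e'], ?_⟩
  rw [← e y, h2, smul_add, map_smul]

/-- A map to a module with zero differential is a quasi-isomorphism if the source is contracted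
in two steps, along a decomposition whose first projection is `c`. -/
lemma QI.of_twoStep {X₀ : Type*} [AddCommGroup X₀] [Module R X₀] (c : X →ₗ[R] X₀)
    (h : X₀ →ₗ[R] X) (i : Y →ₗ[R] X) (k : X₀ →ₗ[R] X)
    (hDD : ∀ x, D (D x) = 0) (hDi : ∀ y, D (i y) = 0) (hfi : ∀ y, f (i y) = y)
    (h1 : ∀ x, c (D (h (c x))) = c (x - i (f x)))
    (h2 : ∀ x, h (c (D x)) = x + k (c x)) : QI D 0 f := by
  intro x y hx hy
  have hy : f x = 0 := hy
  -- Since `f x = 0`, the identity `h1` shows that subtracting `D (h (c x))` moves `x` into the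
  -- kernel of `c`. The difference is still a cycle, and `h2` forces a cycle in the kernel of `c` to
  -- vanish.
  have e : x - D (h (c x)) = 0 := by
    have e1 : c (x - D (h (c x))) = 0 := by rw [map_sub, h1, hy]; simp
    have e2 := h2 (x - D (h (c x)))
    rw [e1, map_sub, hx, hDD] at e2
    simpa using e2.symm
  -- The second summand is a cycle, so it corrects the image under `f` without changing the
  -- boundary.
  refine ⟨h (c x) + i (y - f (h (c x))), 0, ?_, ?_⟩
  · rw [map_add, hDi, add_zero]; exact sub_eq_zero.1 e
  · rw [map_add, hfi]; simp

end QI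

/-! ### Decompositions into a sequence of modules, and triangular differentials. -/

section Decomp

variable {R : Type*} [CommRing R] {X Y : Type*} [AddCommGroup X] [Module R X]
  [AddCommGroup Y] [Module R Y] {U V : ℕ → Type*} [∀ n, AddCommGroup (U n)] [∀ n, Module R (U n)]
  [∀ n, AddCommGroup (V n)] [∀ n, Module R (V n)]

variable (R X U) in
/-- A decomposition of a module as a direct sum of a sequence of modules. -/
structure Decomp where
  /-- the inclusions -/
  ι : ∀ n, U n →ₗ[R] X
  /-- the projections -/
  π : ∀ n, X →ₗ[R] U n
  π_ι : ∀ n u, π n (ι n u) = u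
  π_ι_ne : ∀ m n u, m ≠ n → π m (ι n u) = 0
  exists_sum : ∀ x, ∃ N, ∀ M, N ≤ M → x = ∑ n ∈ Finset.range M, ι n (π n x)

variable (R U) in
/-- The decomposition of a direct sum. -/
def Decomp.directSum : Decomp R (DirectSum ℕ U) U where
  ι := DirectSum.lof R ℕ U
  π := DirectSum.component R ℕ U
  π_ι n u := DirectSum.component.lof_self R n u
  π_ι_ne m n u h := DirectSum.component.of R _ _ _ |>.trans (dif_neg h.symm)
  exists_sum x := by
    classical
    induction x using DirectSum.induction_on with
    | zero => exact ⟨0, fun M _ => by simp⟩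
    | of n x =>
      refine ⟨n + 1, fun M hM => ?_⟩
      rw [Finset.sum_eq_single n]
      · exact congrArg _ (DirectSum.component.lof_self R n x).symm
      · intro m _ hm
        have : DirectSum.component R ℕ U m (DirectSum.lof R ℕ U n x) = 0 :=
          DirectSum.component.of R _ _ _ |>.trans (dif_neg hm.symm)
        exact (congrArg _ this).trans (map_zero _)
      · intro h; exact absurd (Finset.mem_range.2 hM) h
    -- Asking for the expansion at every large bound, and not at a single one, lets both summands
    -- use the maximum of their bounds.
    | add x y hx hy =>
      obtain ⟨N, hN⟩ := hx
      obtain ⟨N', hN'⟩ := hy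
      refine ⟨max N N', fun M hM => ?_⟩
      simp only [map_add, Finset.sum_add_distrib]
      rw [← hN M ((le_max_left _ _).trans hM), ← hN' M ((le_max_right _ _).trans hM)]

/-- The decomposition of `W ⊗ X` induced by a decomposition of `X`. -/
def Decomp.lTensor (W : Type*) [AddCommGroup W] [Module R W] (P : Decomp R X U) :
    Decomp R (W ⊗[R] X) (fun n => W ⊗[R] U n) where
  ι n := (P.ι n).lTensor W
  π n := (P.π n).lTensor W
  π_ι n u := by
    rw [← LinearMap.lTensor_comp_apply, show P.π n ∘ₗ P.ι n = LinearMap.id from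
      LinearMap.ext (P.π_ι n), LinearMap.lTensor_id, LinearMap.id_apply]
  π_ι_ne m n u h := by
    rw [← LinearMap.lTensor_comp_apply, show P.π m ∘ₗ P.ι n = 0 from
      LinearMap.ext fun u => P.π_ι_ne m n u h, LinearMap.lTensor_zero, LinearMap.zero_apply]
  exists_sum x := by
    induction x using TensorProduct.induction_on with
    | zero => exact ⟨0, fun M _ => by simp⟩
    | tmul w x =>
      obtain ⟨N, hN⟩ := P.exists_sum x
      refine ⟨N, fun M hM => ?_⟩
      conv_lhs => rw [hN M hM, tmul_sum]
      simp
    | add x y hx hy =>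
      obtain ⟨N, hN⟩ := hx
      obtain ⟨N', hN'⟩ := hy
      refine ⟨max N N', fun M hM => ?_⟩
      simp only [map_add, Finset.sum_add_distrib]
      rw [← hN M ((le_max_left _ _).trans hM), ← hN' M ((le_max_right _ _).trans hM)]

/-- The decomposition of `X ⊗ W` induced by a decomposition of `X`. -/
def Decomp.rTensor (W : Type*) [AddCommGroup W] [Module R W] (P : Decomp R X U) :
    Decomp R (X ⊗[R] W) (fun n => U n ⊗[R] W) where
  ι n := (P.ι n).rTensor W
  π n := (P.π n).rTensor W
  π_ι n u := by
    rw [← LinearMap.rTensor_comp_apply, show P.π n ∘ₗ P.ι n = LinearMap.id from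
      LinearMap.ext (P.π_ι n), LinearMap.rTensor_id, LinearMap.id_apply]
  π_ι_ne m n u h := by
    rw [← LinearMap.rTensor_comp_apply, show P.π m ∘ₗ P.ι n = 0 from
      LinearMap.ext fun u => P.π_ι_ne m n u h, LinearMap.rTensor_zero, LinearMap.zero_apply]
  exists_sum x := by
    induction x using TensorProduct.induction_on with
    | zero => exact ⟨0, fun M _ => by simp⟩
    | tmul x w =>
      obtain ⟨N, hN⟩ := P.exists_sum x
      refine ⟨N, fun M hM => ?_⟩
      conv_lhs => rw [hN M hM, sum_tmul]
      simp
    | add x y hx hy =>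
      obtain ⟨N, hN⟩ := hx
      obtain ⟨N', hN'⟩ := hy
      refine ⟨max N N', fun M hM => ?_⟩
      simp only [map_add, Finset.sum_add_distrib]
      rw [← hN M ((le_max_left _ _).trans hM), ← hN' M ((le_max_right _ _).trans hM)]

variable (P : Decomp R X U) (Q : Decomp R Y V)

lemma Decomp.ext_zero {x : X} (h : ∀ n, P.π n x = 0) : x = 0 := by
  obtain ⟨N, hN⟩ := P.exists_sum x
  rw [hN N le_rfl]
  exact Finset.sum_eq_zero fun n _ => by rw [h, map_zero]

lemma Decomp.hom_ext {M : Type*} [AddCommGroup M] [Module R M] {f g : X →ₗ[R] M}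
    (h : ∀ n u, f (P.ι n u) = g (P.ι n u)) : f = g := by
  ext x
  obtain ⟨N, hN⟩ := P.exists_sum x
  rw [hN N le_rfl, map_sum, map_sum]
  exact Finset.sum_congr rfl fun n _ => h n _

lemma Decomp.exists_bound (x : X) : ∃ N, ∀ n, N ≤ n → P.π n x = 0 := by
  obtain ⟨N, hN⟩ := P.exists_sum x
  refine ⟨N, fun n hn => ?_⟩
  rw [hN N le_rfl, map_sum]
  exact Finset.sum_eq_zero fun m hm => P.π_ι_ne _ _ _ (by
    have := Finset.mem_range.1 hm; omega)

/-- `D` is lower triangular with diagonal part `d`. -/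
def Decomp.Triangular (D : X →ₗ[R] X) (d : ∀ n, U n →ₗ[R] U n) : Prop :=
  ∀ n u, P.π n (D (P.ι n u)) = d n u ∧ ∀ m, n < m → P.π m (D (P.ι n u)) = 0

variable {P Q}

/-- Components of `x` above `N` vanish by assumption, and those below `N` do not reach index `N` by
triangularity. Only the diagonal entry at `N` is left. -/
lemma Decomp.Triangular.π_eq {D : X →ₗ[R] X} {d : ∀ n, U n →ₗ[R] U n} (h : P.Triangular D d)
    {N : ℕ} {x : X} (hx : ∀ n, N < n → P.π n x = 0) : P.π N (D x) = d N (P.π N x) := by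
  obtain ⟨M, hM⟩ := P.exists_sum x
  rw [hM (max M (N + 1)) (le_max_left _ _)]
  simp only [map_sum]
  rw [Finset.sum_eq_single N, Finset.sum_eq_single N]
  · rw [P.π_ι, (h N _).1]
  · intro n _ hn; rw [P.π_ι_ne _ _ _ hn.symm, map_zero]
  · intro hn; exact absurd (Finset.mem_range.2 (by omega)) hn
  · intro n _ hn
    rcases lt_or_gt_of_ne hn with hn | hn
    · exact (h n _).2 N hn
    · rw [hx n hn]; simp
  · intro hn; exact absurd (Finset.mem_range.2 (by omega)) hn

/-- A map of modules with triangular differentials is a quasi-isomorphism if it is one on the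
diagonal. -/
lemma QI.of_triangular {D : X →ₗ[R] X} {E : Y →ₗ[R] Y} {f : X →ₗ[R] Y}
    {d : ∀ n, U n →ₗ[R] U n} {e : ∀ n, V n →ₗ[R] V n} {φ : ∀ n, U n →ₗ[R] V n}
    (hD : P.Triangular D d) (hE : Q.Triangular E e) (hDD : ∀ x, D (D x) = 0)
    (hEE : ∀ y, E (E y) = 0) (hfD : ∀ x, f (D x) = E (f x))
    (hf : ∀ n u, f (P.ι n u) = Q.ι n (φ n u)) (h : ∀ n, QI (d n) (e n) (φ n)) : QI D E f := by
  have hπ : ∀ n x, Q.π n (f x) = φ n (P.π n x) := by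
    intro n x
    refine LinearMap.congr_fun (P.hom_ext (f := Q.π n ∘ₗ f) (g := φ n ∘ₗ P.π n) ?_) x
    intro m u
    simp only [LinearMap.comp_apply, hf]
    by_cases hmn : n = m
    · subst hmn; rw [Q.π_ι, P.π_ι]
    · rw [Q.π_ι_ne _ _ _ hmn, P.π_ι_ne _ _ _ hmn, map_zero]
  -- Induction on a common bound for the components of `x` and `y`. It replaces the spectral
  -- sequence of the filtration, and convergence is automatic because each element has finitely many
  -- components.
  have key : ∀ N x y, (∀ n, N ≤ n → P.π n x = 0) → (∀ n, N ≤ n → Q.π n y = 0) → D x = 0 →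
      f x = E y → ∃ x' y', x = D x' ∧ y = f x' + E y' := by
    intro N
    induction N with
    | zero =>
      intro x y hx hy _ _
      exact ⟨0, 0, by simpa using P.ext_zero fun n => hx n (Nat.zero_le n),
        by simpa using Q.ext_zero fun n => hy n (Nat.zero_le n)⟩
    | succ N ih =>
      intro x y hx hy hDx hfx
      obtain ⟨u, w, h1, h2⟩ := h N (P.π N x) (Q.π N y)
        (by rw [← hD.π_eq (fun n hn => hx n hn), hDx, map_zero])
        (by rw [← hπ, hfx, hE.π_eq (fun n hn => hy n hn)])
      have hz : ∀ n, N < n → P.π n (D (P.ι N u)) = 0 := fun n hn => (hD N u).2 n hn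
      have hz' : ∀ n, N < n → Q.π n (E (Q.ι N w)) = 0 := fun n hn => (hE N w).2 n hn
      -- The top components form a cycle in the cone of `φ N`, which bounds `(u, w)`. Subtracting
      -- the boundary of this pair in the full cone kills the components of index `N` and creates
      -- none above.
      obtain ⟨x', y', h3, h4⟩ := ih (x - D (P.ι N u)) (y - (f (P.ι N u) + E (Q.ι N w)))
        (by
          intro n hn
          rcases hn.eq_or_lt with rfl | hn
          · rw [map_sub, (hD N u).1, h1, sub_self]
          · rw [map_sub, hx n hn, hz n hn, sub_zero])
        (by
          intro n hn
          rcases hn.eq_or_lt with rfl | hn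
          · rw [map_sub, map_add, (hE N w).1, hπ, P.π_ι, h2, sub_self]
          · rw [map_sub, map_add, hy n hn, hz' n hn, hπ, P.π_ι_ne _ _ _ hn.ne', map_zero]
            simp)
        (by rw [map_sub, hDx, hDD, sub_zero])
        (by
          have hEE : E (E (Q.ι N w)) = 0 := hEE _
          rw [map_sub, hfx, hfD, map_sub, map_add, hEE, add_zero])
      exact ⟨x' + P.ι N u, y' + Q.ι N w, by rw [map_add, ← h3]; abel, by
        rw [map_add, map_add, sub_eq_iff_eq_add.1 h4]; abel⟩
  intro x y hx hy
  obtain ⟨N, hN⟩ := P.exists_bound x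
  obtain ⟨N', hN'⟩ := Q.exists_bound y
  exact key (max N N') x y (fun n hn => hN n ((le_max_left _ _).trans hn))
    (fun n hn => hN' n ((le_max_right _ _).trans hn)) hx hy

end Decomp
end DiffMod
namespace DiffMod

/-! ### Bounded below exact complexes of flat modules. -/

section Flat

/-- Tensoring with a product splits along the two projections, so injectivity can be tested on each
factor. The terms of mapping cones are such products. -/
lemma flat_prod {R : Type u} [CommRing R] (M N : Type*) [AddCommGroup M] [Module R M]
    [AddCommGroup N] [Module R N] [Module.Flat R M] [Module.Flat R N] :
    Module.Flat R (M × N) := by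
  rw [Module.Flat.iff_rTensor_injectiveₛ]
  intro P _ _ S
  have hM := Module.Flat.rTensor_preserves_injective_linearMap (M := M) S.subtype
    S.injective_subtype
  have hN := Module.Flat.rTensor_preserves_injective_linearMap (M := N) S.subtype
    S.injective_subtype
  have key : ∀ z : S ⊗[R] (M × N), z =
      (LinearMap.inl R M N).lTensor S ((LinearMap.fst R M N).lTensor S z) +
      (LinearMap.inr R M N).lTensor S ((LinearMap.snd R M N).lTensor S z) := by
    intro z
    rw [← LinearMap.lTensor_comp_apply, ← LinearMap.lTensor_comp_apply, ← LinearMap.add_apply,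
      ← LinearMap.lTensor_add]
    have : LinearMap.inl R M N ∘ₗ LinearMap.fst R M N + LinearMap.inr R M N ∘ₗ LinearMap.snd R M N
        = LinearMap.id := by ext <;> simp
    rw [this, LinearMap.lTensor_id, LinearMap.id_apply]
  intro z z' h
  rw [key z, key z']
  congr 2
  · apply hM
    have := congrArg ((LinearMap.fst R M N).lTensor P) h
    simpa only [← LinearMap.comp_apply, LinearMap.lTensor_comp_rTensor,
      ← LinearMap.rTensor_comp_lTensor] using this
  · apply hN
    have := congrArg ((LinearMap.snd R M N).lTensor P) h
    simpa only [← LinearMap.comp_apply, LinearMap.lTensor_comp_rTensor,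
      ← LinearMap.rTensor_comp_lTensor] using this

/-- The free module on the set `N` and the kernel of its projection stay in `Type (max u v)`, so the
induction in `exact_lTensor_of_flat` may be applied to `N'`. -/
lemma exists_flat_presentation (R : Type u) [CommRing R] (N : Type (max u v)) [AddCommGroup N]
    [Module R N] : ∃ (F : Type (max u v)) (_ : AddCommGroup F) (_ : Module R F)
      (_ : Module.Flat R F) (N' : Type (max u v)) (_ : AddCommGroup N') (_ : Module R N')
      (q : F →ₗ[R] N) (i : N' →ₗ[R] F), Function.Surjective q ∧ Function.Injective i ∧
        Function.Exact i q :=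
  ⟨N →₀ R, inferInstance, inferInstance, inferInstance,
    LinearMap.ker (Finsupp.linearCombination R (id : N → N)), inferInstance, inferInstance,
    Finsupp.linearCombination R id, Submodule.subtype _,
    Finsupp.linearCombination_id_surjective R N, Submodule.injective_subtype _,
    LinearMap.exact_subtype_ker_map _⟩

/-- An exact complex of flat modules which is bounded below stays exact after tensoring. -/
lemma exact_lTensor_of_flat {R : Type u} [CommRing R] {c : ℕ → Type*} [∀ n, AddCommGroup (c n)]
    [∀ n, Module R (c n)] [∀ n, Module.Flat R (c n)] (d : ∀ n, c (n + 1) →ₗ[R] c n)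
    (h0 : Function.Surjective (d 0)) (hd : ∀ n, Function.Exact (d (n + 1)) (d n)) (n : ℕ) :
    ∀ (N : Type (max u v)) [AddCommGroup N] [Module R N],
      Function.Exact ((d (n + 1)).lTensor N) ((d n).lTensor N) := by
  have hdd : ∀ (N : Type (max u v)) [AddCommGroup N] [Module R N] (n : ℕ) (z : N ⊗[R] c (n + 2)),
      (d n).lTensor N ((d (n + 1)).lTensor N z) = 0 := by
    intro N _ _ n z
    rw [← LinearMap.lTensor_comp_apply, (hd n).linearMap_comp_eq_zero, LinearMap.lTensor_zero,
      LinearMap.zero_apply]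
  -- Dimension shifting: exactness at one stage for `N` follows from exactness one stage lower for
  -- the kernel `N'` of a flat presentation. This is why the coefficient module is quantified inside
  -- the induction.
  induction n with
  | zero =>
    intro N _ _ z
    refine ⟨fun hz => ?_, fun ⟨w, hw⟩ => hw ▸ hdd N 0 w⟩
    obtain ⟨F, _, _, _, N', _, _, q, i, hq, hi, hiq⟩ := exists_flat_presentation.{u, v} R N
    obtain ⟨y, rfl⟩ := LinearMap.rTensor_surjective (c 1) hq z
    have h1 : (d 0).lTensor F y ∈ LinearMap.ker (q.rTensor (c 0)) := by
      rw [LinearMap.mem_ker, ← LinearMap.comp_apply, LinearMap.rTensor_comp_lTensor,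
        ← LinearMap.lTensor_comp_rTensor]
      exact hz
    -- The boundary of the lift `y` comes from `N' ⊗ c 0`. At the bottom, surjectivity of `d 0`
    -- lifts it to a correction `w'` of `y`, after which exactness over the flat module `F` applies.
    obtain ⟨w, hw⟩ := (rTensor_exact (c 0) hiq hq _).1 h1
    obtain ⟨w', rfl⟩ := LinearMap.lTensor_surjective N' h0 w
    have h2 : (d 0).lTensor F (y - i.rTensor (c 1) w') = 0 := by
      rw [map_sub, ← hw, sub_eq_zero]
      simp only [← LinearMap.comp_apply, LinearMap.rTensor_comp_lTensor,
        LinearMap.lTensor_comp_rTensor]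
    obtain ⟨t, ht⟩ := (Module.Flat.lTensor_exact F (hd 0) _).1 h2
    refine ⟨q.rTensor _ t, ?_⟩
    have h3 : q.rTensor (c 1) (i.rTensor (c 1) w') = 0 := (rTensor_exact (c 1) hiq hq _).2 ⟨_, rfl⟩
    have h4 := congrArg (q.rTensor (c 1)) ht
    rw [map_sub, h3, sub_zero] at h4
    rw [← h4]
    simp only [← LinearMap.comp_apply, LinearMap.rTensor_comp_lTensor,
        LinearMap.lTensor_comp_rTensor]
  | succ n ih =>
    intro N _ _ z
    refine ⟨fun hz => ?_, fun ⟨w, hw⟩ => hw ▸ hdd N _ w⟩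
    obtain ⟨F, _, _, _, N', _, _, q, i, hq, hi, hiq⟩ := exists_flat_presentation.{u, v} R N
    obtain ⟨y, rfl⟩ := LinearMap.rTensor_surjective (c (n + 2)) hq z
    have h1 : (d (n + 1)).lTensor F y ∈ LinearMap.ker (q.rTensor (c (n + 1))) := by
      rw [LinearMap.mem_ker, ← LinearMap.comp_apply, LinearMap.rTensor_comp_lTensor,
        ← LinearMap.lTensor_comp_rTensor]
      exact hz
    obtain ⟨w, hw⟩ := (rTensor_exact (c (n + 1)) hiq hq _).1 h1
    -- Flatness of `c n` makes `N' ⊗ c n` a submodule of `F ⊗ c n`, where the image of `w` is a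
    -- boundary and hence a cycle. The induction hypothesis then supplies the correction that
    -- surjectivity gave at the bottom.
    have h5 : (d n).lTensor N' w = 0 := by
      have hinj : Function.Injective (i.rTensor (c n)) :=
        Module.Flat.rTensor_preserves_injective_linearMap i hi
      refine hinj ?_
      rw [map_zero, ← hdd F n y, ← hw]
      simp only [← LinearMap.comp_apply, LinearMap.rTensor_comp_lTensor,
        LinearMap.lTensor_comp_rTensor]
    obtain ⟨w', rfl⟩ := (ih N' w).1 h5
    have h2 : (d (n + 1)).lTensor F (y - i.rTensor (c (n + 2)) w') = 0 := by
      rw [map_sub, ← hw, sub_eq_zero]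
      simp only [← LinearMap.comp_apply, LinearMap.rTensor_comp_lTensor,
        LinearMap.lTensor_comp_rTensor]
    obtain ⟨t, ht⟩ := (Module.Flat.lTensor_exact F (hd (n + 1)) _).1 h2
    refine ⟨q.rTensor _ t, ?_⟩
    have h3 : q.rTensor (c (n + 2)) (i.rTensor (c (n + 2)) w') = 0 :=
      (rTensor_exact (c (n + 2)) hiq hq _).2 ⟨_, rfl⟩
    have h4 := congrArg (q.rTensor (c (n + 2))) ht
    rw [map_sub, h3, sub_zero] at h4
    rw [← h4]
    simp only [← LinearMap.comp_apply, LinearMap.rTensor_comp_lTensor,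
        LinearMap.lTensor_comp_rTensor]

end Flat

/-! ### Quasi-isomorphisms of chain complexes in terms of elements. -/

section Homology

/-- The explicit homology of a complex of modules is kernel modulo range, and the two conditions are
injectivity and surjectivity of the induced map on it. -/
lemma shortComplex_quasiIso_iff {R : Type u} [Ring R] {S T : ShortComplex (ModuleCat.{v} R)}
    (φ : S ⟶ T) : ShortComplex.QuasiIso φ ↔
      (∀ x : S.X₂, S.g.hom x = 0 → (∃ y, φ.τ₂.hom x = T.f.hom y) → ∃ x', x = S.f.hom x') ∧
      (∀ y : T.X₂, T.g.hom y = 0 → ∃ x y', S.g.hom x = 0 ∧ y = φ.τ₂.hom x + T.f.hom y') := by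
  let γ : ShortComplex.LeftHomologyMapData φ S.moduleCatLeftHomologyData
    T.moduleCatLeftHomologyData := default
  obtain ⟨k, h, hK, hπ, hbij⟩ : ∃ (k : LinearMap.ker S.g.hom →ₗ[R] LinearMap.ker T.g.hom)
      (h : (LinearMap.ker S.g.hom ⧸ LinearMap.range S.moduleCatToCycles) →ₗ[R]
        (LinearMap.ker T.g.hom ⧸ LinearMap.range T.moduleCatToCycles)),
      (∀ x, (k x).1 = φ.τ₂.hom x.1) ∧
      (∀ x, h (Submodule.Quotient.mk x) = Submodule.Quotient.mk (k x)) ∧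
      (ShortComplex.QuasiIso φ ↔ Function.Bijective h) :=
    ⟨γ.φK.hom, γ.φH.hom, fun x => LinearMap.congr_fun (congrArg ModuleCat.Hom.hom γ.commi) x,
      fun x => LinearMap.congr_fun (congrArg ModuleCat.Hom.hom γ.commπ) x,
      by rw [γ.quasiIso_iff, ConcreteCategory.isIso_iff_bijective]; rfl⟩
  rw [hbij]
  constructor
  · rintro ⟨h1, h2⟩
    refine ⟨fun x hx ⟨y, hy⟩ => ?_, fun y hy => ?_⟩
    · have : h (Submodule.Quotient.mk ⟨x, hx⟩) = 0 := by
        rw [hπ, Submodule.Quotient.mk_eq_zero]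
        exact ⟨y, Subtype.ext (by rw [hK]; exact hy.symm)⟩
      have h3 := h1 (this.trans (map_zero h).symm)
      obtain ⟨x', hx'⟩ := (Submodule.Quotient.mk_eq_zero _).1 h3
      exact ⟨x', (congrArg Subtype.val hx').symm⟩
    · obtain ⟨w, hw⟩ := h2 (Submodule.Quotient.mk ⟨y, hy⟩)
      obtain ⟨x, rfl⟩ := Submodule.Quotient.mk_surjective _ w
      rw [hπ, eq_comm, Submodule.Quotient.eq] at hw
      obtain ⟨y', hy'⟩ := hw
      refine ⟨x.1, y', x.2, ?_⟩
      have := congrArg Subtype.val hy'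
      rw [← hK]
      exact (sub_eq_iff_eq_add'.1 this.symm)
  · rintro ⟨h1, h2⟩
    constructor
    · rw [injective_iff_map_eq_zero]
      intro w hw
      obtain ⟨x, rfl⟩ := Submodule.Quotient.mk_surjective _ w
      rw [hπ, Submodule.Quotient.mk_eq_zero] at hw
      obtain ⟨y, hy⟩ := hw
      obtain ⟨x', hx'⟩ := h1 x.1 x.2 ⟨y, by rw [← hK, ← hy]; rfl⟩
      exact (Submodule.Quotient.mk_eq_zero _).2 ⟨x', Subtype.ext hx'.symm⟩
    · intro w
      obtain ⟨y, rfl⟩ := Submodule.Quotient.mk_surjective _ w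
      obtain ⟨x, y', hx, hy⟩ := h2 y.1 y.2
      refine ⟨Submodule.Quotient.mk ⟨x, hx⟩, (hπ _).trans ?_⟩
      rw [eq_comm, Submodule.Quotient.eq]
      refine ⟨y', Subtype.ext ?_⟩
      change T.f.hom y' = y.1 - (k ⟨x, hx⟩).1
      rw [hK, hy]
      simp

/-- Injectivity in degree `n` and surjectivity in degree `n + 1` together are exactness of the
mapping cone at one spot. Only surjectivity in degree zero is left over. The form agrees with the
right side of `QI.iff_graded`. -/
lemma chainComplex_quasiIso_iff {R : Type u} [Ring R] {X Y : ChainComplex (ModuleCat.{v} R) ℕ}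
    (f : X ⟶ Y) : QuasiIso f ↔
      (∀ y : Y.X 0, ∃ x y', y = (f.f 0).hom x + (Y.d 1 0).hom y') ∧
      ∀ n (x : X.X n) (y : Y.X (n + 1)), (X.d n (n - 1)).hom x = 0 →
        (f.f n).hom x = (Y.d (n + 1) n).hom y →
        ∃ x' y', x = (X.d (n + 1) n).hom x' ∧
          y = (f.f (n + 1)).hom x' + (Y.d (n + 2) (n + 1)).hom y' := by
  have hdd : ∀ (Z : ChainComplex (ModuleCat.{v} R) ℕ) i j k (z : Z.X i),
      (Z.d j k).hom ((Z.d i j).hom z) = 0 := fun Z i j k z => by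
    rw [← LinearMap.comp_apply, ← ModuleCat.hom_comp, Z.d_comp_d]; rfl
  have hfd : ∀ i j (x : X.X i), (f.f j).hom ((X.d i j).hom x) = (Y.d i j).hom ((f.f i).hom x) :=
    fun i j x => by
      rw [← LinearMap.comp_apply, ← ModuleCat.hom_comp, ← f.comm]; rfl
  have key : ∀ n, QuasiIsoAt f n ↔
      (∀ x : X.X n, (X.d n (n - 1)).hom x = 0 → (∃ y, (f.f n).hom x = (Y.d (n + 1) n).hom y) →
        ∃ x', x = (X.d (n + 1) n).hom x') ∧
      (∀ y : Y.X n, (Y.d n (n - 1)).hom y = 0 →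
        ∃ x y', (X.d n (n - 1)).hom x = 0 ∧ y = (f.f n).hom x + (Y.d (n + 1) n).hom y') := by
    intro n
    -- For `n = 0` the truncated index `n - 1` is `0`, and `d 0 0` is zero by the shape of the
    -- complex, so the cycle condition is empty there.
    rw [quasiIsoAt_iff' f (n + 1) n (n - 1) (by simp) (by cases n <;> simp)]
    exact shortComplex_quasiIso_iff _
  rw [quasiIso_iff]
  simp only [key]
  constructor
  · intro h
    refine ⟨fun y => ?_, fun n x y hx hy => ?_⟩
    · obtain ⟨x, y', -, e⟩ := (h 0).2 y (by
        rw [Y.shape _ _ (by simp)]; rfl)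
      exact ⟨x, y', e⟩
    · obtain ⟨x', rfl⟩ := (h n).1 x hx ⟨y, hy⟩
      obtain ⟨x'', y', h1, h2⟩ := (h (n + 1)).2 (y - (f.f (n + 1)).hom x') (by
        rw [map_sub, sub_eq_zero]
        exact hy.symm.trans (hfd _ _ _))
      refine ⟨x' + x'', y', ?_, ?_⟩
      · rw [map_add]
        exact (add_zero _).symm.trans (congrArg _ h1.symm)
      · rw [sub_eq_iff_eq_add.1 h2, map_add]; abel
  · rintro ⟨h0, h1⟩ n
    refine ⟨fun x hx ⟨y, hy⟩ => ?_, fun y hy => ?_⟩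
    · obtain ⟨x', -, e, -⟩ := h1 n x y hx hy
      exact ⟨x', e⟩
    · cases n with
      | zero =>
        obtain ⟨x, y', e⟩ := h0 y
        exact ⟨x, y', by rw [X.shape _ _ (by simp)]; rfl, e⟩
      | succ n =>
        obtain ⟨x', y', e1, e2⟩ := h1 n 0 y (map_zero _) (by rw [map_zero]; exact hy.symm)
        exact ⟨x', y', e1.symm, e2⟩

end Homology

/-! ### Homogeneous differentials and mapping cones of graded modules. -/

section Graded

variable {R : Type u} [CommRing R] {X Y : Type*} [AddCommGroup X] [Module R X]
  [AddCommGroup Y] [Module R Y] {U V : ℕ → Type*} [∀ n, AddCommGroup (U n)] [∀ n, Module R (U n)]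
  [∀ n, AddCommGroup (V n)] [∀ n, Module R (V n)]
  {P : Decomp R X U} {Q : Decomp R Y V}

/-- `D` is homogeneous of degree `-1` with components `d`. -/
structure Decomp.Homog (P : Decomp R X U) (D : X →ₗ[R] X) (d : ∀ n, U (n + 1) →ₗ[R] U n) :
    Prop where
  zero : ∀ u, D (P.ι 0 u) = 0
  succ : ∀ n u, D (P.ι (n + 1) u) = P.ι n (d n u)

lemma Decomp.Homog.π_eq {D : X →ₗ[R] X} {d : ∀ n, U (n + 1) →ₗ[R] U n} (h : P.Homog D d) (n : ℕ)
    (x : X) : P.π n (D x) = d n (P.π (n + 1) x) := by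
  refine LinearMap.congr_fun (P.hom_ext (f := P.π n ∘ₗ D) (g := d n ∘ₗ P.π (n + 1)) ?_) x
  rintro (_ | m) u
  · simp [h.zero, P.π_ι_ne (n + 1) 0 u (by omega)]
  · simp only [LinearMap.comp_apply, h.succ]
    by_cases hmn : n = m
    · subst hmn; rw [P.π_ι, P.π_ι]
    · rw [P.π_ι_ne _ _ _ hmn, P.π_ι_ne _ _ _ (by omega), map_zero]

lemma Decomp.Homog.lTensor {D : X →ₗ[R] X} {d : ∀ n, U (n + 1) →ₗ[R] U n} (h : P.Homog D d)
    (N : Type*) [AddCommGroup N] [Module R N] :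
    (P.lTensor N).Homog (D.lTensor N) (fun n => (d n).lTensor N) where
  zero u := by
    change D.lTensor N ((P.ι 0).lTensor N u) = 0
    rw [← LinearMap.lTensor_comp_apply, show D ∘ₗ P.ι 0 = 0 from LinearMap.ext h.zero,
      LinearMap.lTensor_zero, LinearMap.zero_apply]
  succ n u := by
    change D.lTensor N ((P.ι (n + 1)).lTensor N u) = (P.ι n).lTensor N ((d n).lTensor N u)
    rw [← LinearMap.lTensor_comp_apply, ← LinearMap.lTensor_comp_apply,
      show D ∘ₗ P.ι (n + 1) = P.ι n ∘ₗ d n from LinearMap.ext (h.succ n)]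

variable {D : X →ₗ[R] X} {E : Y →ₗ[R] Y} {f : X →ₗ[R] Y} {d : ∀ n, U (n + 1) →ₗ[R] U n}
  {e : ∀ n, V (n + 1) →ₗ[R] V n} {φ : ∀ n, U n →ₗ[R] V n}

lemma Decomp.π_map (hf : ∀ n u, f (P.ι n u) = Q.ι n (φ n u)) (n : ℕ) (x : X) :
    Q.π n (f x) = φ n (P.π n x) := by
  refine LinearMap.congr_fun (P.hom_ext (f := Q.π n ∘ₗ f) (g := φ n ∘ₗ P.π n) ?_) x
  intro m u
  simp only [LinearMap.comp_apply, hf]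
  by_cases hmn : n = m
  · subst hmn; rw [Q.π_ι, P.π_ι]
  · rw [Q.π_ι_ne _ _ _ hmn, P.π_ι_ne _ _ _ hmn, map_zero]

/-- The cone is graded by pairing the component of `x` in degree `n` with that of `y` in degree `n +
1`, so exactness can be tested degree by degree. The degree zero component of `y` has no partner and
gives the first condition. -/
lemma QI.iff_graded (hD : P.Homog D d) (hE : Q.Homog E e)
    (hf : ∀ n u, f (P.ι n u) = Q.ι n (φ n u)) : QI D E f ↔
      (∀ y : V 0, ∃ x y', y = φ 0 x + e 0 y') ∧
      ∀ n x y, D (P.ι n x) = 0 → φ n x = e n y →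
        ∃ x' y', x = d n x' ∧ y = φ (n + 1) x' + e (n + 1) y' := by
  constructor
  · intro h
    refine ⟨fun y => ?_, fun n x y hx hy => ?_⟩
    · obtain ⟨x', y', -, h2⟩ := h 0 (Q.ι 0 y) (map_zero _) (by rw [hE.zero, map_zero])
      refine ⟨P.π 0 x', Q.π 1 y', ?_⟩
      rw [← Q.π_ι 0 y, h2, map_add, Decomp.π_map hf, hE.π_eq]
    · obtain ⟨x', y', h1, h2⟩ := h (P.ι n x) (Q.ι (n + 1) y) hx (by rw [hf, hE.succ, hy])
      refine ⟨P.π (n + 1) x', Q.π (n + 2) y', ?_, ?_⟩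
      · rw [← hD.π_eq, ← h1, P.π_ι]
      · rw [← hE.π_eq, ← Decomp.π_map hf, ← map_add, ← h2, Q.π_ι]
  · rintro ⟨h0, h1⟩ x y hx hy
    have hDx : ∀ n, D (P.ι n (P.π n x)) = 0 := by
      rintro (_ | n)
      · exact hD.zero _
      · rw [hD.succ, ← hD.π_eq, hx, map_zero, map_zero]
    have hφ : ∀ n, φ n (P.π n x) = e n (Q.π (n + 1) y) := fun n => by
      rw [← hE.π_eq, ← hy, Decomp.π_map hf]
    obtain ⟨a, b, hab⟩ := h0 (Q.π 0 y)
    choose s t hs ht using fun n => h1 n _ _ (hDx n) (hφ n)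
    obtain ⟨N, hN⟩ := P.exists_sum x
    obtain ⟨N', hN'⟩ := Q.exists_sum y
    let M := max N N'
    refine ⟨P.ι 0 a + ∑ n ∈ Finset.range M, P.ι (n + 1) (s n),
      Q.ι 1 b + ∑ n ∈ Finset.range M, Q.ι (n + 2) (t n), ?_, ?_⟩
    · rw [map_add, hD.zero, zero_add, map_sum]
      conv_lhs => rw [hN M (le_max_left _ _)]
      refine Finset.sum_congr rfl fun n _ => ?_
      rw [hD.succ, ← hs]
    -- The expansion of `y` needs one more term than that of `x`: its component `0` is handled by
    -- `hab`, and its component `n + 1` belongs to `ht n`.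
    · conv_lhs => rw [hN' (M + 1) ((le_max_right _ _).trans (Nat.le_succ _)),
        Finset.sum_range_succ', hab, Finset.sum_congr rfl fun n _ => congrArg _ (ht n)]
      simp only [map_add, map_sum, hf, hE.succ, Finset.sum_add_distrib]
      abel

/-- The family shifted by one, starting with zero. -/
def Shift (U : ℕ → Type w) (n : ℕ) : Type w :=
  match n with
  | 0 => PUnit.{w + 1}
  | n + 1 => U n

instance {U : ℕ → Type w} [∀ n, AddCommGroup (U n)] (n : ℕ) : AddCommGroup (Shift U n) :=
  match n with
  | 0 => inferInstanceAs (AddCommGroup PUnit.{w + 1})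
  | n + 1 => inferInstanceAs (AddCommGroup (U n))

instance {U : ℕ → Type w} [∀ n, AddCommGroup (U n)] [∀ n, Module R (U n)] (n : ℕ) :
    Module R (Shift U n) :=
  match n with
  | 0 => inferInstanceAs (Module R PUnit.{w + 1})
  | n + 1 => inferInstanceAs (Module R (U n))

instance {U : ℕ → Type w} [∀ n, AddCommGroup (U n)] [∀ n, Module R (U n)]
    [∀ n, Module.Flat R (U n)] (n : ℕ) : Module.Flat R (Shift U n) :=
  match n with
  | 0 => inferInstanceAs (Module.Flat R PUnit.{w + 1})
  | n + 1 => inferInstanceAs (Module.Flat R (U n))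

/-- The differential from a family to its shift. -/
def toShift (d : ∀ n, U (n + 1) →ₗ[R] U n) (n : ℕ) : U n →ₗ[R] Shift U n :=
  match n with
  | 0 => 0
  | n + 1 => d n

/-- The differential of the mapping cone. -/
def coneD (d : ∀ n, U (n + 1) →ₗ[R] U n) (e : ∀ n, V (n + 1) →ₗ[R] V n) (φ : ∀ n, U n →ₗ[R] V n)
    (n : ℕ) : (U n × V (n + 1)) →ₗ[R] (Shift U n × V n) :=
  LinearMap.prod (toShift d n ∘ₗ LinearMap.fst R _ _)
    (φ n ∘ₗ LinearMap.fst R _ _ - e n ∘ₗ LinearMap.snd R _ _)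

/-- A quasi-isomorphism of flat modules which are graded in non-negative degrees stays a
quasi-isomorphism after tensoring. -/
lemma QI.lTensor_of_flat {U V : ℕ → Type*} [∀ n, AddCommGroup (U n)] [∀ n, Module R (U n)]
    [∀ n, AddCommGroup (V n)] [∀ n, Module R (V n)]
    {P : Decomp R X U} {Q : Decomp R Y V} {d : ∀ n, U (n + 1) →ₗ[R] U n}
    {e : ∀ n, V (n + 1) →ₗ[R] V n} {φ : ∀ n, U n →ₗ[R] V n}
    [∀ n, Module.Flat R (U n)] [∀ n, Module.Flat R (V n)]
    (hD : P.Homog D d) (hE : Q.Homog E e) (hf : ∀ n u, f (P.ι n u) = Q.ι n (φ n u))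
    (hDD : ∀ x, D (D x) = 0) (hEE : ∀ y, E (E y) = 0) (hfD : ∀ x, f (D x) = E (f x))
    (h : QI D E f) (N : Type (max u v)) [AddCommGroup N] [Module R N] :
    QI (D.lTensor N) (E.lTensor N) (f.lTensor N) := by
  have hinj : ∀ n, Function.Injective (P.ι n) := fun n =>
    Function.LeftInverse.injective (P.π_ι n)
  have hinj' : ∀ n, Function.Injective (Q.ι n) := fun n =>
    Function.LeftInverse.injective (Q.π_ι n)
  have hs : ∀ n x, toShift d n x = 0 ↔ D (P.ι n x) = 0 := by
    rintro (_ | n) x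
    · simp [toShift, hD.zero]
    · rw [hD.succ]
      exact (map_eq_zero_iff _ (hinj n)).symm
  have hdd : ∀ n x, toShift d n (d n x) = 0 := fun n x => by
    rw [hs, ← hD.succ, hDD]
  have hee : ∀ n x, e n (e (n + 1) x) = 0 := fun n x => hinj' _ (by
    rw [← hE.succ, ← hE.succ, hEE, map_zero])
  have hφd : ∀ n x, φ n (d n x) = e n (φ (n + 1) x) := fun n x => hinj' _ (by
    rw [← hf, ← hD.succ, hfD, hf, hE.succ])
  rw [QI.iff_graded hD hE hf] at h
  have hflat : ∀ n, Module.Flat R (Shift U n × V n) := fun n => flat_prod _ _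
  -- The hypothesis says that the mapping cone is exact, and its terms are flat. The term of index
  -- `n + 1` is `U n × V (n + 1)` by definition of `Shift`. The sign in `-y'` turns the sum `φ x' +
  -- e y'` of `QI` into the difference of the cone differential.
  have hex := exact_lTensor_of_flat.{u, v} (R := R) (c := fun n => Shift U n × V n) (coneD d e φ)
    (by
      rintro ⟨⟨⟩, y⟩
      obtain ⟨x, y', rfl⟩ := h.1 y
      exact ⟨(x, -y'), Prod.ext rfl (by change φ 0 x - e 0 (-y') = _; simp)⟩)
    (by
      rintro n ⟨x, y⟩
      constructor
      · intro hz
        obtain ⟨x', y', h1, h2⟩ := h.2 n x y ((hs n x).1 (congrArg Prod.fst hz))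
          (sub_eq_zero.1 (congrArg Prod.snd hz))
        exact ⟨(x', -y'), Prod.ext h1.symm (by
          rw [h2]; change φ (n + 1) x' - e (n + 1) (-y') = _; simp)⟩
      · rintro ⟨⟨x', y'⟩, hz⟩
        obtain rfl : d n x' = x := congrArg Prod.fst hz
        obtain rfl : φ (n + 1) x' - e (n + 1) y' = y := congrArg Prod.snd hz
        exact Prod.ext (hdd n x') (by
          change φ n (d n x') - e n (φ (n + 1) x' - e (n + 1) y') = 0
          rw [map_sub, hee, sub_zero]
          exact sub_eq_zero.2 (hφd n x')))
  have hsurj : Function.Surjective (coneD d e φ 0) := by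
    rintro ⟨⟨⟩, y⟩
    obtain ⟨x, y', rfl⟩ := h.1 y
    exact ⟨(x, -y'), Prod.ext rfl (by change φ 0 x - e 0 (-y') = _; simp)⟩
  refine (QI.iff_graded (hD.lTensor N) (hE.lTensor N) (φ := fun n => (φ n).lTensor N) ?_).2 ⟨?_, ?_⟩
  · intro n u
    change f.lTensor N ((P.ι n).lTensor N u) = (Q.ι n).lTensor N ((φ n).lTensor N u)
    rw [← LinearMap.lTensor_comp_apply, ← LinearMap.lTensor_comp_apply,
      show f ∘ₗ P.ι n = Q.ι n ∘ₗ φ n from LinearMap.ext (hf n)]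
  · intro y
    obtain ⟨z, hz⟩ := LinearMap.lTensor_surjective N hsurj ((LinearMap.inr R _ _).lTensor N y)
    refine ⟨(LinearMap.fst R _ _).lTensor N z, -(LinearMap.snd R _ _).lTensor N z, ?_⟩
    have := congrArg ((LinearMap.snd R _ _).lTensor N) hz
    simp only [← LinearMap.lTensor_comp_apply, LinearMap.snd_comp_inr, LinearMap.lTensor_id,
      LinearMap.id_apply] at this
    rw [← this, map_neg, ← sub_eq_add_neg, ← LinearMap.lTensor_comp_apply,
      ← LinearMap.lTensor_comp_apply, ← LinearMap.sub_apply, ← LinearMap.lTensor_sub]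
    rfl
  · intro n x y hx hy
    have hx' : (toShift d n).lTensor N x = 0 := by
      cases n with
      | zero => simp [toShift]
      | succ n =>
        have : (P.lTensor N).ι n ((d n).lTensor N x) = 0 := by
          rw [← (hD.lTensor N).succ, hx]
        rw [← (P.lTensor N).π_ι n ((toShift d (n + 1)).lTensor N x)]
        exact (congrArg _ this).trans (map_zero _)
    let c₁ : U n →ₗ[R] U n × V (n + 1) := LinearMap.inl R _ _
    let c₂ : V (n + 1) →ₗ[R] U n × V (n + 1) := LinearMap.inr R _ _
    have e1 : coneD d e φ n ∘ₗ c₁ =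
        LinearMap.inl R _ _ ∘ₗ toShift d n + LinearMap.inr R _ _ ∘ₗ φ n :=
      LinearMap.ext fun x => Prod.ext (by simp [coneD, c₁]) (by simp [coneD, c₁])
    have e2 : coneD d e φ n ∘ₗ c₂ = - (LinearMap.inr R _ _ ∘ₗ e n) :=
      LinearMap.ext fun x => Prod.ext (by simp [coneD, c₂]) (by simp [coneD, c₂])
    let p₁ : U n × V (n + 1) →ₗ[R] U n := LinearMap.fst R _ _
    let p₂ : U n × V (n + 1) →ₗ[R] V (n + 1) := LinearMap.snd R _ _
    let q₁ : U (n + 1) × V (n + 2) →ₗ[R] U (n + 1) := LinearMap.fst R _ _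
    let q₂ : U (n + 1) × V (n + 2) →ₗ[R] V (n + 2) := LinearMap.snd R _ _
    let δ : U (n + 1) × V (n + 2) →ₗ[R] U n × V (n + 1) :=
      LinearMap.prod (d n ∘ₗ q₁) (φ (n + 1) ∘ₗ q₁ - e (n + 1) ∘ₗ q₂)
    -- The tensor product of `N` with a product is not itself a product, so the pair `(x, y)` is
    -- encoded through the inclusions `c₁`, `c₂`, and the preimage is decoded through the
    -- projections `q₁`, `q₂`.
    obtain ⟨z, hz⟩ : ∃ z, δ.lTensor N z = c₁.lTensor N x + c₂.lTensor N y :=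
      (hex n N (c₁.lTensor N x + c₂.lTensor N y)).1 (by
        have e3 : (coneD d e φ n).lTensor N (c₁.lTensor N x) =
            (LinearMap.inr R (Shift U n) (V n)).lTensor N ((φ n).lTensor N x) := by
          rw [← LinearMap.lTensor_comp_apply, e1, LinearMap.lTensor_add, LinearMap.add_apply,
            LinearMap.lTensor_comp_apply, hx', map_zero, zero_add, LinearMap.lTensor_comp_apply]
        have e4 : (coneD d e φ n).lTensor N (c₂.lTensor N y) =
            - (LinearMap.inr R (Shift U n) (V n)).lTensor N ((e n).lTensor N y) := by
          rw [← LinearMap.lTensor_comp_apply, e2, LinearMap.lTensor_neg, LinearMap.neg_apply,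
            LinearMap.lTensor_comp_apply]
        refine (map_add _ _ _).trans ?_
        refine (congrArg₂ (· + ·) e3 e4).trans ?_
        rw [hy]
        exact add_neg_cancel _)
    have e3 : p₁ ∘ₗ δ = d n ∘ₗ q₁ := rfl
    have e4 : p₂ ∘ₗ δ = φ (n + 1) ∘ₗ q₁ - e (n + 1) ∘ₗ q₂ := rfl
    refine ⟨q₁.lTensor N z, -q₂.lTensor N z, ?_, ?_⟩
    · have h3 := congrArg (p₁.lTensor N) hz
      rw [map_add, ← LinearMap.lTensor_comp_apply, ← LinearMap.lTensor_comp_apply,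
        ← LinearMap.lTensor_comp_apply, e3, LinearMap.fst_comp_inl, LinearMap.fst_comp_inr,
        LinearMap.lTensor_id, LinearMap.lTensor_zero] at h3
      rw [← LinearMap.lTensor_comp_apply]
      simpa using h3.symm
    · have h3 := congrArg (p₂.lTensor N) hz
      rw [map_add, ← LinearMap.lTensor_comp_apply, ← LinearMap.lTensor_comp_apply,
        ← LinearMap.lTensor_comp_apply, e4, LinearMap.snd_comp_inl, LinearMap.snd_comp_inr,
        LinearMap.lTensor_id, LinearMap.lTensor_zero] at h3
      rw [map_neg, ← sub_eq_add_neg, ← LinearMap.lTensor_comp_apply,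
        ← LinearMap.lTensor_comp_apply, ← LinearMap.sub_apply, ← LinearMap.lTensor_sub]
      simpa using h3.symm

end Graded

end DiffMod

namespace ConnDGCoalg

open DiffMod

/-! ### The total module of a dg coalgebra and the universal twisting cochain. -/

section Tot

variable {R : Type u} [CommRing R] (K : ConnDGCoalg.{u, v} R)

/-- The direct sum of the components of a dg coalgebra. -/
def Tot : Type v := DirectSum ℕ fun n => K.cx.X n

instance : AddCommGroup K.Tot :=
  (inferInstance : AddCommGroup (DirectSum ℕ fun n => K.cx.X n))

instance : Module R K.Tot :=
  (inferInstance : Module R (DirectSum ℕ fun n => K.cx.X n))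

/-- The decomposition of the total module into its components. -/
def totDecomp : Decomp R K.Tot (fun n => K.cx.X n) :=
  Decomp.directSum R (fun n => K.cx.X n)

/-- The inclusion of a component. -/
def tι (n : ℕ) : K.cx.X n →ₗ[R] K.Tot := DirectSum.lof R ℕ (fun n => K.cx.X n) n

/-- The linear map with given components. -/
def totLift {M : Type*} [AddCommGroup M] [Module R M] (g : ∀ n, K.cx.X n →ₗ[R] M) :
    K.Tot →ₗ[R] M := DirectSum.toModule R ℕ M g

variable {K}

@[simp]
lemma totLift_tι {M : Type*} [AddCommGroup M] [Module R M] (g : ∀ n, K.cx.X n →ₗ[R] M) (n : ℕ)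
    (x : K.cx.X n) : K.totLift g (K.tι n x) = g n x :=
  DirectSum.toModule_lof (M := fun n => K.cx.X n) (φ := g) R n x

@[elab_as_elim]
lemma tot_induction {P : K.Tot → Prop} (x : K.Tot) (hι : ∀ n x, P (K.tι n x))
    (hadd : ∀ x y, P x → P y → P (x + y)) : P x := by
  induction x using DirectSum.induction_on with
  | zero => have := hι 0 0; rwa [map_zero] at this
  | of n x => exact hι n x
  | add x y hx hy => exact hadd x y hx hy

variable (K)

/-- The differential of the total module. -/
def totD : K.Tot →ₗ[R] K.Tot := K.totLift fun n => K.tι (n - 1) ∘ₗ (K.cx.d n (n - 1)).hom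

/-- The involution `x ↦ (-1)^|x| x`. -/
def totSgn : K.Tot →ₗ[R] K.Tot := K.totLift fun n => (-1 : R) ^ n • K.tι n

/-- The counit of the total module. -/
def totCounit : K.Tot →ₗ[R] R := K.totLift fun n =>
  match n with
  | 0 => K.counit
  | _ + 1 => 0

/-- The coproduct of the total module. -/
def totComul : K.Tot →ₗ[R] K.Tot ⊗[R] K.Tot := K.totLift fun n =>
  ∑ pq ∈ Finset.HasAntidiagonal.antidiagonal n,
    TensorProduct.map (K.tι pq.1) (K.tι pq.2) ∘ₗ K.comul pq.1 pq.2 n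

/-- The universal twisting cochain. -/
def tw : K.Tot →ₗ[R] K.Cobar := K.totLift K.br

lemma totD_tι (n : ℕ) (x : K.cx.X n) :
    K.totD (K.tι n x) = K.tι (n - 1) ((K.cx.d n (n - 1)).hom x) := by simp [totD]

lemma totD_tι_zero (x : K.cx.X 0) : K.totD (K.tι 0 x) = 0 := by
  rw [totD_tι, K.cx.shape _ _ (by simp)]; simp

lemma totSgn_tι (n : ℕ) (x : K.cx.X n) : K.totSgn (K.tι n x) = (-1 : R) ^ n • K.tι n x := by
  simp [totSgn]

lemma totComul_tι (n : ℕ) (x : K.cx.X n) : K.totComul (K.tι n x) =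
    ∑ pq ∈ Finset.HasAntidiagonal.antidiagonal n,
      TensorProduct.map (K.tι pq.1) (K.tι pq.2) (K.comul pq.1 pq.2 n x) := by simp [totComul]

lemma totCounit_tι_zero (x : K.cx.X 0) : K.totCounit (K.tι 0 x) = K.counit x := by
  simp [totCounit]

lemma totCounit_tι_succ (n : ℕ) (x : K.cx.X (n + 1)) : K.totCounit (K.tι (n + 1) x) = 0 := by
  simp [totCounit]

lemma tw_tι (n : ℕ) (x : K.cx.X n) : K.tw (K.tι n x) = K.br n x := by simp [tw]

lemma totD_totD (x : K.Tot) : K.totD (K.totD x) = 0 := by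
  induction x using tot_induction with
  | hι n x =>
    have e : (K.cx.d (n - 1) (n - 1 - 1)).hom ((K.cx.d n (n - 1)).hom x) = 0 := by
      rw [← LinearMap.comp_apply, ← ModuleCat.hom_comp, K.cx.d_comp_d]; rfl
    rw [totD_tι, totD_tι, e, map_zero]
  | hadd x y hx hy => simp [hx, hy]

lemma totSgn_totSgn (x : K.Tot) : K.totSgn (K.totSgn x) = x := by
  induction x using tot_induction with
  | hι n x => rw [totSgn_tι, map_smul, totSgn_tι, smul_smul, neg_one_pow_mul_self', one_smul]
  | hadd x y hx hy => simp [hx, hy]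

lemma totD_totSgn (x : K.Tot) : K.totD (K.totSgn x) = - K.totSgn (K.totD x) := by
  induction x using tot_induction with
  | hι n x =>
    cases n with
    | zero => simp [totSgn_tι, totD_tι_zero]
    | succ n => simp [totSgn_tι, totD_tι, pow_succ]
  | hadd x y hx hy => simp [hx, hy, add_comm]

lemma totCounit_totD (x : K.Tot) : K.totCounit (K.totD x) = 0 := by
  induction x using tot_induction with
  | hι n x =>
    match n, x with
    | 0, x => simp [totD_tι_zero]
    | 1, x => rw [totD_tι]; exact (K.totCounit_tι_zero _).trans (K.counit_d x)
    | n + 2, x => rw [totD_tι]; exact K.totCounit_tι_succ n _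
  | hadd x y hx hy => simp [hx, hy]

lemma totCounit_totSgn (x : K.Tot) : K.totCounit (K.totSgn x) = K.totCounit x := by
  induction x using tot_induction with
  | hι n x =>
    cases n with
    | zero => simp [totSgn_tι]
    | succ n => simp [totSgn_tι, totCounit_tι_succ]
  | hadd x y hx hy => simp [hx, hy]

lemma tw_totSgn (x : K.Tot) : K.tw (K.totSgn x) = - K.sgn (K.tw x) := by
  induction x using tot_induction with
  | hι n x => rw [totSgn_tι, map_smul, tw_tι, sgn_br_all, pow_succ]; simp
  | hadd x y hx hy => simp [hx, hy, add_comm]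

lemma totComul_totSgn (x : K.Tot) :
    K.totComul (K.totSgn x) = TensorProduct.map K.totSgn K.totSgn (K.totComul x) := by
  induction x using tot_induction with
  | hι n x =>
    rw [totSgn_tι, map_smul, totComul_tι, map_sum, Finset.smul_sum]
    refine Finset.sum_congr rfl fun pq hpq => ?_
    have hn : (-1 : R) ^ n = (-1) ^ (pq.1 + pq.2) := by
      rw [Finset.HasAntidiagonal.mem_antidiagonal.1 hpq]
    rw [TensorProduct.map_map, hn]
    have e : ∀ n, K.totSgn ∘ₗ K.tι n = (-1 : R) ^ n • K.tι n := fun n =>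
      LinearMap.ext (K.totSgn_tι n)
    rw [e, e, TensorProduct.map_smul_left, TensorProduct.map_smul_right, smul_smul, ← pow_add]
    rfl
  | hadd x y hx hy => simp only [map_add, hx, hy]

/-- This is the twisting cochain equation. Together with coassociativity it is the reason that all
twisted differentials below square to zero. -/
lemma diff_tw (x : K.Tot) : K.diff (K.tw x) = - K.tw (K.totD x) +
    LinearMap.mul' R K.Cobar (TensorProduct.map (K.tw ∘ₗ K.totSgn) K.tw (K.totComul x)) := by
  induction x using tot_induction with
  | hι n x =>
    rw [tw_tι, diff_br_all, totD_tι, tw_tι, totComul_tι, quad, LinearMap.sum_apply, map_sum,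
      map_sum]
    congr 1
    refine Finset.sum_congr rfl fun pq _ => ?_
    have e : ∀ n, (K.tw ∘ₗ K.totSgn) ∘ₗ K.tι n = (-1 : R) ^ n • K.br n := fun n =>
      LinearMap.ext fun x => by simp [totSgn_tι, tw_tι]
    have e' : ∀ n, K.tw ∘ₗ K.tι n = K.br n := fun n => LinearMap.ext fun x => by simp [tw_tι]
    rw [TensorProduct.map_map, e, e', TensorProduct.map_smul_left]
    simp [br₂]
  | hadd x y hx hy => simp only [map_add, hx, hy]; abel

/-- The Koszul sign of the Leibniz rule is stored in the operator `totSgn`, so that the identities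
that follow can be checked without homogeneous elements. -/
lemma totComul_totD (x : K.Tot) : K.totComul (K.totD x) =
    K.totD.rTensor _ (K.totComul x) + TensorProduct.map K.totSgn K.totD (K.totComul x) := by
  induction x using tot_induction with
  | hι n x =>
    have e1 : ∀ p q (w : K.cx.X p ⊗[R] K.cx.X q),
        K.totD.rTensor _ (TensorProduct.map (K.tι p) (K.tι q) w) =
          TensorProduct.map (K.totD ∘ₗ K.tι p) (K.tι q) w := fun p q w => by
      rw [LinearMap.rTensor, TensorProduct.map_map]; rfl
    have e2 : ∀ p q (w : K.cx.X p ⊗[R] K.cx.X q),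
        TensorProduct.map K.totSgn K.totD (TensorProduct.map (K.tι p) (K.tι q) w) =
          (-1 : R) ^ p • TensorProduct.map (K.tι p) (K.totD ∘ₗ K.tι q) w := fun p q w => by
      rw [TensorProduct.map_map, show K.totSgn ∘ₗ K.tι p = (-1 : R) ^ p • K.tι p from
        LinearMap.ext (K.totSgn_tι p), TensorProduct.map_smul_left]
      rfl
    have z : K.totD ∘ₗ K.tι 0 = 0 := LinearMap.ext K.totD_tι_zero
    have s : ∀ n, K.totD ∘ₗ K.tι (n + 1) = K.tι n ∘ₗ (K.cx.d (n + 1) n).hom := fun n =>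
      LinearMap.ext (K.totD_tι (n + 1))
    rw [totComul_tι]
    simp only [map_sum, e1, e2]
    cases n with
    | zero => rw [totD_tι_zero]; simp [z]
    | succ n =>
      have e3 : K.totD (K.tι (n + 1) x) = K.tι n ((K.cx.d (n + 1) n).hom x) := K.totD_tι _ _
      rw [e3, totComul_tι, Finset.Nat.sum_antidiagonal_succ (n := n),
        Finset.Nat.sum_antidiagonal_succ' (n := n)]
      simp only [z, s, TensorProduct.map_zero_left, TensorProduct.map_zero_right,
        LinearMap.zero_apply, smul_zero, zero_add]
      rw [← Finset.sum_add_distrib]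
      refine Finset.sum_congr rfl fun pq hpq => ?_
      rw [K.leibniz _ _ _ (Finset.HasAntidiagonal.mem_antidiagonal.1 hpq), map_add, map_smul,
        LinearMap.rTensor, LinearMap.lTensor, TensorProduct.map_map, TensorProduct.map_map]
      rfl
  | hadd x y hx hy => simp only [map_add, hx, hy]; abel

/-- Both sides regroup, by `sum_antidiagonal_assoc`, as one sum over triples `a + b + c = n`, and
they agree there by the componentwise axiom. -/
lemma totComul_coassoc (x : K.Tot) :
    TensorProduct.assoc R _ _ _ (K.totComul.rTensor _ (K.totComul x)) =
      K.totComul.lTensor _ (K.totComul x) := by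
  induction x using tot_induction with
  | hι n x =>
    have h := sum_antidiagonal_assoc n (fun a b c => TensorProduct.map (K.tι a)
      (TensorProduct.map (K.tι b) (K.tι c)) ((K.comul b c (b + c)).lTensor _
        (K.comul a (b + c) n x)))
    have hs : ∀ n, K.totComul ∘ₗ K.tι n = ∑ pq ∈ Finset.HasAntidiagonal.antidiagonal n,
        TensorProduct.map (K.tι pq.1) (K.tι pq.2) ∘ₗ K.comul pq.1 pq.2 n := fun n =>
      LinearMap.ext fun x => by rw [LinearMap.comp_apply, totComul_tι]; simp
    rw [totComul_tι, map_sum, map_sum, map_sum]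
    refine Eq.trans (Finset.sum_congr rfl fun pq hpq => ?_)
      (h.trans (Finset.sum_congr rfl fun pq hpq => ?_))
    · rw [LinearMap.rTensor, TensorProduct.map_map, hs, ← TensorProduct.mapBilinear_apply, map_sum,
        LinearMap.sum_apply, LinearMap.sum_apply, map_sum]
      refine Finset.sum_congr rfl fun ac hac => ?_
      obtain ⟨p, q⟩ := pq
      obtain ⟨a, c⟩ := ac
      obtain rfl := Finset.HasAntidiagonal.mem_antidiagonal.1 hac
      dsimp only at hpq ⊢
      rw [← K.coassoc a c q n (Finset.HasAntidiagonal.mem_antidiagonal.1 hpq),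
        TensorProduct.mapBilinear_apply, LinearMap.rTensor]
      have := LinearMap.congr_fun (TensorProduct.map_map_comp_assoc_eq (K.tι a) (K.tι c)
        (K.tι q)) (TensorProduct.map (K.comul a c (a + c)) LinearMap.id
          (K.comul (a + c) q n x))
      refine Eq.trans ?_ this.symm
      simp only [LinearMap.comp_apply, LinearEquiv.coe_coe]
      rw [TensorProduct.map_map, LinearMap.comp_id]
      rfl
    · rw [LinearMap.lTensor, TensorProduct.map_map, hs, ← TensorProduct.mapBilinear_apply, map_sum,
        LinearMap.sum_apply]
      refine Finset.sum_congr rfl fun ac hac => ?_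
      obtain ⟨p, q⟩ := pq
      obtain ⟨a, c⟩ := ac
      obtain rfl := Finset.HasAntidiagonal.mem_antidiagonal.1 hac
      rw [TensorProduct.mapBilinear_apply, LinearMap.lTensor, TensorProduct.map_map]
      rfl
  | hadd x y hx hy => simp only [map_add, hx, hy]

lemma totComul_counit_left (x : K.Tot) :
    TensorProduct.lid R _ (K.totCounit.rTensor _ (K.totComul x)) = x := by
  induction x using tot_induction with
  | hι n x =>
    rw [totComul_tι, map_sum, map_sum, Finset.sum_eq_single (0, n)]
    · rw [LinearMap.rTensor, TensorProduct.map_map,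
        show K.totCounit ∘ₗ K.tι 0 = K.counit from LinearMap.ext K.totCounit_tι_zero]
      conv_rhs => rw [← K.counit_left n x]
      generalize K.comul 0 n n x = w
      induction w using TensorProduct.induction_on with
      | zero => simp
      | add x y hx hy => simp only [map_add, hx, hy]
      | tmul x y => simp
    · rintro ⟨p, q⟩ hpq hne
      obtain _ | p := p
      · exact absurd (by simpa using hpq) hne
      · rw [LinearMap.rTensor, TensorProduct.map_map, show K.totCounit ∘ₗ K.tι (p + 1) = 0 from
          LinearMap.ext (K.totCounit_tι_succ p)]
        simp
    · intro h; simp at h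
  | hadd x y hx hy => simp only [map_add, hx, hy]

lemma totComul_counit_right (x : K.Tot) :
    TensorProduct.rid R _ (K.totCounit.lTensor _ (K.totComul x)) = x := by
  induction x using tot_induction with
  | hι n x =>
    rw [totComul_tι, map_sum, map_sum, Finset.sum_eq_single (n, 0)]
    · rw [LinearMap.lTensor, TensorProduct.map_map,
        show K.totCounit ∘ₗ K.tι 0 = K.counit from LinearMap.ext K.totCounit_tι_zero]
      conv_rhs => rw [← K.counit_right n x]
      generalize K.comul n 0 n x = w
      induction w using TensorProduct.induction_on with
      | zero => simp
      | add x y hx hy => simp only [map_add, hx, hy]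
      | tmul x y => simp
    · rintro ⟨p, q⟩ hpq hne
      obtain _ | q := q
      · exact absurd (by simpa using hpq) hne
      · rw [LinearMap.lTensor, TensorProduct.map_map, show K.totCounit ∘ₗ K.tι (q + 1) = 0 from
          LinearMap.ext (K.totCounit_tι_succ q)]
        simp
    · intro h; simp at h
  | hadd x y hx hy => simp only [map_add, hx, hy]

/-- The group-like element of degree zero. -/
def totOne : K.Tot := K.tι 0 ((LinearEquiv.ofBijective K.counit K.connected).symm 1)

/-- Connectedness makes the degree zero part free of rank one on `totOne`. -/
lemma tι_zero_eq (x : K.cx.X 0) : K.tι 0 x = K.counit x • K.totOne := by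
  rw [totOne, ← map_smul, ← map_smul]
  congr 1
  rw [LinearEquiv.eq_symm_apply]
  simp

lemma totCounit_totOne : K.totCounit K.totOne = 1 := by
  rw [totOne, totCounit_tι_zero]
  exact (LinearEquiv.ofBijective K.counit K.connected).apply_symm_apply 1

lemma totD_totOne : K.totD K.totOne = 0 := K.totD_tι_zero _

lemma tw_totOne : K.tw K.totOne = 0 := by simp [totOne, tw_tι, br_zero]

/-- Only the component of bidegree `(0, 0)` occurs, and an element of that component has the form `z
⊗ totOne`, where `z` is found by applying the counit to the left factor. The counit axiom gives `z =
totOne`. -/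
lemma totComul_totOne : K.totComul K.totOne = K.totOne ⊗ₜ K.totOne := by
  have h : ∀ w : K.cx.X 0 ⊗[R] K.cx.X 0, TensorProduct.map (K.tι 0) (K.tι 0) w =
      TensorProduct.lid R _ (K.totCounit.rTensor _ (TensorProduct.map (K.tι 0) (K.tι 0) w)) ⊗ₜ
        K.totOne := by
    intro w
    induction w using TensorProduct.induction_on with
    | zero => simp
    | add x y hx hy => rw [map_add, map_add, map_add, add_tmul, ← hx, ← hy]
    | tmul x y =>
      rw [TensorProduct.map_tmul, LinearMap.rTensor_tmul, TensorProduct.lid_tmul,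
        totCounit_tι_zero, tι_zero_eq, tι_zero_eq, smul_smul, smul_tmul_smul, smul_tmul']
  have e : K.totComul K.totOne = TensorProduct.map (K.tι 0) (K.tι 0)
      (K.comul 0 0 0 ((LinearEquiv.ofBijective K.counit K.connected).symm 1)) := by
    rw [totOne, totComul_tι]; simp
  rw [e, h, ← e, totComul_counit_left]

end Tot

/-! ### Functoriality of the total module. -/

section Map

variable {R : Type u} [CommRing R] {K K' : ConnDGCoalg.{u, v} R} (f : Hom K K')

/-- The map of total modules induced by a morphism of dg coalgebras. -/
def Hom.totMap : K.Tot →ₗ[R] K'.Tot := K.totLift fun n => K'.tι n ∘ₗ (f.f.f n).hom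

lemma Hom.totMap_tι (n : ℕ) (x : K.cx.X n) :
    f.totMap (K.tι n x) = K'.tι n ((f.f.f n).hom x) := by simp [totMap]

lemma Hom.totMap_totD (x : K.Tot) : f.totMap (K.totD x) = K'.totD (f.totMap x) := by
  induction x using tot_induction with
  | hι n x => rw [totD_tι, totMap_tι, totMap_tι, totD_tι, comm_d]
  | hadd x y hx hy => simp [hx, hy]

lemma Hom.totMap_totCounit (x : K.Tot) : K'.totCounit (f.totMap x) = K.totCounit x := by
  induction x using tot_induction with
  | hι n x =>
    cases n with
    | zero => rw [totMap_tι, totCounit_tι_zero, totCounit_tι_zero, f.counit_comm]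
    | succ n => rw [totMap_tι, totCounit_tι_succ, totCounit_tι_succ]
  | hadd x y hx hy => simp [hx, hy]

lemma Hom.totMap_totComul (x : K.Tot) :
    K'.totComul (f.totMap x) = TensorProduct.map f.totMap f.totMap (K.totComul x) := by
  induction x using tot_induction with
  | hι n x =>
    rw [totMap_tι, totComul_tι, totComul_tι, map_sum]
    refine Finset.sum_congr rfl fun pq _ => ?_
    have e : ∀ n, f.totMap ∘ₗ K.tι n = K'.tι n ∘ₗ (f.f.f n).hom := fun n =>
      LinearMap.ext (f.totMap_tι n)
    rw [f.comul_comm, TensorProduct.map_map, TensorProduct.map_map, e, e]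
  | hadd x y hx hy => simp only [map_add, hx, hy]

lemma Hom.cobarAlgHom_tw (x : K.Tot) : f.cobarAlgHom (K.tw x) = K'.tw (f.totMap x) := by
  induction x using tot_induction with
  | hι n x => rw [tw_tι, totMap_tι, tw_tι, cobarAlgHom_br]
  | hadd x y hx hy => simp [hx, hy]

lemma Hom.cobarAlgHom_sgn (a : K.Cobar) : f.cobarAlgHom (K.sgn a) = K'.sgn (f.cobarAlgHom a) :=
  DFunLike.congr_fun (cobar_algHom_ext K (f.cobarAlgHom.comp K.sgn) (K'.sgn.comp f.cobarAlgHom)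
    (fun n x => by simp [sgn_br, cobarAlgHom_br])) a

end Map

/-! ### Twisted tensor products over the cobar construction. -/

section Twisted

variable {R : Type u} [CommRing R] (K : ConnDGCoalg.{u, v} R)

lemma sgn_sgn (a : K.Cobar) : K.sgn (K.sgn a) = a :=
  DFunLike.congr_fun (cobar_algHom_ext K (K.sgn.comp K.sgn) (AlgHom.id R _) (fun n x => by
    rw [AlgHom.comp_apply, sgn_br, map_smul, sgn_br, smul_smul, neg_one_pow_mul_self', one_smul,
      AlgHom.id_apply])) a

/-- A dg algebra with a map from the cobar construction. -/
structure DGAlg (N : Type*) [Ring N] [Algebra R N] where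
  /-- the structure map -/
  θ : K.Cobar →ₐ[R] N
  /-- the differential -/
  d : N →ₗ[R] N
  /-- the grading involution -/
  σ : N →ₐ[R] N
  d_mul : ∀ a b, d (a * b) = d a * b + σ a * d b
  d_d : ∀ a, d (d a) = 0
  σ_σ : ∀ a, σ (σ a) = a
  d_σ : ∀ a, d (σ a) = - σ (d a)
  θ_diff : ∀ a, θ (K.diff a) = d (θ a)
  θ_sgn : ∀ a, θ (K.sgn a) = σ (θ a)

/-- The cobar construction as a dg algebra over itself. -/
@[simps]
def selfDGAlg : K.DGAlg K.Cobar where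
  θ := AlgHom.id R _
  d := K.diff
  σ := K.sgn
  d_mul := K.diff_mul
  d_d := K.diff_diff
  σ_σ := K.sgn_sgn
  d_σ a := by rw [sgn_diff, neg_neg]
  θ_diff _ := rfl
  θ_sgn _ := rfl

/-- A dg algebra with zero differential which is concentrated in degree zero. -/
@[simps]
def zeroDGAlg {N : Type*} [Ring N] [Algebra R N] (θ : K.Cobar →ₐ[R] N)
    (h : ∀ a, θ (K.diff a) = 0) (h' : ∀ a, θ (K.sgn a) = θ a) : K.DGAlg N where
  θ := θ
  d := 0
  σ := AlgHom.id R _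
  d_mul _ _ := by simp
  d_d _ := rfl
  σ_σ _ := rfl
  d_σ _ := by simp
  θ_diff a := h a
  θ_sgn a := h' a

/-- A right dg comodule. -/
structure DGComod (Y : Type*) [AddCommGroup Y] [Module R Y] where
  /-- the differential -/
  D : Y →ₗ[R] Y
  /-- the grading involution -/
  σ : Y →ₗ[R] Y
  /-- the coaction -/
  ψ : Y →ₗ[R] Y ⊗[R] K.Tot
  D_D : ∀ y, D (D y) = 0
  σ_σ : ∀ y, σ (σ y) = y
  D_σ : ∀ y, D (σ y) = - σ (D y)
  ψ_D : ∀ y, ψ (D y) = D.rTensor K.Tot (ψ y) + TensorProduct.map σ K.totD (ψ y)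
  ψ_σ : ∀ y, ψ (σ y) = TensorProduct.map σ K.totSgn (ψ y)
  coassoc : ∀ y, TensorProduct.assoc R _ _ _ (ψ.rTensor K.Tot (ψ y)) =
    K.totComul.lTensor Y (ψ y)

/-- A left dg module over the cobar construction. -/
structure DGMod (B : Type*) [AddCommGroup B] [Module R B] where
  /-- the differential -/
  d : B →ₗ[R] B
  /-- the action -/
  ρ : K.Cobar →ₐ[R] Module.End R B
  d_d : ∀ b, d (d b) = 0
  d_ρ : ∀ a b, d (ρ a b) = ρ (K.diff a) b + ρ (K.sgn a) (d b)

variable {K}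

namespace DGAlg

variable {N : Type*} [Ring N] [Algebra R N] (A : K.DGAlg N)

lemma d_one : A.d 1 = 0 := by
  simpa using A.d_mul 1 1

/-- The twisting cochain. -/
def t : K.Tot →ₗ[R] N := A.θ.toLinearMap ∘ₗ K.tw

lemma t_apply (x : K.Tot) : A.t x = A.θ (K.tw x) := rfl

lemma σ_t (x : K.Tot) : A.σ (A.t x) = - A.t (K.totSgn x) := by
  rw [t_apply, t_apply, tw_totSgn, map_neg, neg_neg, A.θ_sgn]

lemma d_t (x : K.Tot) : A.d (A.t x) = - A.t (K.totD x) +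
    LinearMap.mul' R N (TensorProduct.map (A.t ∘ₗ K.totSgn) A.t (K.totComul x)) := by
  rw [t_apply, ← A.θ_diff, diff_tw, map_add, map_neg, ← t_apply]
  congr 1
  generalize K.totComul x = w
  induction w using TensorProduct.induction_on with
  | zero => simp
  | add x y hx hy => simp only [map_add, hx, hy]
  | tmul x y => simp [t_apply]

/-- The restriction of the twisted differential to `1 ⊗ K`. -/
def δ : K.Tot →ₗ[R] N ⊗[R] K.Tot :=
  TensorProduct.mk R N K.Tot 1 ∘ₗ K.totD + A.t.rTensor K.Tot ∘ₗ K.totComul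

lemma δ_apply (x : K.Tot) :
    A.δ x = 1 ⊗ₜ K.totD x + A.t.rTensor K.Tot (K.totComul x) := rfl

/-- Left multiplication on `N ⊗ Z`. -/
def lmul (R : Type u) [CommRing R] {N : Type*} [Ring N] [Algebra R N] (Z : Type*) [AddCommGroup Z]
    [Module R Z] : N →ₐ[R] Module.End R (N ⊗[R] Z) :=
  AlgHom.ofLinearMap (LinearMap.rTensorHom Z ∘ₗ LinearMap.mul R N)
    (by ext; simp) (fun a b => by ext; simp [mul_assoc])

@[simp]
lemma lmul_tmul {Z : Type*} [AddCommGroup Z] [Module R Z] (n m : N) (z : Z) :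
    lmul R Z n (m ⊗ₜ[R] z) = (n * m) ⊗ₜ z := rfl

/-- The twisted differential on `N ⊗ K`. -/
def tensD : N ⊗[R] K.Tot →ₗ[R] N ⊗[R] K.Tot :=
  A.d.rTensor K.Tot + TensorProduct.lift ((LinearMap.lcomp R _ A.δ) ∘ₗ
    (lmul R K.Tot).toLinearMap ∘ₗ A.σ.toLinearMap)

lemma tensD_tmul (n : N) (x : K.Tot) :
    A.tensD (n ⊗ₜ x) = A.d n ⊗ₜ x + lmul R K.Tot (A.σ n) (A.δ x) := rfl

lemma tensD_one_tmul (x : K.Tot) : A.tensD (1 ⊗ₜ x) = A.δ x := by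
  rw [tensD_tmul, d_one, zero_tmul, zero_add, map_one, map_one]; rfl

lemma tensD_lmul (n : N) (z : N ⊗[R] K.Tot) :
    A.tensD (lmul R K.Tot n z) = lmul R K.Tot (A.d n) z + lmul R K.Tot (A.σ n) (A.tensD z) := by
  induction z using TensorProduct.induction_on with
  | zero => simp
  | add x y hx hy => simp only [map_add, hx, hy]; abel
  | tmul m x =>
    rw [lmul_tmul, lmul_tmul, tensD_tmul, tensD_tmul, d_mul, map_add, map_mul, map_mul,
      Module.End.mul_apply, add_tmul, lmul_tmul]
    abel

/-- `a ⊗ b ⊗ c ↦ g(a) t(b) ⊗ c`. -/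
def mul₃ (g : K.Tot →ₗ[R] N) : K.Tot ⊗[R] (K.Tot ⊗[R] K.Tot) →ₗ[R] N ⊗[R] K.Tot :=
  TensorProduct.lift (LinearMap.lcomp R _ (A.t.rTensor K.Tot) ∘ₗ (lmul R K.Tot).toLinearMap ∘ₗ g)

lemma mul₃_tmul (g : K.Tot →ₗ[R] N) (x : K.Tot) (w : K.Tot ⊗[R] K.Tot) :
    A.mul₃ g (x ⊗ₜ w) = lmul R K.Tot (g x) (A.t.rTensor K.Tot w) := rfl

/-- Two cubic terms arise, one from the twisting equation for `t x'` and one from the coproduct of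
`x''`, and they cancel by coassociativity. The terms that contain `∂` cancel because the coproduct
is a chain map. -/
lemma tensD_δ (x : K.Tot) : A.tensD (A.δ x) = 0 := by
  have h1 : ∀ w : K.Tot ⊗[R] K.Tot, A.tensD (A.t.rTensor K.Tot w) =
      - (A.t ∘ₗ K.totD).rTensor K.Tot w - TensorProduct.map (A.t ∘ₗ K.totSgn) K.totD w
      + A.mul₃ (A.t ∘ₗ K.totSgn) (TensorProduct.assoc R _ _ _ (K.totComul.rTensor _ w))
      - A.mul₃ (A.t ∘ₗ K.totSgn) (K.totComul.lTensor _ w) := by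
    intro w
    induction w using TensorProduct.induction_on with
    | zero => simp
    | add x y hx hy => simp only [map_add, hx, hy]; abel
    | tmul x y =>
      have e : A.mul₃ (A.t ∘ₗ K.totSgn) (TensorProduct.assoc R _ _ _ (K.totComul x ⊗ₜ y)) =
          LinearMap.mul' R N (TensorProduct.map (A.t ∘ₗ K.totSgn) A.t (K.totComul x)) ⊗ₜ y := by
        generalize K.totComul x = w
        induction w using TensorProduct.induction_on with
        | zero => simp
        | add x y hx hy => simp only [map_add, hx, hy, add_tmul]
        | tmul a b => simp [mul₃_tmul]
      rw [LinearMap.rTensor_tmul, LinearMap.rTensor_tmul, LinearMap.rTensor_tmul,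
        LinearMap.lTensor_tmul, TensorProduct.map_tmul, tensD_tmul, d_t, σ_t, e, δ_apply,
        mul₃_tmul, map_neg, LinearMap.neg_apply, map_add, lmul_tmul, mul_one, add_tmul, neg_tmul]
      simp only [LinearMap.comp_apply]
      abel
  rw [δ_apply, map_add, tensD_one_tmul, h1, totComul_coassoc, δ_apply, totComul_totD, totD_totD,
    tmul_zero, map_add, ← LinearMap.rTensor_comp_apply, LinearMap.rTensor, LinearMap.rTensor,
    TensorProduct.map_map, LinearMap.id_comp]
  abel

lemma tensD_tensD (z : N ⊗[R] K.Tot) : A.tensD (A.tensD z) = 0 := by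
  induction z using TensorProduct.induction_on with
  | zero => simp
  | add x y hx hy => simp only [map_add, hx, hy, add_zero]
  | tmul n x =>
    rw [tensD_tmul, map_add, tensD_tmul, tensD_lmul, tensD_δ, A.d_d, A.d_σ]
    simp

/-- The coaction on `N ⊗ K`. -/
def coact (K : ConnDGCoalg.{u, v} R) (N : Type*) [AddCommGroup N] [Module R N] :
    N ⊗[R] K.Tot →ₗ[R] (N ⊗[R] K.Tot) ⊗[R] K.Tot :=
  (TensorProduct.assoc R N K.Tot K.Tot).symm.toLinearMap ∘ₗ K.totComul.lTensor N

lemma coact_tmul (n : N) (x : K.Tot) : coact K N (n ⊗ₜ x) =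
    (TensorProduct.mk R N K.Tot n).rTensor K.Tot (K.totComul x) := by
  change (TensorProduct.assoc R N K.Tot K.Tot).symm (n ⊗ₜ K.totComul x) = _
  generalize K.totComul x = w
  induction w using TensorProduct.induction_on with
  | zero => simp
  | add x y hx hy => simp only [map_add, tmul_add, hx, hy]
  | tmul a b => simp

lemma coact_lmul (n : N) (z : N ⊗[R] K.Tot) :
    coact K N (lmul R K.Tot n z) = (lmul R K.Tot n).rTensor K.Tot (coact K N z) := by
  induction z using TensorProduct.induction_on with
  | zero => simp
  | add x y hx hy => simp only [map_add, hx, hy]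
  | tmul m x =>
    rw [lmul_tmul, coact_tmul, coact_tmul, ← LinearMap.rTensor_comp_apply]
    rfl

lemma coact_map (g : N →ₗ[R] N) {f : K.Tot →ₗ[R] K.Tot}
    (hf : ∀ x, K.totComul (f x) = TensorProduct.map f f (K.totComul x)) (z : N ⊗[R] K.Tot) :
    coact K N (TensorProduct.map g f z) =
      TensorProduct.map (TensorProduct.map g f) f (coact K N z) := by
  induction z using TensorProduct.induction_on with
  | zero => simp
  | add x y hx hy => simp only [map_add, hx, hy]
  | tmul m x =>
    rw [TensorProduct.map_tmul, coact_tmul, coact_tmul, hf, LinearMap.rTensor, LinearMap.rTensor,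
      TensorProduct.map_map, TensorProduct.map_map]
    rfl

lemma coact_coassoc (z : N ⊗[R] K.Tot) :
    TensorProduct.assoc R _ _ _ ((coact K N).rTensor K.Tot (coact K N z)) =
      K.totComul.lTensor (N ⊗[R] K.Tot) (coact K N z) := by
  induction z using TensorProduct.induction_on with
  | zero => simp
  | add x y hx hy => simp only [map_add, hx, hy]
  | tmul n x =>
    let g : K.Tot ⊗[R] (K.Tot ⊗[R] K.Tot) →ₗ[R] (N ⊗[R] K.Tot) ⊗[R] (K.Tot ⊗[R] K.Tot) :=
      (TensorProduct.mk R N K.Tot n).rTensor _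
    have h := congrArg g (K.totComul_coassoc x)
    rw [coact_tmul]
    refine Eq.trans ?_ (h.trans ?_)
    · generalize K.totComul x = w
      induction w using TensorProduct.induction_on with
      | zero => simp
      | add x y hx hy => simp only [map_add, hx, hy]
      | tmul a b =>
        rw [LinearMap.rTensor_tmul, LinearMap.rTensor_tmul, LinearMap.rTensor_tmul,
          TensorProduct.mk_apply, coact_tmul]
        generalize K.totComul a = w
        induction w using TensorProduct.induction_on with
        | zero => simp
        | add x y hx hy => simp only [map_add, add_tmul, hx, hy]
        | tmul a b => simp [g]
    · generalize K.totComul x = w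
      induction w using TensorProduct.induction_on with
      | zero => simp
      | add x y hx hy => simp only [map_add, hx, hy]
      | tmul a b => simp [g]

/-- The twisting cochain consumes the leftmost factor of the coproduct and the coaction splits off
the rightmost, so the two commute by coassociativity. The second summand is the Leibniz term in the
factor which was split off. -/
lemma coact_δ (x : K.Tot) : coact K N (A.δ x) = A.δ.rTensor K.Tot (K.totComul x) +
    TensorProduct.map (TensorProduct.mk R N K.Tot 1 ∘ₗ K.totSgn) K.totD (K.totComul x) := by
  have h : coact K N (A.t.rTensor K.Tot (K.totComul x)) =
      (A.t.rTensor K.Tot ∘ₗ K.totComul).rTensor K.Tot (K.totComul x) := by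
    have h1 : ∀ w : K.Tot ⊗[R] K.Tot, coact K N (A.t.rTensor K.Tot w) =
        (A.t.rTensor K.Tot).rTensor K.Tot ((TensorProduct.assoc R _ _ _).symm
          (K.totComul.lTensor K.Tot w)) := by
      intro w
      induction w using TensorProduct.induction_on with
      | zero => simp
      | add x y hx hy => simp only [map_add, hx, hy]
      | tmul a b =>
        rw [LinearMap.rTensor_tmul, coact_tmul, LinearMap.lTensor_tmul]
        generalize K.totComul b = w
        induction w using TensorProduct.induction_on with
        | zero => simp
        | add x y hx hy => simp only [map_add, tmul_add, hx, hy]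
        | tmul a b => simp
    rw [h1, ← totComul_coassoc, LinearEquiv.symm_apply_apply, ← LinearMap.rTensor_comp_apply]
  rw [δ_apply, map_add, h, coact_tmul, totComul_totD, map_add, δ, LinearMap.rTensor_add,
    LinearMap.add_apply, ← LinearMap.rTensor_comp_apply, LinearMap.rTensor, LinearMap.rTensor,
    LinearMap.rTensor, TensorProduct.map_map, LinearMap.id_comp]
  abel

/-- The twisted tensor product `N ⊗ K` as a dg comodule. -/
@[simps]
def comod : K.DGComod (N ⊗[R] K.Tot) where
  D := A.tensD
  σ := TensorProduct.map A.σ.toLinearMap K.totSgn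
  ψ := coact K N
  D_D := A.tensD_tensD
  σ_σ y := by
    rw [TensorProduct.map_map, show A.σ.toLinearMap ∘ₗ A.σ.toLinearMap = LinearMap.id from
      LinearMap.ext A.σ_σ, show K.totSgn ∘ₗ K.totSgn = LinearMap.id from
      LinearMap.ext K.totSgn_totSgn, TensorProduct.map_id]; rfl
  D_σ y := by
    induction y using TensorProduct.induction_on with
    | zero => simp
    | add x y hx hy => simp only [map_add, hx, hy, neg_add]
    | tmul n x =>
      have h : ∀ z, TensorProduct.map A.σ.toLinearMap K.totSgn (lmul R K.Tot n z) =
          lmul R K.Tot (A.σ n) (TensorProduct.map A.σ.toLinearMap K.totSgn z) := by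
        intro z
        induction z using TensorProduct.induction_on with
        | zero => simp
        | add x y hx hy => simp only [map_add, hx, hy]
        | tmul m x => simp
      have h2 : A.δ (K.totSgn x) = - TensorProduct.map A.σ.toLinearMap K.totSgn (A.δ x) := by
        rw [δ_apply, δ_apply, totD_totSgn, totComul_totSgn, map_add, TensorProduct.map_tmul]
        rw [AlgHom.toLinearMap_apply, map_one, LinearMap.rTensor, TensorProduct.map_map,
          TensorProduct.map_map, show A.σ.toLinearMap ∘ₗ A.t = - (A.t ∘ₗ K.totSgn) from
          LinearMap.ext A.σ_t, tmul_neg, ← neg_one_smul R (A.t ∘ₗ K.totSgn),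
          TensorProduct.map_smul_left, LinearMap.id_comp, LinearMap.comp_id,
          LinearMap.smul_apply, neg_smul, one_smul, neg_add, neg_neg]
      have h3 : TensorProduct.map A.σ.toLinearMap K.totSgn (lmul R K.Tot (A.σ n) (A.δ x)) =
          lmul R K.Tot n (TensorProduct.map A.σ.toLinearMap K.totSgn (A.δ x)) := by
        generalize A.δ x = z
        induction z using TensorProduct.induction_on with
        | zero => simp
        | add x y hx hy => simp only [map_add, hx, hy]
        | tmul m x => simp [A.σ_σ]
      rw [TensorProduct.map_tmul, tensD_tmul, tensD_tmul, map_add, TensorProduct.map_tmul, h3,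
        AlgHom.toLinearMap_apply, A.σ_σ, h2, A.d_σ, AlgHom.toLinearMap_apply, map_neg, neg_tmul]
      abel
  ψ_D y := by
    induction y using TensorProduct.induction_on with
    | zero => simp
    | add x y hx hy => simp only [map_add, hx, hy]; abel
    | tmul n x =>
      rw [tensD_tmul, map_add, coact_lmul, coact_δ, coact_tmul, coact_tmul, map_add]
      generalize K.totComul x = w
      induction w using TensorProduct.induction_on with
      | zero => simp
      | add x y hx hy =>
        convert congrArg₂ (· + ·) hx hy using 1 <;> (simp only [map_add]; abel)
      | tmul a b => simp [tensD_tmul, add_tmul, add_assoc]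
  ψ_σ y := coact_map _ K.totComul_totSgn y
  coassoc := coact_coassoc

end DGAlg

namespace DGMod

variable {B : Type*} [AddCommGroup B] [Module R B] (M : K.DGMod B)

/-- The action of the twisting cochain. -/
def κ : K.Tot →ₗ[R] Module.End R B := M.ρ.toLinearMap ∘ₗ K.tw

lemma κ_apply (x : K.Tot) : M.κ x = M.ρ (K.tw x) := rfl

/-- This is the twisting equation, carried over to the operators by which `K` acts on `B`. The last
term is the derivation rule for the action. -/
lemma d_κ (x : K.Tot) (b : B) : M.d (M.κ x b) = - M.κ (K.totD x) b +
    LinearMap.mul' R (Module.End R B) (TensorProduct.map (M.κ ∘ₗ K.totSgn) M.κ (K.totComul x)) b -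
      M.κ (K.totSgn x) (M.d b) := by
  have h : M.ρ (LinearMap.mul' R K.Cobar
      (TensorProduct.map (K.tw ∘ₗ K.totSgn) K.tw (K.totComul x))) =
      LinearMap.mul' R (Module.End R B)
        (TensorProduct.map (M.κ ∘ₗ K.totSgn) M.κ (K.totComul x)) := by
    generalize K.totComul x = w
    induction w using TensorProduct.induction_on with
    | zero => simp
    | add x y hx hy => simp only [map_add, hx, hy]
    | tmul x y => simp [κ_apply]
  rw [κ_apply, M.d_ρ, diff_tw, map_add, h, κ_apply, κ_apply, tw_totSgn, map_neg, map_neg]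
  simp

end DGMod

variable {Y B : Type*} [AddCommGroup Y] [Module R Y] [AddCommGroup B] [Module R B]

/-- The twisted differential on `Y ⊗ B`. -/
def twD (C : K.DGComod Y) (M : K.DGMod B) : Y ⊗[R] B →ₗ[R] Y ⊗[R] B :=
  C.D.rTensor B + TensorProduct.map C.σ M.d -
    TensorProduct.lift (LinearMap.mk₂ R (fun y b => TensorProduct.map C.σ (M.κ.flip b) (C.ψ y))
      (by simp) (by simp) (by simp [TensorProduct.map_add_right])
      (by simp [TensorProduct.map_smul_right]))

variable (C : K.DGComod Y) (M : K.DGMod B)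

lemma twD_tmul (y : Y) (b : B) : twD C M (y ⊗ₜ b) =
    C.D y ⊗ₜ b + C.σ y ⊗ₜ M.d b - TensorProduct.map C.σ (M.κ.flip b) (C.ψ y) := rfl

/-- The differential of `κ` produces a quadratic term by the twisting equation, and applying the
coaction twice produces another. They cancel by coassociativity of the coaction. The remaining terms
cancel since the coaction is a chain map and the involution anticommutes with `D`. -/
lemma twD_twD (z : Y ⊗[R] B) : twD C M (twD C M z) = 0 := by
  induction z using TensorProduct.induction_on with
  | zero => simp
  | add x y hx hy => simp only [map_add, hx, hy, add_zero]
  | tmul y b =>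
    let m : Y ⊗[R] (K.Tot ⊗[R] K.Tot) →ₗ[R] Y ⊗[R] B :=
      (LinearMap.applyₗ b ∘ₗ LinearMap.mul' R (Module.End R B) ∘ₗ
        TensorProduct.map (M.κ ∘ₗ K.totSgn) M.κ).lTensor Y
    have h1 : ∀ w : Y ⊗[R] K.Tot, twD C M (TensorProduct.map C.σ (M.κ.flip b) w) =
        - TensorProduct.map (C.σ ∘ₗ C.D) (M.κ.flip b) w - (M.κ.flip b ∘ₗ K.totD).lTensor Y w -
          (M.κ.flip (M.d b) ∘ₗ K.totSgn).lTensor Y w + m (K.totComul.lTensor Y w) -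
          m (TensorProduct.assoc R _ _ _ (C.ψ.rTensor K.Tot w)) := by
      intro w
      induction w using TensorProduct.induction_on with
      | zero => simp
      | add x y hx hy => simp only [map_add, hx, hy]; abel
      | tmul y x =>
        have e : m (TensorProduct.assoc R _ _ _ (C.ψ y ⊗ₜ x)) =
            (M.κ.flip (M.κ x b) ∘ₗ K.totSgn).lTensor Y (C.ψ y) := by
          generalize C.ψ y = w
          induction w using TensorProduct.induction_on with
          | zero => simp
          | add x y hx hy => simp only [map_add, hx, hy, add_tmul]
          | tmul y z => simp [m]
        have e2 : TensorProduct.map C.σ (M.κ.flip (M.κ x b)) (C.ψ (C.σ y)) =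
            (M.κ.flip (M.κ x b) ∘ₗ K.totSgn).lTensor Y (C.ψ y) := by
          rw [C.ψ_σ, TensorProduct.map_map, show C.σ ∘ₗ C.σ = LinearMap.id from
            LinearMap.ext C.σ_σ]
          rfl
        rw [TensorProduct.map_tmul, twD_tmul, LinearMap.flip_apply, M.d_κ, C.σ_σ, C.D_σ, e2,
          LinearMap.rTensor_tmul, e]
        simp only [TensorProduct.map_tmul, LinearMap.lTensor_tmul, LinearMap.comp_apply,
          LinearMap.flip_apply, m, LinearMap.applyₗ_apply_apply, neg_tmul, tmul_sub, tmul_add,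
          tmul_neg]
        abel
    rw [twD_tmul, map_sub, map_add, h1, C.coassoc, twD_tmul, twD_tmul, C.D_D, M.d_d, C.D_σ,
      C.ψ_D, C.ψ_σ, map_add, LinearMap.rTensor, TensorProduct.map_map, TensorProduct.map_map,
      TensorProduct.map_map, show C.σ ∘ₗ C.σ = LinearMap.id from LinearMap.ext C.σ_σ,
      LinearMap.comp_id, LinearMap.lTensor, LinearMap.lTensor, neg_tmul]
    simp only [zero_tmul, tmul_zero]
    abel

/-- Naturality of the twisted tensor product in the module. -/
lemma lTensor_twD {B' : Type*} [AddCommGroup B'] [Module R B'] (M' : K.DGMod B') (g : B →ₗ[R] B')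
    (hd : ∀ b, g (M.d b) = M'.d (g b)) (hρ : ∀ a b, g (M.ρ a b) = M'.ρ a (g b))
    (z : Y ⊗[R] B) : g.lTensor Y (twD C M z) = twD C M' (g.lTensor Y z) := by
  induction z using TensorProduct.induction_on with
  | zero => simp
  | add x y hx hy => simp only [map_add, hx, hy]
  | tmul y b =>
    have e : g ∘ₗ M.κ.flip b = M'.κ.flip (g b) := LinearMap.ext fun x => hρ _ _
    rw [twD_tmul, LinearMap.lTensor_tmul, twD_tmul, map_sub, map_add, LinearMap.lTensor_tmul,
      LinearMap.lTensor_tmul, hd, LinearMap.lTensor, TensorProduct.map_map, e]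
    rfl

end Twisted

end ConnDGCoalg

namespace DiffMod

/-! ### Transport along linear isomorphisms. -/

section Transport

variable {R : Type*} [CommRing R] {X Y X' Y' : Type*} [AddCommGroup X] [Module R X]
  [AddCommGroup Y] [Module R Y] [AddCommGroup X'] [Module R X'] [AddCommGroup Y'] [Module R Y']
  {D : X →ₗ[R] X} {E : Y →ₗ[R] Y} {f : X →ₗ[R] Y}

lemma QI.congr {D' : X' →ₗ[R] X'} {E' : Y' →ₗ[R] Y'} {f' : X' →ₗ[R] Y'} (h : QI D E f)
    (eX : X ≃ₗ[R] X') (eY : Y ≃ₗ[R] Y') (hD : ∀ x, eX (D x) = D' (eX x))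
    (hE : ∀ y, eY (E y) = E' (eY y)) (hf : ∀ x, eY (f x) = f' (eX x)) : QI D' E' f' := by
  intro x y hx hy
  obtain ⟨x, rfl⟩ := eX.surjective x
  obtain ⟨y, rfl⟩ := eY.surjective y
  obtain ⟨x', y', rfl, rfl⟩ := h x y (eX.injective (by rw [hD, hx, map_zero]))
    (eY.injective (by rw [hf, hE, hy]))
  exact ⟨eX x', eY y', hD x', by rw [map_add, hf, hE]⟩

lemma comm_lTensor {Z Z' W : Type*} [AddCommGroup Z] [Module R Z] [AddCommGroup Z'] [Module R Z']
    [AddCommGroup W] [Module R W] (g : Z →ₗ[R] Z') (z : W ⊗[R] Z) :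
    TensorProduct.comm R W Z' (g.lTensor W z) = g.rTensor W (TensorProduct.comm R W Z z) := by
  induction z using TensorProduct.induction_on with
  | zero => simp
  | add x y hx hy => simp only [map_add, hx, hy]
  | tmul x y => simp

lemma QI.lTensor_iff_rTensor {N : Type*} [AddCommGroup N] [Module R N] :
    QI (D.lTensor N) (E.lTensor N) (f.lTensor N) ↔
      QI (D.rTensor N) (E.rTensor N) (f.rTensor N) := by
  refine ⟨fun h => h.congr (TensorProduct.comm R _ _) (TensorProduct.comm R _ _) (comm_lTensor _)
    (comm_lTensor _) (comm_lTensor _), fun h => h.congr (TensorProduct.comm R _ _).symm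
    (TensorProduct.comm R _ _).symm ?_ ?_ ?_⟩ <;>
  · intro x
    rw [LinearEquiv.symm_apply_eq, comm_lTensor, LinearEquiv.apply_symm_apply]

variable {U : ℕ → Type*} [∀ n, AddCommGroup (U n)] [∀ n, Module R (U n)]

/-- Transport of a decomposition along an isomorphism. -/
def Decomp.congr (P : Decomp R X U) (e : X ≃ₗ[R] X') : Decomp R X' U where
  ι n := e.toLinearMap ∘ₗ P.ι n
  π n := P.π n ∘ₗ e.symm.toLinearMap
  π_ι n u := by simp [P.π_ι]
  π_ι_ne m n u h := by simp [P.π_ι_ne m n u h]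
  exists_sum x := by
    obtain ⟨N, hN⟩ := P.exists_sum (e.symm x)
    refine ⟨N, fun M hM => ?_⟩
    refine (e.apply_symm_apply x).symm.trans ((congrArg e (hN M hM)).trans ?_)
    rw [map_sum]
    rfl

lemma Decomp.flat (P : Decomp R X U) [Module.Flat R X] (n : ℕ) : Module.Flat R (U n) :=
  Module.Flat.of_retract (P.ι n) (P.π n) (LinearMap.ext (P.π_ι n))

end Transport

/-! ### Flatness of tensor powers and of the tensor algebra. -/

section Flat

variable {R : Type*} [CommRing R] (M : Type*) [AddCommGroup M] [Module R M] [Module.Flat R M]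

/-- A tensor power of length `n + 1` is the tensor product of those of lengths `n` and `1`, and
tensor products of flat modules are flat. -/
lemma flat_tensorPower (n : ℕ) : Module.Flat R (⨂[R]^n M) := by
  induction n with
  | zero => exact Module.Flat.of_linearEquiv (PiTensorProduct.isEmptyEquiv (Fin 0))
  | succ n ih =>
    have : Module.Flat R (⨂[R]^1 M) :=
      Module.Flat.of_linearEquiv (PiTensorProduct.subsingletonEquiv (0 : Fin 1))
    exact Module.Flat.of_linearEquiv (TensorPower.mulEquiv (n := n) (m := 1)).symm

lemma flat_tensorAlgebra : Module.Flat R (TensorAlgebra R M) := by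
  have := flat_tensorPower (R := R) M
  exact Module.Flat.of_linearEquiv (TensorAlgebra.equivDirectSum (R := R) (M := M)).toLinearEquiv

end Flat

end DiffMod

namespace ConnDGCoalg

open DiffMod

/-! ### The grading of the cobar construction, and the use of flatness. -/

section Grading

variable {R : Type u} [CommRing R] (K : ConnDGCoalg.{u, v} R)

instance : SetLike.GradedMonoid K.deg where
  one_mem := K.one_mem_deg
  mul_mem _ _ _ _ := K.mul_mem_deg

/-- The splitting of the cobar construction into homogeneous components. -/
def split : K.Cobar →ₐ[R] DirectSum ℕ fun n => K.deg n :=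
  TensorAlgebra.lift R (DirectSum.toModule R ℕ _ fun n =>
    DirectSum.lof R ℕ (fun n => K.deg n) n ∘ₗ (K.br (n + 1)).codRestrict _ (K.br_mem_deg n))

lemma split_br (n : ℕ) (x : K.cx.X (n + 1)) : K.split (K.br (n + 1) x) =
    DirectSum.of (fun n => K.deg n) n ⟨K.br (n + 1) x, K.br_mem_deg n x⟩ := by
  conv_lhs => rw [br]
  simp [split]
  rfl

/-- Monomials span each `deg n`, so this determines `split` on all homogeneous elements. The
induction on the length uses that `split` is multiplicative. -/
lemma split_monomial (L : List (Σ n : ℕ, K.cx.X (n + 1))) : K.split (K.monomial L) =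
    DirectSum.of (fun n => K.deg n) (L.map Sigma.fst).sum ⟨K.monomial L, K.monomial_mem L⟩ := by
  induction L with
  | nil => simp only [monomial_nil, map_one]; rfl
  | cons s L ih =>
    obtain ⟨n, x⟩ := s
    have e : K.split (K.monomial (⟨n, x⟩ :: L)) =
        K.split (K.br (n + 1) x) * K.split (K.monomial L) := by
      rw [monomial_cons, map_mul]
    rw [e, ih, split_br, DirectSum.of_mul_of]
    have h : ∀ (m : ℕ) (a b : K.deg m), a.1 = b.1 → DirectSum.of (fun n => K.deg n) m a =
        DirectSum.of (fun n => K.deg n) m b := fun m a b hab => congrArg _ (Subtype.ext hab)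
    exact h _ _ _ (K.monomial_cons n x L).symm

/-- The spans `deg n` are not independent by construction. The algebra map `split`, which exists by
the universal property of the tensor algebra, is the inverse of the sum map and proves it. -/
instance : GradedAlgebra K.deg :=
  GradedAlgebra.ofAlgHom K.deg K.split
    (cobar_algHom_ext K _ _ fun n x => by
      rw [AlgHom.comp_apply, split_br, AlgHom.id_apply]
      exact DirectSum.coeAlgHom_of _ _ _)
    (fun n a => by
      have h : K.deg n ≤ (LinearMap.range (DirectSum.lof R ℕ (fun n => K.deg n) n)).comap
          K.split.toLinearMap := by
        conv_lhs => rw [deg]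
        rw [Submodule.span_le]
        rintro _ ⟨L, rfl, rfl⟩
        exact ⟨_, (K.split_monomial L).symm⟩
      obtain ⟨b, hb⟩ := h a.2
      have e : (DirectSum.coeAlgHom K.deg).comp K.split = AlgHom.id R _ :=
        cobar_algHom_ext K _ _ fun n x => by
          rw [AlgHom.comp_apply, split_br, AlgHom.id_apply]
          exact DirectSum.coeAlgHom_of _ _ _
      have e' : (b : K.Cobar) = a := by
        have e1 := DFunLike.congr_fun e a.1
        rw [AlgHom.comp_apply, AlgHom.id_apply] at e1
        rw [← e1]
        refine Eq.trans ?_ (congrArg (DirectSum.coeAlgHom K.deg) hb)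
        exact (DirectSum.coeAlgHom_of _ _ _).symm
      obtain rfl : b = a := Subtype.ext e'
      exact hb.symm)

/-- The decomposition of the cobar construction into homogeneous components. -/
def cobarDecomp : Decomp R K.Cobar (fun n => K.deg n) :=
  (Decomp.directSum R (fun n => K.deg n)).congr (DirectSum.decomposeLinearEquiv K.deg).symm

lemma cobarDecomp_ι (n : ℕ) (a : K.deg n) : K.cobarDecomp.ι n a = a :=
  DirectSum.decompose_symm_of K.deg a

/-- The component of the differential in degree `n + 1`. -/
def diffDeg (n : ℕ) : K.deg (n + 1) →ₗ[R] K.deg n := K.diff.restrict fun _ ha => K.diff_mem ha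

lemma diff_homog : K.cobarDecomp.Homog K.diff K.diffDeg where
  zero a := by rw [cobarDecomp_ι, K.diff_of_mem_zero a.2]
  succ n a := by rw [cobarDecomp_ι, cobarDecomp_ι]; rfl

/-- A homogeneous part is a retract of the whole cobar construction, which is the tensor algebra of
a flat module. -/
lemma flat_deg (h : ∀ n, Module.Flat R (K.cx.X n)) (n : ℕ) : Module.Flat R (K.deg n) := by
  have : Module.Flat R K.Cobar := flat_tensorAlgebra K.Desusp
  exact K.cobarDecomp.flat n

variable {K} {K' : ConnDGCoalg.{u, v} R} (f : Hom K K')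

/-- This passes from the chain complex of homogeneous parts to the whole cobar algebra with its
differential, by matching `chainComplex_quasiIso_iff` with `QI.iff_graded`. -/
lemma Hom.qi_cobar (hf : f.IsOmegaQuasiIso) : QI K.diff K'.diff f.cobarAlgHom.toLinearMap := by
  have h := (chainComplex_quasiIso_iff _).1 hf
  refine (QI.iff_graded K.diff_homog K'.diff_homog (φ := fun n =>
    f.cobarAlgHom.toLinearMap.restrict fun _ ha => f.cobarAlgHom_mem ha) ?_).2 ⟨?_, ?_⟩
  · intro n a
    rw [cobarDecomp_ι, cobarDecomp_ι]; rfl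
  · intro y
    obtain ⟨x, y', e⟩ := h.1 y
    rw [cobar_d] at e
    exact ⟨x, y', e⟩
  · intro n x y hx hy
    obtain ⟨x', y', e1, e2⟩ := h.2 n x y (by
      cases n with
      | zero => rw [K.cobar.shape _ _ (by simp)]; rfl
      | succ n =>
        rw [cobarDecomp_ι] at hx
        have e : (K.cobar.d (n + 1) (n + 1 - 1)) = K.cobar.d (n + 1) n := rfl
        rw [e, cobar_d]
        exact Subtype.ext hx) (by rw [cobar_d]; exact hy)
    rw [cobar_d] at e1 e2
    exact ⟨x', y', e1, e2⟩

/-- This is where flatness enters: the mapping cone of `Ωf` is an exact bounded below complex of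
flat modules, so it stays exact with arbitrary coefficients. -/
lemma Hom.qi_cobar_rTensor (hf : f.IsOmegaQuasiIso) (hK : ∀ n, Module.Flat R (K.cx.X n))
    (hK' : ∀ n, Module.Flat R (K'.cx.X n)) (N : Type (max u v)) [AddCommGroup N] [Module R N] :
    QI (K.diff.rTensor N) (K'.diff.rTensor N) (f.cobarAlgHom.toLinearMap.rTensor N) := by
  have := K.flat_deg hK
  have := K'.flat_deg hK'
  rw [← QI.lTensor_iff_rTensor]
  exact QI.lTensor_of_flat.{u, v} (φ := fun n =>
    f.cobarAlgHom.toLinearMap.restrict fun _ ha => f.cobarAlgHom_mem ha) K.diff_homog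
    K'.diff_homog (fun n a => by rw [cobarDecomp_ι, cobarDecomp_ι]; rfl) K.diff_diff K'.diff_diff
    f.cobarAlgHom_diff (f.qi_cobar hf) N

end Grading

end ConnDGCoalg

namespace DiffMod

/-- The hypotheses of `QI.of_twoStep` are identities between linear maps, so they survive tensoring
with any module, flat or not. -/
lemma QI.of_twoStep_rTensor {R : Type*} [CommRing R] {X Y : Type*} [AddCommGroup X] [Module R X]
    [AddCommGroup Y] [Module R Y] {D : X →ₗ[R] X} {f : X →ₗ[R] Y}
    {X₀ : Type*} [AddCommGroup X₀] [Module R X₀] (c : X →ₗ[R] X₀)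
    (h : X₀ →ₗ[R] X) (i : Y →ₗ[R] X) (k : X₀ →ₗ[R] X)
    (hDD : ∀ x, D (D x) = 0) (hDi : ∀ y, D (i y) = 0) (hfi : ∀ y, f (i y) = y)
    (h1 : ∀ x, c (D (h (c x))) = c (x - i (f x)))
    (h2 : ∀ x, h (c (D x)) = x + k (c x)) (N : Type*) [AddCommGroup N] [Module R N] :
    QI (D.rTensor N) 0 (f.rTensor N) := by
  refine QI.of_twoStep (c.rTensor N) (h.rTensor N) (i.rTensor N) (k.rTensor N) ?_ ?_ ?_ ?_ ?_ <;>
  · intro z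
    induction z using TensorProduct.induction_on with
    | zero => simp
    | add x y hx hy => simp only [map_add, map_sub, hx, hy] <;> abel
    | tmul x n =>
      simp only [LinearMap.rTensor_tmul, hDD, hDi, hfi, h1, h2, add_tmul, map_sub, sub_tmul,
        zero_tmul]

end DiffMod

namespace ConnDGCoalg

open DiffMod

/-! ### Contraction of the universal twisted tensor product onto the ground ring. -/

section Acyclic

variable {R : Type u} [CommRing R] {K : ConnDGCoalg.{u, v} R}

/-- The inclusion of the components of positive degree. -/
def posIncl (K : ConnDGCoalg.{u, v} R) : K.Desusp →ₗ[R] K.Tot :=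
  DirectSum.toModule R ℕ K.Tot fun n => K.tι (n + 1)

lemma posIncl_lof (n : ℕ) (x : K.cx.X (n + 1)) :
    K.posIncl (DirectSum.lof R ℕ (fun n => K.cx.X (n + 1)) n x) = K.tι (n + 1) x :=
  DirectSum.toModule_lof (M := fun n => K.cx.X (n + 1)) R n x

lemma tw_posIncl (y : K.Desusp) : K.tw (K.posIncl y) = TensorAlgebra.ι R y := by
  induction y using DirectSum.induction_on with
  | zero => simp
  | of n x => exact (congrArg _ (posIncl_lof n x)).trans (K.tw_tι _ _)
  | add x y hx hy => simp only [map_add, hx, hy]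

lemma totCounit_posIncl (y : K.Desusp) : K.totCounit (K.posIncl y) = 0 := by
  induction y using DirectSum.induction_on with
  | zero => simp
  | of n x => exact (congrArg _ (posIncl_lof n x)).trans (K.totCounit_tι_succ _ _)
  | add x y hx hy => simp only [map_add, hx, hy, add_zero]

/-- The total module is generated by multiples of `totOne` and the part of positive degree. On the
first the twisting cochain vanishes, and on the second the counit does. -/
lemma tot_induction_pos {P : K.Tot → Prop} (x : K.Tot) (hone : ∀ r : R, P (r • K.totOne))
    (hpos : ∀ y, P (K.posIncl y)) (hadd : ∀ x y, P x → P y → P (x + y)) : P x := by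
  induction x using tot_induction with
  | hι n x =>
    cases n with
    | zero => rw [tι_zero_eq]; exact hone _
    | succ n => rw [← posIncl_lof]; exact hpos _
  | hadd x y hx hy => exact hadd x y hx hy

/-- The contractions are defined by recursion on left multiplication with generators (`recL`); this
is the matching induction principle. -/
lemma cobar_left_induction {P : K.Cobar → Prop} (a : K.Cobar) (hone : P 1)
    (hadd : ∀ a b, P a → P b → P (a + b)) (hsmul : ∀ (r : R) a, P a → P (r • a))
    (hmul : ∀ n x a, P a → P (K.br (n + 1) x * a)) : P a := by
  have h : ∀ c, P c → P (a * c) := by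
    induction a using cobar_induction with
    | halg r => intro c hc; rw [← Algebra.smul_def]; exact hsmul _ _ hc
    | hbr n x => exact hmul n x
    | hmul a b ha hb => intro c hc; rw [mul_assoc]; exact ha _ (hb _ hc)
    | hadd a b ha hb => intro c hc; rw [add_mul]; exact hadd _ _ (ha _ hc) (hb _ hc)
  simpa using h 1 hone

section contr

variable {P : Type*} [AddCommMonoid P] [Module R P] (g : K.Desusp →ₗ[R] Module.End R P) (p : P)

/-- The linear map on the cobar construction with prescribed value at `1` and prescribed behaviour
under left multiplication by generators. -/
def recL : K.Cobar →ₗ[R] P := LinearMap.applyₗ p ∘ₗ (TensorAlgebra.lift R g).toLinearMap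

lemma recL_one : recL g p 1 = p := by simp [recL]

lemma recL_mul (y : K.Desusp) (a : K.Cobar) :
    recL g p (TensorAlgebra.ι R y * a) = g y (recL g p a) := by simp [recL]

end contr

/-- The augmentation of the cobar construction. -/
abbrev aug (K : ConnDGCoalg.{u, v} R) : K.Cobar →ₐ[R] R := TensorAlgebra.lift R 0

lemma aug_ι (y : K.Desusp) : K.aug (TensorAlgebra.ι R y) = 0 := by simp [aug]

lemma aug_br (n : ℕ) (x : K.cx.X n) : K.aug (K.br n x) = 0 := by
  cases n with
  | zero => simp [br_zero]
  | succ n => exact aug_ι _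

lemma aug_diff (a : K.Cobar) : K.aug (K.diff a) = 0 := by
  induction a using cobar_induction with
  | halg r => simp [diff_algebraMap]
  | hadd a b ha hb => rw [map_add, map_add, ha, hb, add_zero]
  | hmul a b ha hb => rw [diff_mul, map_add, map_mul, map_mul, ha, hb, zero_mul, mul_zero, add_zero]
  | hbr n x =>
    rw [diff_br_all, map_add, map_neg, aug_br, neg_zero, zero_add]
    simp only [quad, LinearMap.sum_apply, map_sum, LinearMap.smul_apply, LinearMap.comp_apply,
      map_smul]
    refine Finset.sum_eq_zero fun pq _ => ?_
    generalize K.comul pq.1 pq.2 (n + 1) x = w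
    induction w using TensorProduct.induction_on with
    | zero => simp
    | add x y hx hy => rw [map_add, map_add, smul_add, hx, hy, add_zero]
    | tmul x y => rw [br₂_tmul, map_mul, aug_br, zero_mul, smul_zero]

lemma aug_sgn (a : K.Cobar) : K.aug (K.sgn a) = K.aug a :=
  DFunLike.congr_fun (cobar_algHom_ext K (K.aug.comp K.sgn) K.aug (fun n x => by
    rw [AlgHom.comp_apply, sgn_br, map_smul, aug_br, smul_zero])) a

/-- The counit on the second factor. -/
def counitR (K : ConnDGCoalg.{u, v} R) (N : Type*) [AddCommGroup N] [Module R N] :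
    N ⊗[R] K.Tot →ₗ[R] N := (TensorProduct.rid R N).toLinearMap ∘ₗ K.totCounit.lTensor N

@[simp]
lemma counitR_tmul {N : Type*} [AddCommGroup N] [Module R N] (n : N) (x : K.Tot) :
    K.counitR N (n ⊗ₜ x) = K.totCounit x • n := rfl

lemma counitR_rTensor {N : Type*} [AddCommGroup N] [Module R N] (g : K.Tot →ₗ[R] N) (x : K.Tot) :
    K.counitR N (g.rTensor K.Tot (K.totComul x)) = g x := by
  conv_rhs => rw [← K.totComul_counit_right x]
  generalize K.totComul x = w
  induction w using TensorProduct.induction_on with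
  | zero => simp
  | add x y hx hy => simp only [map_add, hx, hy]
  | tmul x y => simp

section DGAlg

variable {N : Type*} [Ring N] [Algebra R N] (A : K.DGAlg N)

lemma counitR_lmul (n : N) (z : N ⊗[R] K.Tot) :
    K.counitR N (DGAlg.lmul R K.Tot n z) = n * K.counitR N z := by
  induction z using TensorProduct.induction_on with
  | zero => simp
  | add x y hx hy => simp only [map_add, hx, hy, mul_add]
  | tmul x y => simp

lemma counitR_δ (x : K.Tot) : K.counitR N (A.δ x) = A.t x := by
  rw [DGAlg.δ_apply, map_add, counitR_rTensor, counitR_tmul, totCounit_totD, zero_smul, zero_add]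

lemma counitR_tensD (n : N) (x : K.Tot) :
    K.counitR N (A.tensD (n ⊗ₜ x)) = K.totCounit x • A.d n + A.σ n * A.t x := by
  rw [DGAlg.tensD_tmul, map_add, counitR_tmul, counitR_lmul, counitR_δ]

lemma δ_totOne : A.δ K.totOne = 0 := by
  rw [DGAlg.δ_apply, totD_totOne, totComul_totOne, LinearMap.rTensor_tmul, DGAlg.t_apply,
    tw_totOne]
  simp

/-- A dg algebra over the cobar construction as a left module. -/
@[simps]
def DGAlg.mod : K.DGMod N where
  d := A.d
  ρ := (Algebra.lmul R N).comp A.θ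
  d_d := A.d_d
  d_ρ a b := by
    simp [A.d_mul, A.θ_diff, A.θ_sgn]

end DGAlg

/-- The contraction of the universal twisted tensor product, with the augmentation as second
component. -/
def contrAct (K : ConnDGCoalg.{u, v} R) :
    K.Desusp →ₗ[R] Module.End R ((K.Cobar ⊗[R] K.Tot) × R) :=
  LinearMap.mk₂ R (fun y p => (DGAlg.lmul R K.Tot (K.sgn (TensorAlgebra.ι R y)) p.1 +
      p.2 • (1 ⊗ₜ K.posIncl y), 0))
    (fun y y' p => Prod.ext (by simp [tmul_add]; abel) (by simp))
    (fun r y p => Prod.ext (by simp [smul_comm r]) (by simp))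
    (fun y p p' => Prod.ext (by simp [add_smul]; abel) (by simp))
    (fun r y p => Prod.ext (by simp [smul_smul]) (by simp))

/-- The contraction of the universal twisted tensor product. -/
def contr (K : ConnDGCoalg.{u, v} R) : K.Cobar →ₗ[R] K.Cobar ⊗[R] K.Tot :=
  LinearMap.fst R _ _ ∘ₗ recL K.contrAct (0, 1)

lemma contr_one : K.contr 1 = 0 := by
  rw [contr, LinearMap.comp_apply, recL_one]; rfl

/-- In closed form the contraction moves the last letter into the coalgebra factor: `{y₁|…|y_k}`
goes to `{y₁|…|y_{k-1}} ⊗ y_k` up to sign. The augmentation term starts the recursion, since it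
detects when no letter is left behind `y`. -/
lemma contr_mul (y : K.Desusp) (a : K.Cobar) : K.contr (TensorAlgebra.ι R y * a) =
    DGAlg.lmul R K.Tot (K.sgn (TensorAlgebra.ι R y)) (K.contr a) +
      K.aug a • (1 ⊗ₜ K.posIncl y) := by
  have h : (recL K.contrAct (0, 1) a).2 = K.aug a := by
    induction a using cobar_left_induction with
    | hone => rw [recL_one, map_one]
    | hadd a b ha hb => rw [map_add, map_add, ← ha, ← hb]; rfl
    | hsmul r a ha => rw [map_smul, map_smul, ← ha]; rfl
    | hmul n x a ha =>
      rw [map_mul K.aug, aug_br, zero_mul]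
      exact (congrArg Prod.snd (recL_mul _ _ _ _)).trans rfl
  rw [contr, LinearMap.comp_apply, recL_mul, ← h]
  rfl

lemma counitR_contr (a : K.Cobar) : K.counitR K.Cobar (K.contr a) = 0 := by
  induction a using cobar_left_induction with
  | hone => rw [contr_one, map_zero]
  | hadd a b ha hb => rw [map_add, map_add, ha, hb, add_zero]
  | hsmul r a ha => rw [map_smul, map_smul, ha, smul_zero]
  | hmul n x a ha =>
    have e := contr_mul (DirectSum.lof R ℕ (fun n => K.cx.X (n + 1)) n x) a
    refine (congrArg _ e).trans ?_
    rw [map_add, counitR_lmul, ha, mul_zero, map_smul, counitR_tmul, totCounit_posIncl]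
    simp

/-- The values of `contr` lie over coalgebra elements of positive degree, so after the counit only
the twisting term survives. It multiplies the last letter back, which recovers everything except the
constant term. -/
lemma counitR_tensD_contr (a : K.Cobar) :
    K.counitR K.Cobar (K.selfDGAlg.tensD (K.contr a)) = a - K.aug a • 1 := by
  induction a using cobar_left_induction with
  | hone => rw [contr_one, map_zero, map_zero, map_one, one_smul, sub_self]
  | hadd a b ha hb => rw [map_add, map_add, map_add, ha, hb, map_add, add_smul]; abel
  | hsmul r a ha =>
    rw [map_smul, map_smul, map_smul, ha, map_smul, smul_sub, smul_smul, smul_eq_mul]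
  | hmul n x a ha =>
    have e := contr_mul (DirectSum.lof R ℕ (fun n => K.cx.X (n + 1)) n x) a
    refine (congrArg (fun z => K.counitR K.Cobar (K.selfDGAlg.tensD z)) e).trans ?_
    have e2 : TensorAlgebra.ι R (DirectSum.lof R ℕ (fun n => K.cx.X (n + 1)) n x) =
      K.br (n + 1) x := rfl
    rw [map_add, map_add, DGAlg.tensD_lmul, map_add, counitR_lmul, counitR_lmul, ha, counitR_contr,
      mul_zero, zero_add, map_smul, map_smul, DGAlg.tensD_one_tmul, counitR_δ, DGAlg.t_apply,
      tw_posIncl, map_mul, e2, aug_br]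
    simp [sgn_sgn, mul_sub]

/-- Conversely, an element `a ⊗ y` over a positive degree `y` is recovered from its twisting term
`σ(a) t(y)`. -/
lemma contr_sgn_mul (a : K.Cobar) (y : K.Desusp) :
    K.contr (K.sgn a * TensorAlgebra.ι R y) = a ⊗ₜ K.posIncl y := by
  induction a using cobar_left_induction with
  | hone =>
    have e := contr_mul y 1
    rw [mul_one] at e
    rw [map_one, one_mul, e, contr_one, map_zero, zero_add, map_one, one_smul]
  | hadd a b ha hb => rw [map_add, add_mul, map_add, ha, hb, add_tmul]
  | hsmul r a ha => rw [map_smul, smul_mul_assoc, map_smul, ha, smul_tmul']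
  | hmul n x a ha =>
    have e : K.contr (K.br (n + 1) x * (K.sgn a * TensorAlgebra.ι R y)) = _ :=
      contr_mul (DirectSum.lof R ℕ (fun n => K.cx.X (n + 1)) n x) _
    have e2 : TensorAlgebra.ι R (DirectSum.lof R ℕ (fun n => K.cx.X (n + 1)) n x) =
      K.br (n + 1) x := rfl
    rw [map_mul K.sgn, sgn_br, mul_assoc, smul_mul_assoc, map_smul, e, ha, e2, map_mul K.aug, aug_ι,
      mul_zero,
      zero_smul, add_zero, sgn_br, map_smul, LinearMap.smul_apply, smul_smul,
      neg_one_pow_mul_self', one_smul, DGAlg.lmul_tmul]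

/-- The universal twisted tensor product is acyclic. -/
lemma qi_universal (N : Type*) [AddCommGroup N] [Module R N] :
    QI (R := R) (X := (K.Cobar ⊗[R] K.Tot) ⊗[R] N) (Y := R ⊗[R] N) (K.selfDGAlg.tensD.rTensor N) 0
      ((K.aug.toLinearMap ∘ₗ K.counitR K.Cobar).rTensor N) := by
  -- The projection `counitR` has the part `ΩK ⊗ K₊` over positive degrees as its kernel. The
  -- component of the differential from that part to `ΩK ⊗ 1` is a bijection onto the augmentation
  -- ideal with inverse `contr`. The map `k` accounts for the elements `a ⊗ 1`, whose image under
  -- `counitR ∘ D` is the cobar differential of `a`.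
  refine QI.of_twoStep_rTensor (K.counitR K.Cobar) K.contr
    (LinearMap.toSpanSingleton R _ (1 ⊗ₜ K.totOne))
    (K.contr ∘ₗ K.diff - (TensorProduct.mk R _ _).flip K.totOne)
    K.selfDGAlg.tensD_tensD ?_ ?_ ?_ ?_ N
  · intro r
    rw [LinearMap.toSpanSingleton_apply, map_smul, DGAlg.tensD_one_tmul, δ_totOne, smul_zero]
  · intro r
    simp [totCounit_totOne]
  · intro z
    rw [counitR_tensD_contr, map_sub, LinearMap.toSpanSingleton_apply, map_smul, counitR_tmul,
      totCounit_totOne, one_smul]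
    rfl
  · intro z
    induction z using TensorProduct.induction_on with
    | zero => simp
    | add x y hx hy => simp only [map_add, hx, hy]; abel
    | tmul a x =>
      rw [counitR_tensD]
      induction x using tot_induction_pos with
      | hone r => simp [totCounit_totOne, DGAlg.t_apply, tw_totOne, smul_sub]
      | hpos y =>
        rw [totCounit_posIncl, counitR_tmul, totCounit_posIncl, DGAlg.t_apply, tw_posIncl]
        simp [contr_sgn_mul]
      | hadd x y hx hy =>
        convert congrArg₂ (· + ·) hx hy using 1
        · simp only [map_add, add_smul, mul_add]; abel
        · simp only [map_add, tmul_add]; abel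

end Acyclic

/-! ### Contraction of the two-sided twisted tensor product `N ⊗ K ⊗ ΩK` onto `N`. -/

section FreeModule

set_option maxSynthPendingDepth 4

variable {R : Type u} [CommRing R] {K : ConnDGCoalg.{u, v} R} {N : Type*} [Ring N] [Algebra R N]
  (θ : K.Cobar →ₐ[R] N) (h : ∀ a, θ (K.diff a) = 0) (h' : ∀ a, θ (K.sgn a) = θ a)

section Mod

variable {B : Type*} [AddCommGroup B] [Module R B] (M : K.DGMod B)

/-- Under the counit of the middle factor the differential shows the two ways of absorbing `x`:
multiplication into `N` on the left, and the action on `B` on the right, with opposite signs. -/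
lemma counitR_twD (n : N) (x : K.Tot) (b : B) :
    (K.counitR N).rTensor B (twD (K.zeroDGAlg θ h h').comod M ((n ⊗ₜ x) ⊗ₜ b)) =
      (n * θ (K.tw x)) ⊗ₜ b + (K.totCounit x • n) ⊗ₜ M.d b - n ⊗ₜ M.κ x b := by
  have e : ∀ w : K.Tot ⊗[R] K.Tot, (K.counitR N).rTensor B (TensorProduct.map
      (TensorProduct.map (AlgHom.id R N).toLinearMap K.totSgn) (M.κ.flip b)
      ((TensorProduct.mk R N K.Tot n).rTensor K.Tot w)) =
      n ⊗ₜ M.κ (TensorProduct.lid R _ (K.totCounit.rTensor _ w)) b := by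
    intro w
    induction w using TensorProduct.induction_on with
    | zero => simp
    | add x y hx hy => simp only [map_add, hx, hy, tmul_add, LinearMap.add_apply]
    | tmul x y => simp [totCounit_totSgn, smul_tmul']
  rw [twD_tmul, map_sub, map_add, DGAlg.comod_ψ, DGAlg.comod_σ, DGAlg.coact_tmul]
  refine congrArg₂ _ (congrArg₂ _ ?_ ?_) ((e _).trans (by rw [totComul_counit_left]))
  · rw [LinearMap.rTensor_tmul, DGAlg.comod_D, counitR_tensD]
    simp [DGAlg.t_apply]
  · simp [totCounit_totSgn]

end Mod

/-- The operation of generators which defines the contraction of the two-sided twisted tensor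
product. -/
def contrAct₂ : K.Desusp →ₗ[R]
    Module.End R ((N →ₗ[R] (N ⊗[R] K.Tot) ⊗[R] K.Cobar) × K.Cobar) :=
  LinearMap.mk₂ R (fun y p =>
      ((TensorProduct.mk R _ _).flip p.2 ∘ₗ (TensorProduct.mk R N K.Tot).flip (K.posIncl y) +
        p.1 ∘ₗ LinearMap.mulRight R (θ (TensorAlgebra.ι R y)), TensorAlgebra.ι R y * p.2))
    (fun y y' p => Prod.ext (LinearMap.ext fun n => by
      simp [mul_add]; abel)
      (by simp [add_mul]))
    (fun r y p => Prod.ext (LinearMap.ext fun n => by simp [smul_tmul']) (by simp))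
    (fun y p p' => Prod.ext (LinearMap.ext fun n => by simp; abel) (by simp [mul_add]))
    (fun r y p => Prod.ext (LinearMap.ext fun n => by simp) (by simp))

/-- The contraction of the two-sided twisted tensor product. -/
def contr₂ : K.Cobar →ₗ[R] N →ₗ[R] (N ⊗[R] K.Tot) ⊗[R] K.Cobar :=
  LinearMap.fst R _ _ ∘ₗ recL (contrAct₂ θ) (0, 1)

lemma contr₂_one : contr₂ θ 1 = 0 := by
  rw [contr₂, LinearMap.comp_apply, recL_one]; rfl

/-- In closed form, `n` and `{y₁|…|y_k}` give the sum over `i` of `n θ(y₁⋯y_{i-1}) ⊗ y_i ⊗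
{y_{i+1}|…|y_k}`: each letter in turn is placed in the middle. The second component of the recursion
merely carries the word `a` along. -/
lemma contr₂_mul (y : K.Desusp) (a : K.Cobar) (n : N) : contr₂ θ (TensorAlgebra.ι R y * a) n =
    (n ⊗ₜ K.posIncl y) ⊗ₜ a + contr₂ θ a (n * θ (TensorAlgebra.ι R y)) := by
  have h : (recL (contrAct₂ θ) (0, 1) a).2 = a := by
    induction a using cobar_left_induction with
    | hone => rw [recL_one]
    | hadd a b ha hb => rw [map_add, Prod.snd_add, ha, hb]
    | hsmul r a ha => rw [map_smul, Prod.smul_snd, ha]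
    | hmul n x a ha =>
      refine (congrArg Prod.snd (recL_mul (contrAct₂ θ) (0, 1)
        (DirectSum.lof R ℕ (fun n => K.cx.X (n + 1)) n x) a)).trans ?_
      exact congrArg (fun b => K.br (n + 1) x * b) ha
  rw [contr₂, LinearMap.comp_apply, recL_mul]
  change (n ⊗ₜ K.posIncl y) ⊗ₜ (recL (contrAct₂ θ) (0, 1) a).2 + _ = _
  rw [h]
  rfl

/-- By `counitR_twD` each summand contributes the difference of two consecutive ways to cut the
word, so the sum telescopes to the two extreme cuts. -/
lemma counitR_twD_contr₂ (a : K.Cobar) (n : N) : (K.counitR N).rTensor K.Cobar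
    (twD (K.zeroDGAlg θ h h').comod K.selfDGAlg.mod (contr₂ θ a n)) =
      (n * θ a) ⊗ₜ 1 - n ⊗ₜ a := by
  induction a using cobar_left_induction generalizing n with
  | hone => rw [contr₂_one]; simp
  | hadd a b ha hb =>
    rw [map_add, LinearMap.add_apply, map_add, map_add, ha, hb, map_add, mul_add, add_tmul,
      tmul_add]
    abel
  | hsmul r a ha =>
    rw [map_smul, LinearMap.smul_apply, map_smul, map_smul, ha, smul_sub, map_smul, tmul_smul,
      mul_smul_comm, smul_tmul']
  | hmul k x a ha =>
    have e2 : TensorAlgebra.ι R (DirectSum.lof R ℕ (fun n => K.cx.X (n + 1)) k x) =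
      K.br (k + 1) x := rfl
    rw [← e2, contr₂_mul, map_add, map_add, ha, counitR_twD, tw_posIncl, totCounit_posIncl,
      map_mul, mul_assoc]
    have e3 : K.selfDGAlg.mod.κ (K.posIncl (DirectSum.lof R ℕ (fun n => K.cx.X (n + 1)) k x)) a =
        TensorAlgebra.ι R (DirectSum.lof R ℕ (fun n => K.cx.X (n + 1)) k x) * a := by
      rw [DGMod.κ_apply, tw_posIncl]; rfl
    rw [e3]
    simp

/-- The two-sided twisted tensor product `N ⊗ K ⊗ Ω K` is quasi-isomorphic to `N`. -/
lemma qi_free (W : Type*) [AddCommGroup W] [Module R W] :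
    QI (R := R) (X := ((N ⊗[R] K.Tot) ⊗[R] K.Cobar) ⊗[R] W) (Y := N ⊗[R] W)
      ((twD (K.zeroDGAlg θ h h').comod K.selfDGAlg.mod).rTensor W) 0
      ((LinearMap.mul' R N ∘ₗ TensorProduct.map (K.counitR N) θ.toLinearMap).rTensor W) := by
  -- As for `qi_universal`, the projection kills what lies over positive degrees of `K`. The sign of
  -- the homotopy is dictated by the right side of `counitR_twD_contr₂`.
  refine QI.of_twoStep_rTensor ((K.counitR N).rTensor K.Cobar)
    (- TensorProduct.lift (contr₂ θ).flip)
    ((TensorProduct.mk R _ _).flip 1 ∘ₗ (TensorProduct.mk R _ _).flip K.totOne)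
    (- TensorProduct.lift (contr₂ θ ∘ₗ K.diff).flip -
      ((TensorProduct.mk R N K.Tot).flip K.totOne).rTensor K.Cobar) (twD_twD _ _) ?_ ?_ ?_ ?_ W
  · intro n
    rw [LinearMap.comp_apply, LinearMap.flip_apply, LinearMap.flip_apply,
      TensorProduct.mk_apply, TensorProduct.mk_apply, twD_tmul, DGAlg.comod_D, DGAlg.tensD_tmul,
      δ_totOne, DGAlg.mod_d, selfDGAlg_d, diff_one, DGAlg.comod_ψ, DGAlg.coact_tmul,
      totComul_totOne, LinearMap.rTensor_tmul, TensorProduct.map_tmul, LinearMap.flip_apply,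
      DGMod.κ_apply, tw_totOne]
    simp
  · intro n
    simp [totCounit_totOne]
  · intro z
    induction z using TensorProduct.induction_on with
    | zero => simp
    | add x y hx hy =>
      simp only [map_add, map_sub] at hx hy ⊢
      rw [hx, hy]; abel
    | tmul y a =>
      rw [LinearMap.rTensor_tmul, LinearMap.neg_apply, TensorProduct.lift.tmul,
        LinearMap.flip_apply, map_neg, map_neg, counitR_twD_contr₂, map_sub,
        LinearMap.rTensor_tmul]
      simp [totCounit_totOne]
  · intro z
    induction z using TensorProduct.induction_on with
    | zero => simp
    | add x y hx hy => simp only [map_add, hx, hy]; abel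
    | tmul y a =>
      induction y using TensorProduct.induction_on with
      | zero => simp
      | add x y hx hy => simp only [map_add, add_tmul, hx, hy]; abel
      | tmul n x =>
        rw [counitR_twD, LinearMap.rTensor_tmul, counitR_tmul]
        induction x using tot_induction_pos with
        | hone r =>
          simp [totCounit_totOne, DGMod.κ_apply, tw_totOne, ← smul_tmul', smul_sub]
        | hpos y =>
          have e3 : K.selfDGAlg.mod.κ (K.posIncl y) a = TensorAlgebra.ι R y * a := by
            rw [DGMod.κ_apply, tw_posIncl]; rfl
          rw [totCounit_posIncl, tw_posIncl, e3]
          simp [contr₂_mul]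
        | hadd x y hx hy =>
          convert congrArg₂ (· + ·) hx hy using 1
          · simp only [map_add, add_smul, mul_add, add_tmul, tmul_add, LinearMap.add_apply,
              map_sub]
            abel
          · simp only [map_add, tmul_add, add_tmul, add_smul]; abel

end FreeModule

/-! ### Filtrations of twisted tensor products by the degree of a coalgebra factor. -/

section Filtration

set_option maxSynthPendingDepth 4

variable {R : Type u} [CommRing R] {K : ConnDGCoalg.{u, v} R}

/-- The degrees of the two factors of the coproduct add up to `n`. If `g` only sees positive
degrees, the other factor has degree less than `n`, where `p` vanishes. With a twisting cochain as
`g`, this says that twisting strictly lowers the degree of the coalgebra factor. -/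
lemma map_totComul_eq_zero {V W : Type*} [AddCommGroup V] [Module R V] [AddCommGroup W]
    [Module R W] (g : K.Tot →ₗ[R] V) (p : K.Tot →ₗ[R] W) (n : ℕ) (hg : ∀ x, g (K.tι 0 x) = 0)
    (hp : ∀ k < n, ∀ x, p (K.tι k x) = 0) (x : K.cx.X n) :
    TensorProduct.map g p (K.totComul (K.tι n x)) = 0 ∧
      TensorProduct.map p g (K.totComul (K.tι n x)) = 0 := by
  have h : ∀ i j, i + j = n → g ∘ₗ K.tι i = 0 ∨ p ∘ₗ K.tι j = 0 := by
    rintro (_ | i) j hij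
    · exact Or.inl (LinearMap.ext hg)
    · exact Or.inr (LinearMap.ext (hp j (by omega)))
  rw [totComul_tι, map_sum, map_sum]
  refine ⟨Finset.sum_eq_zero fun pq hpq => ?_, Finset.sum_eq_zero fun pq hpq => ?_⟩
  · rw [TensorProduct.map_map]
    rcases h pq.1 pq.2 (Finset.HasAntidiagonal.mem_antidiagonal.1 hpq) with e | e <;> simp [e]
  · rw [TensorProduct.map_map]
    rcases h pq.2 pq.1 ((add_comm _ _).trans (Finset.HasAntidiagonal.mem_antidiagonal.1 hpq))
      with e | e <;> simp [e]

lemma tw_tι_zero (x : K.cx.X 0) : K.tw (K.tι 0 x) = 0 := by rw [tw_tι, br_zero]; rfl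

section DGAlg

variable {N : Type*} [Ring N] [Algebra R N] (A : K.DGAlg N)

lemma lTensor_π_δ (n k : ℕ) (h : n ≤ k) (x : K.cx.X n) :
    (K.totDecomp.π k).lTensor N (A.δ (K.tι n x)) = 0 := by
  have h1 : K.totDecomp.π k (K.totD (K.tι n x)) = 0 := by
    cases n with
    | zero => rw [totD_tι_zero, map_zero]
    | succ n =>
      rw [totD_tι]
      exact K.totDecomp.π_ι_ne _ _ _ (by omega)
  have h2 := (map_totComul_eq_zero A.t (K.totDecomp.π k) n
    (fun x => by rw [DGAlg.t_apply, tw_tι_zero, map_zero])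
    (fun j hj x => K.totDecomp.π_ι_ne _ _ _ (by omega)) x).1
  rw [DGAlg.δ_apply, map_add, LinearMap.lTensor_tmul, h1, tmul_zero, zero_add]
  rw [← h2, LinearMap.lTensor, LinearMap.rTensor, TensorProduct.map_map]
  rfl

lemma lTensor_lmul {V W : Type*} [AddCommGroup V] [Module R V] [AddCommGroup W] [Module R W]
    (g : V →ₗ[R] W) (n : N) (z : N ⊗[R] V) :
    g.lTensor N (DGAlg.lmul R V n z) = DGAlg.lmul R W n (g.lTensor N z) := by
  induction z using TensorProduct.induction_on with
  | zero => simp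
  | add x y hx hy => simp only [map_add, hx, hy]
  | tmul m x => simp

/-- Both `∂` and the twisting term strictly lower the degree in `K`, so only the differential of `N`
remains on the diagonal. -/
lemma tensD_triangular :
    (K.totDecomp.lTensor N).Triangular A.tensD (fun n => A.d.rTensor (K.cx.X n)) := by
  have key : ∀ n k (_ : n ≤ k) (u : N ⊗[R] K.cx.X n),
      (K.totDecomp.π k).lTensor N (A.tensD ((K.tι n).lTensor N u)) =
        TensorProduct.map A.d (K.totDecomp.π k ∘ₗ K.tι n) u := by
    intro n k hk u
    induction u using TensorProduct.induction_on with
    | zero => simp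
    | add x y hx hy => simp only [map_add, hx, hy]
    | tmul m x =>
      rw [LinearMap.lTensor_tmul, DGAlg.tensD_tmul, map_add, lTensor_lmul, lTensor_π_δ A n k hk,
        map_zero, add_zero]
      rfl
  refine fun n u => ⟨(key n n le_rfl u).trans ?_, fun m hm => (key n m hm.le u).trans ?_⟩
  · rw [show K.totDecomp.π n ∘ₗ K.tι n = LinearMap.id from LinearMap.ext (K.totDecomp.π_ι n)]
    rfl
  · rw [show K.totDecomp.π m ∘ₗ K.tι n = 0 from
      LinearMap.ext fun x => K.totDecomp.π_ι_ne m n x (by omega), TensorProduct.map_zero_right]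
    rfl

end DGAlg

section Module

variable {Y B : Type*} [AddCommGroup Y] [Module R Y] [AddCommGroup B] [Module R B]

/-- A filtration of a dg module induces one of the twisted tensor product. -/
lemma twD_triangular (C : K.DGComod Y) (M : K.DGMod B) {U : ℕ → Type*}
    [∀ n, AddCommGroup (U n)] [∀ n, Module R (U n)] (Q : Decomp R B U) (M' : ∀ n, K.DGMod (U n))
    (hd : Q.Triangular M.d fun n => (M' n).d)
    (hρ : ∀ n a b, M.ρ a (Q.ι n b) = Q.ι n ((M' n).ρ a b)) :
    (Q.lTensor Y).Triangular (twD C M) fun n => twD C (M' n) := by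
  -- The action respects the pieces of `B`, so the twisting term is already diagonal. The second
  -- summand measures how far `M.d` is from being diagonal.
  have key : ∀ n k (u : Y ⊗[R] U n), (Q.π k).lTensor Y (twD C M ((Q.ι n).lTensor Y u)) =
      (Q.π k ∘ₗ Q.ι n).lTensor Y (twD C (M' n) u) +
        TensorProduct.map C.σ (Q.π k ∘ₗ M.d ∘ₗ Q.ι n - Q.π k ∘ₗ Q.ι n ∘ₗ (M' n).d) u := by
    intro n k u
    induction u using TensorProduct.induction_on with
    | zero => simp
    | add x y hx hy => simp only [map_add, hx, hy]; abel
    | tmul y b =>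
      have e : M.κ.flip (Q.ι n b) = Q.ι n ∘ₗ (M' n).κ.flip b := LinearMap.ext fun x => hρ _ _ _
      rw [LinearMap.lTensor_tmul, twD_tmul, twD_tmul, e, map_sub, map_sub]
      simp only [LinearMap.lTensor, TensorProduct.map_map, map_add, TensorProduct.map_tmul,
        LinearMap.id_comp, LinearMap.comp_assoc, LinearMap.sub_apply, tmul_sub, LinearMap.id_apply,
        LinearMap.comp_apply]
      abel
  refine fun n u => ⟨(key n n u).trans ?_, fun m hm => (key n m u).trans ?_⟩
  · rw [show Q.π n ∘ₗ Q.ι n = LinearMap.id from LinearMap.ext (Q.π_ι n),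
      show Q.π n ∘ₗ M.d ∘ₗ Q.ι n -
      Q.π n ∘ₗ Q.ι n ∘ₗ (M' n).d = 0 from LinearMap.ext fun b => by simp [(hd n b).1, Q.π_ι]]
    simp
  · rw [show Q.π m ∘ₗ Q.ι n = 0 from LinearMap.ext fun b => Q.π_ι_ne m n b (by omega),
      show Q.π m ∘ₗ M.d ∘ₗ Q.ι n - Q.π m ∘ₗ Q.ι n ∘ₗ (M' n).d = 0 from
      LinearMap.ext fun b => by simp [(hd n b).2 m hm, Q.π_ι_ne m n _ (by omega : m ≠ n)]]
    simp

variable {N : Type*} [Ring N] [Algebra R N]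
  (θ : K.Cobar →ₐ[R] N) (h : ∀ a, θ (K.diff a) = 0) (h' : ∀ a, θ (K.sgn a) = θ a)

/-- The algebra `N` has zero differential, so the differential of `N ⊗ K` strictly lowers the degree
in `K`. So does the coaction term, since `κ` vanishes in degree zero. What is left is the
differential of `M`, with the sign of the involution on `K`. -/
lemma twD_comod_triangular (M : K.DGMod B) :
    ((K.totDecomp.lTensor N).rTensor B).Triangular (twD (K.zeroDGAlg θ h h').comod M)
      fun n => (-1 : R) ^ n • M.d.lTensor (N ⊗[R] K.cx.X n) := by
  have key : ∀ n k (_ : n ≤ k) (u : (N ⊗[R] K.cx.X n) ⊗[R] B),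
      ((K.totDecomp.π k).lTensor N).rTensor B (twD (K.zeroDGAlg θ h h').comod M
        (((K.tι n).lTensor N).rTensor B u)) =
        (-1 : R) ^ n • TensorProduct.map ((K.totDecomp.π k ∘ₗ K.tι n).lTensor N) M.d u := by
    intro n k hk u
    induction u using TensorProduct.induction_on with
    | zero => simp
    | add x y hx hy => simp only [map_add, hx, hy, smul_add]
    | tmul y b =>
      induction y using TensorProduct.induction_on with
      | zero => simp
      | add x y hx hy => simp only [map_add, add_tmul, hx, hy, smul_add]
      | tmul m x =>
        have e1 : (K.totDecomp.π k).lTensor N ((K.zeroDGAlg θ h h').tensD (m ⊗ₜ K.tι n x)) = 0 := by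
          rw [DGAlg.tensD_tmul, map_add, lTensor_lmul, lTensor_π_δ _ n k hk]
          simp
        have e2 : ((K.totDecomp.π k).lTensor N).rTensor B (TensorProduct.map
            (TensorProduct.map (AlgHom.id R N).toLinearMap K.totSgn) (M.κ.flip b)
            (DGAlg.coact K N (m ⊗ₜ K.tι n x))) = 0 := by
          have e3 := (map_totComul_eq_zero (M.κ.flip b)
            (TensorProduct.mk R N _ m ∘ₗ K.totDecomp.π k ∘ₗ K.totSgn) n
            (fun x => by simp [DGMod.κ_apply, tw_tι_zero])
            (fun j hj x => by
              have : K.totDecomp.π k (K.tι j x) = 0 := K.totDecomp.π_ι_ne _ _ _ (by omega)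
              simp [totSgn_tι, this]) x).2
          rw [← e3, DGAlg.coact_tmul, LinearMap.rTensor, LinearMap.rTensor, TensorProduct.map_map,
            TensorProduct.map_map]
          rfl
        rw [LinearMap.rTensor_tmul, LinearMap.lTensor_tmul, twD_tmul, map_sub, map_add,
          DGAlg.comod_D, DGAlg.comod_σ, DGAlg.comod_ψ]
        have e4 : ((K.totDecomp.π k).lTensor N).rTensor B
            ((K.zeroDGAlg θ h h').tensD (m ⊗ₜ K.tι n x) ⊗ₜ b) = 0 := by
          rw [LinearMap.rTensor_tmul, e1, zero_tmul]
        refine (congrArg₂ _ (congrArg₂ _ e4 rfl) e2).trans ?_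
        simp [totSgn_tι, smul_tmul']
  refine fun n u => ⟨(key n n le_rfl u).trans ?_, fun m hm => (key n m hm.le u).trans ?_⟩
  · rw [show K.totDecomp.π n ∘ₗ K.tι n = LinearMap.id from LinearMap.ext (K.totDecomp.π_ι n),
      LinearMap.lTensor_id]
    rfl
  · rw [show K.totDecomp.π m ∘ₗ K.tι n = 0 from
      LinearMap.ext fun x => K.totDecomp.π_ι_ne m n x (by omega), LinearMap.lTensor_zero,
      TensorProduct.map_zero_left]
    simp

/-- This permits a change of module in a twisted tensor product: on the diagonal pieces `(N ⊗ K_n) ⊗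
B` all twisting has disappeared, and the map is `g` with coefficients. -/
lemma qi_lTensor_twD {B' : Type*} [AddCommGroup B'] [Module R B'] (M : K.DGMod B) (M' : K.DGMod B')
    (g : B →ₗ[R] B') (hd : ∀ b, g (M.d b) = M'.d (g b))
    (hρ : ∀ a b, g (M.ρ a b) = M'.ρ a (g b))
    (hg : ∀ n, QI (M.d.lTensor (N ⊗[R] K.cx.X n)) (M'.d.lTensor (N ⊗[R] K.cx.X n))
      (g.lTensor (N ⊗[R] K.cx.X n))) :
    QI (twD (K.zeroDGAlg θ h h').comod M) (twD (K.zeroDGAlg θ h h').comod M')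
      (g.lTensor (N ⊗[R] K.Tot)) := by
  refine QI.of_triangular (twD_comod_triangular θ h h' M) (twD_comod_triangular θ h h' M')
    (φ := fun n => g.lTensor (N ⊗[R] K.cx.X n))
    (twD_twD _ _) (twD_twD _ _) (lTensor_twD _ M M' g hd hρ) (fun n u => ?_)
    (fun n => (hg n).smul _ (neg_one_pow_mul_self' n))
  change g.lTensor _ (((K.tι n).lTensor N).rTensor B u) =
    ((K.tι n).lTensor N).rTensor B' (g.lTensor _ u)
  rw [← LinearMap.comp_apply, ← LinearMap.comp_apply, LinearMap.lTensor_comp_rTensor,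
    LinearMap.rTensor_comp_lTensor]

end Module

end Filtration

/-! ### Comparison of `N ⊗ K` with `N ⊗ K'` through `N ⊗ K ⊗ ΩK' ⊗ K'`. -/

section Comparison

set_option maxSynthPendingDepth 4

variable {R : Type u} [CommRing R] {K K' : ConnDGCoalg.{u, v} R}

/-- The tensor product of a dg module with a module. -/
@[simps]
def DGMod.rTensor {B : Type*} [AddCommGroup B] [Module R B] (M : K.DGMod B) (W : Type*)
    [AddCommGroup W] [Module R W] : K.DGMod (B ⊗[R] W) where
  d := M.d.rTensor W
  ρ := (Module.End.rTensorAlgHom R B W).comp M.ρ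
  d_d b := by
    induction b using TensorProduct.induction_on with
    | zero => simp
    | add x y hx hy => simp only [map_add, hx, hy, add_zero]
    | tmul b w => simp [M.d_d]
  d_ρ a b := by
    induction b using TensorProduct.induction_on with
    | zero => simp
    | add x y hx hy => simp only [map_add, hx, hy]; abel
    | tmul b w =>
      change M.d (M.ρ a b) ⊗ₜ[R] w = M.ρ _ b ⊗ₜ[R] w + M.ρ _ (M.d b) ⊗ₜ[R] w
      rw [M.d_ρ, add_tmul]

variable (f : Hom K K')

/-- Restriction of the structure map of a dg algebra. -/
@[simps]
def DGAlg.comap {N : Type*} [Ring N] [Algebra R N] (A : K'.DGAlg N) : K.DGAlg N where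
  θ := A.θ.comp f.cobarAlgHom
  d := A.d
  σ := A.σ
  d_mul := A.d_mul
  d_d := A.d_d
  σ_σ := A.σ_σ
  d_σ := A.d_σ
  θ_diff a := by rw [AlgHom.comp_apply, f.cobarAlgHom_diff, A.θ_diff]; rfl
  θ_sgn a := by rw [AlgHom.comp_apply, f.cobarAlgHom_sgn, A.θ_sgn]; rfl

/-- The twisted tensor product as a left dg module. -/
@[simps]
def DGAlg.tensMod {N : Type*} [Ring N] [Algebra R N] (A : K'.DGAlg N) :
    K.DGMod (N ⊗[R] K'.Tot) where
  d := A.tensD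
  ρ := (DGAlg.lmul R K'.Tot).comp (A.comap f).θ
  d_d := A.tensD_tensD
  d_ρ a z := by
    have h1 := (A.comap f).θ_diff a
    have h2 := (A.comap f).θ_sgn a
    rw [AlgHom.comp_apply, AlgHom.comp_apply, AlgHom.comp_apply, A.tensD_lmul, h1, h2]
    rfl

variable {N : Type*} [Ring N] [Algebra R N] (θ : K'.Cobar →ₐ[R] N)
  (h : ∀ a, θ (K'.diff a) = 0) (h' : ∀ a, θ (K'.sgn a) = θ a)

/-- The map `n ⊗ (a ⊗ w) ↦ n θ(a) ⊗ w`. -/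
def mulMap {A : Type*} [Ring A] [Algebra R A] (q : A →ₐ[R] N) (W : Type*) [AddCommGroup W]
    [Module R W] : N ⊗[R] (A ⊗[R] W) →ₗ[R] N ⊗[R] W :=
  (LinearMap.mul' R N ∘ₗ q.toLinearMap.lTensor N).rTensor W ∘ₗ
    (TensorProduct.assoc R N A W).symm.toLinearMap

@[simp]
lemma mulMap_tmul {A : Type*} [Ring A] [Algebra R A] (q : A →ₐ[R] N) {W : Type*} [AddCommGroup W]
    [Module R W] (n : N) (a : A) (w : W) : mulMap q W (n ⊗ₜ (a ⊗ₜ w)) = (n * q a) ⊗ₜ w := rfl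

/-- The map `(n ⊗ x) ⊗ (a ⊗ w) ↦ ε(x) n θ(a) ⊗ w`. -/
def actMap (K : ConnDGCoalg.{u, v} R) {A : Type*} [Ring A] [Algebra R A] (q : A →ₐ[R] N)
    (W : Type*) [AddCommGroup W] [Module R W] :
    (N ⊗[R] K.Tot) ⊗[R] (A ⊗[R] W) →ₗ[R] N ⊗[R] W :=
  mulMap q W ∘ₗ (K.counitR N).rTensor (A ⊗[R] W)

lemma actMap_tmul {A : Type*} [Ring A] [Algebra R A] (q : A →ₐ[R] N)
    {W : Type*} [AddCommGroup W] [Module R W] (y : N ⊗[R] K.Tot) (a : A) (w : W) :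
    actMap K q W (y ⊗ₜ (a ⊗ₜ w)) = (K.counitR N y * q a) ⊗ₜ w := rfl

lemma mulMap_lmul {A : Type*} [Ring A] [Algebra R A] (q : A →ₐ[R] N) {W : Type*} [AddCommGroup W]
    [Module R W] (n : N) (a : A) (z : A ⊗[R] W) :
    mulMap q W (n ⊗ₜ DGAlg.lmul R W a z) = mulMap q W ((n * q a) ⊗ₜ z) := by
  induction z using TensorProduct.induction_on with
  | zero => simp
  | add x y hx hy => simp only [map_add, tmul_add, hx, hy]
  | tmul b w => simp [mul_assoc]

lemma comp_diff_eq_zero (h : ∀ a, θ (K'.diff a) = 0) (a : K.Cobar) :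
    (θ.comp f.cobarAlgHom) (K.diff a) = 0 := by
  rw [AlgHom.comp_apply, f.cobarAlgHom_diff, h]

lemma comp_sgn_eq (h' : ∀ a, θ (K'.sgn a) = θ a) (a : K.Cobar) :
    (θ.comp f.cobarAlgHom) (K.sgn a) = (θ.comp f.cobarAlgHom) a := by
  rw [AlgHom.comp_apply, f.cobarAlgHom_sgn, h']; rfl

/-- The comodule `N ⊗ K`, for an algebra `N` over the cobar construction of `K'`. -/
abbrev pullComod : K.DGComod (N ⊗[R] K.Tot) :=
  (K.zeroDGAlg (θ.comp f.cobarAlgHom) (comp_diff_eq_zero f θ h) (comp_sgn_eq f θ h')).comod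

/-- The two twisting terms of `counitR_twD` become equal once `ΩK'` is multiplied into `N`, so they
cancel. What remains is the differential of `M`, which induces `E` on `N ⊗ W`. -/
lemma actMap_twD {W : Type*} [AddCommGroup W] [Module R W] (M : K.DGMod (K'.Cobar ⊗[R] W))
    (hρ : ∀ a b, M.ρ a b = DGAlg.lmul R W (f.cobarAlgHom a) b) (E : N ⊗[R] W →ₗ[R] N ⊗[R] W)
    (hE : ∀ n b, mulMap θ W (n ⊗ₜ M.d b) = E (mulMap θ W (n ⊗ₜ b)))
    (z : (N ⊗[R] K.Tot) ⊗[R] (K'.Cobar ⊗[R] W)) :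
    actMap K θ W (twD (pullComod f θ h h') M z) = E (actMap K θ W z) := by
  induction z using TensorProduct.induction_on with
  | zero => simp
  | add x y hx hy => simp only [map_add, hx, hy]
  | tmul y b =>
    induction y using TensorProduct.induction_on with
    | zero => simp
    | add x y hx hy => simp only [map_add, add_tmul, hx, hy]
    | tmul n x =>
      rw [actMap, LinearMap.comp_apply, counitR_twD, map_sub, map_add, DGMod.κ_apply, hρ,
        mulMap_lmul, hE, LinearMap.comp_apply, LinearMap.rTensor_tmul, counitR_tmul]
      simp

lemma mulMap_diff (h : ∀ a, θ (K'.diff a) = 0) {W : Type*} [AddCommGroup W] [Module R W]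
    (n : N) (b : K'.Cobar ⊗[R] W) : mulMap θ W (n ⊗ₜ K'.diff.rTensor W b) = 0 := by
  induction b using TensorProduct.induction_on with
  | zero => simp
  | add x y hx hy => simp only [map_add, tmul_add, hx, hy, add_zero]
  | tmul b w => simp [h]

/-- The structure map `θ` carries the universal twisting cochain to that of `N` and kills the cobar
differential, so it carries one twisted differential to the other. -/
lemma mulMap_tensD (n : N) (b : K'.Cobar ⊗[R] K'.Tot) :
    mulMap θ K'.Tot (n ⊗ₜ K'.selfDGAlg.tensD b) =
      (K'.zeroDGAlg θ h h').tensD (mulMap θ K'.Tot (n ⊗ₜ b)) := by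
  induction b using TensorProduct.induction_on with
  | zero => simp
  | add x y hx hy => simp only [map_add, tmul_add, hx, hy]
  | tmul a x =>
    have e : ∀ n : N, mulMap θ K'.Tot (n ⊗ₜ K'.selfDGAlg.δ x) =
        DGAlg.lmul R K'.Tot n ((K'.zeroDGAlg θ h h').δ x) := by
      intro n
      rw [DGAlg.δ_apply, DGAlg.δ_apply, tmul_add, map_add, map_add, mulMap_tmul, map_one,
        DGAlg.lmul_tmul]
      congr 1
      generalize K'.totComul x = w
      induction w using TensorProduct.induction_on with
      | zero => simp
      | add x y hx hy => simp only [map_add, tmul_add, hx, hy]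
      | tmul b w => simp [DGAlg.t_apply]
    rw [DGAlg.tensD_tmul, tmul_add, map_add, mulMap_lmul, e, mulMap_tmul, mulMap_tmul,
      DGAlg.tensD_tmul]
    simp [h, h']

lemma assoc_twD {Y B W : Type*} [AddCommGroup Y] [Module R Y] [AddCommGroup B] [Module R B]
    [AddCommGroup W] [Module R W] (C : K.DGComod Y) (M : K.DGMod B) (z : (Y ⊗[R] B) ⊗[R] W) :
    TensorProduct.assoc R Y B W ((twD C M).rTensor W z) =
      twD C (M.rTensor W) (TensorProduct.assoc R Y B W z) := by
  induction z using TensorProduct.induction_on with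
  | zero => simp
  | add x y hx hy => simp only [map_add, hx, hy]
  | tmul z w =>
    induction z using TensorProduct.induction_on with
    | zero => simp
    | add x y hx hy => simp only [map_add, add_tmul, hx, hy]
    | tmul y b =>
      rw [LinearMap.rTensor_tmul, TensorProduct.assoc_tmul, twD_tmul, twD_tmul, sub_tmul, map_sub,
        add_tmul, map_add, TensorProduct.assoc_tmul, TensorProduct.assoc_tmul]
      refine congrArg₂ _ rfl ?_
      generalize C.ψ y = v
      induction v using TensorProduct.induction_on with
      | zero => simp
      | add x y hx hy => simp only [map_add, add_tmul, hx, hy]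
      | tmul y x =>
        simp only [TensorProduct.map_tmul, TensorProduct.assoc_tmul, LinearMap.flip_apply]
        rfl

lemma qi_actMap_self (θ : K.Cobar →ₐ[R] N) (h : ∀ a, θ (K.diff a) = 0)
    (h' : ∀ a, θ (K.sgn a) = θ a) (W : Type*) [AddCommGroup W] [Module R W] :
    QI (twD (K.zeroDGAlg θ h h').comod (K.selfDGAlg.mod.rTensor W)) 0 (actMap K θ W) := by
  refine (qi_free θ h h' W).congr (TensorProduct.assoc R _ _ _) (LinearEquiv.refl R _)
    (assoc_twD _ _) (fun _ => rfl) (fun z => ?_)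
  induction z using TensorProduct.induction_on with
  | zero => simp
  | add x y hx hy => simp only [map_add, hx, hy]
  | tmul z w =>
    induction z using TensorProduct.induction_on with
    | zero => simp
    | add x y hx hy => simp only [map_add, add_tmul, hx, hy]
    | tmul y a => rfl

lemma lTensor_rTensor_assoc {X Y W V : Type*} [AddCommGroup X] [Module R X] [AddCommGroup Y]
    [Module R Y] [AddCommGroup W] [Module R W] [AddCommGroup V] [Module R V] (g : X →ₗ[R] Y)
    (z : X ⊗[R] (W ⊗[R] V)) : (TensorProduct.assoc R Y W V).symm (g.rTensor (W ⊗[R] V) z) =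
      (g.rTensor W).rTensor V ((TensorProduct.assoc R X W V).symm z) := by
  induction z using TensorProduct.induction_on with
  | zero => simp
  | add x y hx hy => simp only [map_add, hx, hy]
  | tmul x z =>
    induction z using TensorProduct.induction_on with
    | zero => simp
    | add x y hx hy => simp only [map_add, tmul_add, hx, hy]
    | tmul w v => simp

lemma qi_rTensor_lTensor {X Y W V : Type*} [AddCommGroup X] [Module R X] [AddCommGroup Y]
    [Module R Y] [AddCommGroup W] [Module R W] [AddCommGroup V] [Module R V] {D : X →ₗ[R] X}
    {E : Y →ₗ[R] Y} {g : X →ₗ[R] Y}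
    (h : QI (D.rTensor (W ⊗[R] V)) (E.rTensor (W ⊗[R] V)) (g.rTensor (W ⊗[R] V))) :
    QI ((D.rTensor W).lTensor V) ((E.rTensor W).lTensor V) ((g.rTensor W).lTensor V) :=
  QI.lTensor_iff_rTensor.2 (h.congr (TensorProduct.assoc R _ _ _).symm
    (TensorProduct.assoc R _ _ _).symm (lTensor_rTensor_assoc _) (lTensor_rTensor_assoc _)
    (lTensor_rTensor_assoc _))

section Universe

variable {Q : Type (max u v)} [Ring Q] [Algebra R Q] (θ : K'.Cobar →ₐ[R] Q)
  (h : ∀ a, θ (K'.diff a) = 0) (h' : ∀ a, θ (K'.sgn a) = θ a)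

/-- For `ΩK` in place of `ΩK'` this is `qi_actMap_self`. The map `ΩK → ΩK'` is a quasi-isomorphism
with all coefficients, so it may be inserted under the twisted tensor product, and two-out-of-three
finishes. -/
lemma qi_actMap_comap (hf : f.IsOmegaQuasiIso) (hK : ∀ n, Module.Flat R (K.cx.X n))
    (hK' : ∀ n, Module.Flat R (K'.cx.X n)) (W : Type v) [AddCommGroup W] [Module R W] :
    QI (twD (pullComod f θ h h') ((K'.selfDGAlg.comap f).mod.rTensor W)) 0 (actMap K θ W) := by
  have hd : ∀ b, f.cobarAlgHom.toLinearMap.rTensor W ((K.selfDGAlg.mod.rTensor W).d b) =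
      ((K'.selfDGAlg.comap f).mod.rTensor W).d (f.cobarAlgHom.toLinearMap.rTensor W b) := by
    intro b
    induction b using TensorProduct.induction_on with
    | zero => simp
    | add x y hx hy => simp only [map_add, hx, hy]
    | tmul b w => simp [f.cobarAlgHom_diff]
  have hρ : ∀ a b, f.cobarAlgHom.toLinearMap.rTensor W ((K.selfDGAlg.mod.rTensor W).ρ a b) =
      ((K'.selfDGAlg.comap f).mod.rTensor W).ρ a (f.cobarAlgHom.toLinearMap.rTensor W b) := by
    intro a b
    induction b using TensorProduct.induction_on with
    | zero => simp only [map_zero]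
    | add x y hx hy => simp only [map_add, hx, hy]
    | tmul b w =>
      change f.cobarAlgHom (a * b) ⊗ₜ[R] w = (f.cobarAlgHom a * f.cobarAlgHom b) ⊗ₜ[R] w
      rw [map_mul]
  have h1 := qi_actMap_self (K := K) (θ.comp f.cobarAlgHom) (comp_diff_eq_zero f θ h)
    (comp_sgn_eq f θ h') W
  have e : actMap K (θ.comp f.cobarAlgHom) W =
      actMap K θ W ∘ₗ (f.cobarAlgHom.toLinearMap.rTensor W).lTensor (Q ⊗[R] K.Tot) := by
    refine TensorProduct.ext' fun y b => ?_
    induction b using TensorProduct.induction_on with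
    | zero => simp
    | add x y hx hy => simp only [map_add, tmul_add, hx, hy]
    | tmul b w => rfl
  rw [e] at h1
  refine h1.of_comp_left (qi_lTensor_twD _ _ _ _ _ _ hd hρ fun n => ?_)
    (lTensor_twD _ _ _ _ hd hρ) (fun z => ?_)
  · exact qi_rTensor_lTensor (f.qi_cobar_rTensor hf hK hK' (W ⊗[R] (Q ⊗[R] K.cx.X n)))
  · refine actMap_twD f θ h h' _ (fun a b => rfl) 0 (fun n b => ?_) z
    exact mulMap_diff θ h n b

/-- Filter both sides by the degree of `K'`. On the diagonal `K'_n` becomes an inert coefficient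
module, `N ⊗ K'_n` has zero differential, and `qi_actMap_comap` applies. -/
lemma qi_actMap_tens (hf : f.IsOmegaQuasiIso) (hK : ∀ n, Module.Flat R (K.cx.X n))
    (hK' : ∀ n, Module.Flat R (K'.cx.X n)) :
    QI (twD (pullComod f θ h h') (K'.selfDGAlg.tensMod f)) (K'.zeroDGAlg θ h h').tensD
      (actMap K θ K'.Tot) := by
  refine QI.of_triangular (twD_triangular _ _ (K'.totDecomp.lTensor K'.Cobar)
    (fun n => (K'.selfDGAlg.comap f).mod.rTensor (K'.cx.X n)) (tensD_triangular K'.selfDGAlg)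
    (fun n a b => ?_)) (tensD_triangular (K'.zeroDGAlg θ h h'))
    (φ := fun n => actMap K θ (K'.cx.X n)) (twD_twD _ _)
    (DGAlg.tensD_tensD _) (fun z => ?_) (fun n u => ?_) (fun n => ?_)
  · exact (lTensor_lmul (K'.tι n) _ b).symm
  · exact actMap_twD f θ h h' (K'.selfDGAlg.tensMod f) (fun a b => rfl)
      (K'.zeroDGAlg θ h h').tensD (mulMap_tensD θ h h') z
  · induction u using TensorProduct.induction_on with
    | zero => simp
    | add x y hx hy => simp only [map_add, hx, hy]
    | tmul y b =>
      induction b using TensorProduct.induction_on with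
      | zero => simp
      | add x y hx hy => simp only [map_add, tmul_add, hx, hy]
      | tmul a w => rfl
  · rw [zeroDGAlg_d, LinearMap.rTensor_zero]
    exact qi_actMap_comap f θ h h' hf hK hK' _

/-- The ground ring as a dg module. -/
abbrev groundMod (K : ConnDGCoalg.{u, v} R) : K.DGMod R :=
  (K.zeroDGAlg K.aug aug_diff aug_sgn).mod

lemma aug_cobarAlgHom (a : K.Cobar) : K'.aug (f.cobarAlgHom a) = K.aug a :=
  DFunLike.congr_fun (cobar_algHom_ext K (K'.aug.comp f.cobarAlgHom) K.aug fun n x => by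
    rw [AlgHom.comp_apply, f.cobarAlgHom_br, aug_br, aug_br]) a

/-- The augmentation of the universal twisted tensor product. -/
def augTens (K : ConnDGCoalg.{u, v} R) : K.Cobar ⊗[R] K.Tot →ₗ[R] R :=
  K.aug.toLinearMap ∘ₗ K.counitR K.Cobar

lemma augTens_tensD (z : K.Cobar ⊗[R] K.Tot) : augTens K (K.selfDGAlg.tensD z) = 0 := by
  induction z using TensorProduct.induction_on with
  | zero => simp
  | add x y hx hy => simp only [map_add, hx, hy, add_zero]
  | tmul a x =>
    have e : K.aug (K.tw x) = 0 := by
      induction x using tot_induction with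
      | hι n x => rw [tw_tι, aug_br]
      | hadd x y hx hy => rw [map_add, map_add, hx, hy, add_zero]
    rw [augTens, LinearMap.comp_apply, counitR_tensD, map_add, map_smul]
    change _ • K.aug (K.diff a) + K.aug (K.sgn a * K.tw x) = 0
    rw [aug_diff, map_mul, e]
    simp

lemma augTens_ρ (a : K.Cobar) (z : K'.Cobar ⊗[R] K'.Tot) :
    augTens K' ((K'.selfDGAlg.tensMod f).ρ a z) = (groundMod K).ρ a (augTens K' z) := by
  change K'.aug (K'.counitR _ (DGAlg.lmul R K'.Tot (f.cobarAlgHom a) z)) =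
    K.aug a * K'.aug (K'.counitR _ z)
  rw [counitR_lmul, map_mul, aug_cobarAlgHom]

/-- The universal twisted tensor product `ΩK' ⊗ K'` contracts onto `R` even with coefficients, so as
a module over `ΩK` it may be replaced by the ground ring. -/
lemma qi_augTens : QI (twD (pullComod f θ h h') (K'.selfDGAlg.tensMod f))
    (twD (pullComod f θ h h') (groundMod K)) ((augTens K').lTensor (Q ⊗[R] K.Tot)) := by
  refine qi_lTensor_twD _ _ _ _ _ _ augTens_tensD (augTens_ρ f) fun n => ?_
  rw [QI.lTensor_iff_rTensor]
  have h1 := qi_universal (K := K') (Q ⊗[R] K.cx.X n)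
  have e : (groundMod K).d.rTensor (Q ⊗[R] K.cx.X n) = 0 := LinearMap.rTensor_zero _
  rw [e]
  exact h1

/-- The map `n ⊗ x ↦ ∑ (n ⊗ x') ⊗ (1 ⊗ f x'')`. -/
def diagMap (Q : Type*) [AddCommGroup Q] [Module R Q] :
    Q ⊗[R] K.Tot →ₗ[R] (Q ⊗[R] K.Tot) ⊗[R] (K'.Cobar ⊗[R] K'.Tot) :=
  (TensorProduct.mk R K'.Cobar K'.Tot 1 ∘ₗ f.totMap).lTensor (Q ⊗[R] K.Tot) ∘ₗ DGAlg.coact K Q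

/-- The differential of `1 ⊗ f x''` creates a new letter from the coproduct of `x''`, while the
coaction term creates the same letter from the factor on its left. By coassociativity they cancel.
-/
lemma diagMap_D (C : K.DGComod (Q ⊗[R] K.Tot)) (hC : C.ψ = DGAlg.coact K Q) (y : Q ⊗[R] K.Tot) :
    diagMap f Q (C.D y) = twD C (K'.selfDGAlg.tensMod f) (diagMap f Q y) := by
  have key : ∀ w : (Q ⊗[R] K.Tot) ⊗[R] K.Tot, twD C (K'.selfDGAlg.tensMod f)
      ((TensorProduct.mk R K'.Cobar K'.Tot 1 ∘ₗ f.totMap).lTensor (Q ⊗[R] K.Tot) w) =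
      (TensorProduct.mk R K'.Cobar K'.Tot 1 ∘ₗ f.totMap).lTensor (Q ⊗[R] K.Tot)
        (C.D.rTensor K.Tot w + TensorProduct.map C.σ K.totD w) +
      TensorProduct.map C.σ (TensorProduct.map (K'.tw ∘ₗ f.totMap) f.totMap)
        (K.totComul.lTensor _ w) -
      TensorProduct.map C.σ (TensorProduct.map (K'.tw ∘ₗ f.totMap) f.totMap)
        (TensorProduct.assoc R _ _ _ (C.ψ.rTensor K.Tot w)) := by
    intro w
    induction w using TensorProduct.induction_on with
    | zero => simp
    | add x y hx hy => simp only [map_add, hx, hy]; abel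
    | tmul y x =>
      have e1 : K'.selfDGAlg.δ (f.totMap x) = 1 ⊗ₜ f.totMap (K.totD x) +
          TensorProduct.map (K'.tw ∘ₗ f.totMap) f.totMap (K.totComul x) := by
        rw [DGAlg.δ_apply, ← f.totMap_totD, f.totMap_totComul, LinearMap.rTensor,
          TensorProduct.map_map]
        rfl
      have e2 : ∀ v : (Q ⊗[R] K.Tot) ⊗[R] K.Tot, TensorProduct.map C.σ
          ((K'.selfDGAlg.tensMod f).κ.flip (1 ⊗ₜ f.totMap x)) v =
          TensorProduct.map C.σ (TensorProduct.map (K'.tw ∘ₗ f.totMap) f.totMap)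
            (TensorProduct.assoc R _ _ _ (v ⊗ₜ x)) := by
        intro v
        induction v using TensorProduct.induction_on with
        | zero => simp
        | add x y hx hy => simp only [map_add, add_tmul, hx, hy]
        | tmul y z =>
          have e3 : (K'.selfDGAlg.tensMod f).κ z (1 ⊗ₜ f.totMap x) =
              K'.tw (f.totMap z) ⊗ₜ f.totMap x := by
            rw [DGMod.κ_apply, ← f.cobarAlgHom_tw]
            change (f.cobarAlgHom (K.tw z) * 1) ⊗ₜ[R] f.totMap x = _
            rw [mul_one]
          simp [e3]
      rw [LinearMap.lTensor_tmul, LinearMap.comp_apply, TensorProduct.mk_apply, twD_tmul,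
        DGAlg.tensMod_d, DGAlg.tensD_one_tmul, e1, e2]
      simp [tmul_add]
      abel
  have hco := C.coassoc y
  rw [hC] at hco
  have hψ := C.ψ_D y
  rw [hC] at hψ
  rw [diagMap, LinearMap.comp_apply, LinearMap.comp_apply, key, hC, hco, hψ]
  abel

/-- The comparison of twisted tensor products. -/
lemma qi_totMap (hf : f.IsOmegaQuasiIso) (hK : ∀ n, Module.Flat R (K.cx.X n))
    (hK' : ∀ n, Module.Flat R (K'.cx.X n)) :
    QI (pullComod f θ h h').D (K'.zeroDGAlg θ h h').tensD (f.totMap.lTensor Q) := by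
  -- The augmentation and the counit of `K'` discard the factor `x''`, and the right counit axiom
  -- restores `x`.
  have hα : (augTens K').lTensor (Q ⊗[R] K.Tot) ∘ₗ diagMap f Q =
      (TensorProduct.rid R (Q ⊗[R] K.Tot)).symm.toLinearMap := by
    refine TensorProduct.ext' fun n x => ?_
    rw [LinearMap.comp_apply, diagMap, LinearMap.comp_apply, DGAlg.coact_tmul]
    conv_rhs => rw [← K.totComul_counit_right x]
    generalize K.totComul x = w
    induction w using TensorProduct.induction_on with
    | zero => simp
    | add x y hx hy => simp only [map_add, tmul_add, hx, hy]
    | tmul x y =>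
      simp [augTens, f.totMap_totCounit]
      conv_lhs => rw [← mul_one (K.totCounit y), ← smul_eq_mul, tmul_smul]
  -- Here the counit discards `x'` instead, and the left counit axiom leaves `n ⊗ f x`.
  have hβ : f.totMap.lTensor Q = actMap K θ K'.Tot ∘ₗ diagMap f Q := by
    refine TensorProduct.ext' fun n x => ?_
    rw [LinearMap.comp_apply, diagMap, LinearMap.comp_apply, DGAlg.coact_tmul]
    conv_lhs => rw [← K.totComul_counit_left x]
    generalize K.totComul x = w
    induction w using TensorProduct.induction_on with
    | zero => simp
    | add x y hx hy => simp only [map_add, tmul_add, hx, hy]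
    | tmul x y => simp [actMap_tmul, tmul_smul, smul_tmul']
  have hs := diagMap_D f (pullComod f θ h h') rfl
  have hα' := lTensor_twD (pullComod f θ h h') (K'.selfDGAlg.tensMod f) (groundMod K) (augTens K')
    augTens_tensD (augTens_ρ f)
  -- The composite is an isomorphism of complexes and its second factor is a quasi-isomorphism, so
  -- `diagMap` is one as well.
  have h1 : QI (pullComod f θ h h').D (twD (pullComod f θ h h') (groundMod K))
      ((augTens K').lTensor (Q ⊗[R] K.Tot) ∘ₗ diagMap f Q) := by
    refine QI.of_bijective ?_ fun y => ?_
    · rw [hα]; exact (TensorProduct.rid R (Q ⊗[R] K.Tot)).symm.bijective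
    · rw [LinearMap.comp_apply, LinearMap.comp_apply, hs, hα']
  have h2 : QI _ _ (diagMap f Q) := h1.of_comp_right (qi_augTens f θ h h') hs hα'
  rw [hβ]
  exact h2.comp (qi_actMap_tens f θ h h' hf hK hK') hs
    (actMap_twD f θ h h' _ (fun a b => rfl) _ (mulMap_tensD θ h h'))

end Universe

end Comparison

/-! ### The degree zero homology algebra and its twisted tensor product. -/

section Fundamental

variable {R : Type u} [CommRing R] {K K' : ConnDGCoalg.{u, v} R}

lemma liftAux_sgn {B : Type*} [Ring B] [Algebra R B] (g : K.cx.X 1 →ₗ[R] B) (a : K.Cobar) :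
    liftAux g (K.sgn a) = liftAux g a :=
  DFunLike.congr_fun (cobar_algHom_ext K ((liftAux g).comp K.sgn) (liftAux g) fun n x => by
    rw [AlgHom.comp_apply, sgn_br, map_smul]
    cases n with
    | zero => simp
    | succ n => rw [liftAux_ne g _ (by omega), smul_zero]) a

lemma liftAux_cls_diff (a : K.Cobar) : liftAux K.cls (K.diff a) = 0 :=
  liftAux_diff K.cls K.cls_rel a

/-- The map which kills generators of positive degree is the truncation `ΩK → H_0`: on degree zero
elements it is the quotient map. -/
lemma liftAux_cls (a : K.cobarZero) :
    liftAux K.cls (a : K.Cobar) = Ideal.Quotient.mk K.boundaries a := by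
  have h : HZero.lift K.cls K.cls_rel = AlgHom.id R K.HZero :=
    HZero.algHom_ext fun x => HZero.lift_cls _ _ x
  exact DFunLike.congr_fun h (Ideal.Quotient.mk K.boundaries a)

lemma comp_liftAux {B B' : Type*} [Ring B] [Algebra R B] [Ring B'] [Algebra R B'] (f : Hom K K')
    (g : K.cx.X 1 →ₗ[R] B) (g' : K'.cx.X 1 →ₗ[R] B') (q : B →ₐ[R] B')
    (h : ∀ x, q (g x) = g' ((f.f.f 1).hom x)) (a : K.Cobar) :
    q (liftAux g a) = liftAux g' (f.cobarAlgHom a) :=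
  DFunLike.congr_fun (cobar_algHom_ext K (q.comp (liftAux g)) ((liftAux g').comp f.cobarAlgHom)
    fun n x => by
      rw [AlgHom.comp_apply, AlgHom.comp_apply, f.cobarAlgHom_br]
      cases n with
      | zero => exact (congrArg q (liftAux_one g x)).trans ((h x).trans (liftAux_one g' _).symm)
      | succ n => rw [liftAux_ne g _ (by omega), liftAux_ne g' _ (by omega), map_zero]) a

/-- The quotient of `Ω_0` by the ideal of boundaries is the degree zero homology of the cobar
complex, and `q` is the map induced there by `Ωf`. -/
lemma bijective_hZero (f : Hom K K') (hf : f.IsOmegaQuasiIso) (q : K.HZero →ₐ[R] K'.HZero)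
    (h : ∀ x, q (K.cls x) = K'.cls ((f.f.f 1).hom x)) : Function.Bijective q := by
  have hq : ∀ a : K.cobarZero, q (Ideal.Quotient.mk K.boundaries a) =
      Ideal.Quotient.mk K'.boundaries ⟨f.cobarAlgHom a, f.cobarAlgHom_mem a.2⟩ := fun a => by
    rw [← liftAux_cls, comp_liftAux f K.cls K'.cls q h]
    exact liftAux_cls (K := K') ⟨f.cobarAlgHom a, f.cobarAlgHom_mem a.2⟩
  obtain ⟨h0, h1⟩ := (chainComplex_quasiIso_iff _).1 hf
  constructor
  · rw [injective_iff_map_eq_zero]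
    intro a ha
    obtain ⟨a, rfl⟩ := Ideal.Quotient.mk_surjective a
    rw [hq, Ideal.Quotient.eq_zero_iff_mem] at ha
    obtain ⟨b, hb, e⟩ := ha
    have hd : (K.cobar.d 0 (0 - 1)).hom a = 0 := by rw [K.cobar.shape _ _ (by simp)]; rfl
    obtain ⟨x', y', hx, -⟩ := h1 0 a ⟨b, hb⟩ hd (Subtype.ext (by
      rw [cobar_d]; exact e.symm))
    rw [Ideal.Quotient.eq_zero_iff_mem]
    refine ⟨x'.1, x'.2, ?_⟩
    rw [hx, cobar_d]
    rfl
  · intro b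
    obtain ⟨b, rfl⟩ := Ideal.Quotient.mk_surjective b
    obtain ⟨x, y, e⟩ := h0 b
    refine ⟨Ideal.Quotient.mk K.boundaries x, ?_⟩
    refine (hq x).trans (Ideal.Quotient.eq.2 ⟨-y.1, neg_mem y.2, ?_⟩)
    rw [e, cobar_d]
    change K'.diff (-y.1) = f.cobarAlgHom x.1 - (f.cobarAlgHom x.1 + K'.diff y.1)
    rw [map_neg]; abel

section Graded

variable {B : Type*} [Ring B] [Algebra R B] (g : K.cx.X 1 →ₗ[R] B)
  (h : ∀ a, liftAux g (K.diff a) = 0) (h' : ∀ a, liftAux g (K.sgn a) = liftAux g a)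

/-- The components of the twisted differential of `B ⊗ K`. -/
def degTensD (n : ℕ) : B ⊗[R] K.cx.X (n + 1) →ₗ[R] B ⊗[R] K.cx.X n :=
  (K.cx.d (n + 1) n).hom.lTensor B +
    (LinearMap.mul' R B ∘ₗ g.lTensor B).rTensor (K.cx.X n) ∘ₗ
      (TensorProduct.assoc R B (K.cx.X 1) (K.cx.X n)).symm.toLinearMap ∘ₗ
      (K.comul 1 n (n + 1)).lTensor B

lemma degTensD_tmul (n : ℕ) (b : B) (x : K.cx.X (n + 1)) :
    degTensD g n (b ⊗ₜ x) = b ⊗ₜ (K.cx.d (n + 1) n).hom x +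
      (LinearMap.mulLeft R b ∘ₗ g).rTensor (K.cx.X n) (K.comul 1 n (n + 1) x) := by
  simp only [degTensD, LinearMap.add_apply, LinearMap.lTensor_tmul, LinearMap.comp_apply]
  congr 1
  generalize K.comul 1 n (n + 1) x = w
  induction w using TensorProduct.induction_on with
  | zero => simp
  | add x y hx hy => simp only [map_add, tmul_add, hx, hy]
  | tmul x y => rfl

lemma tensD_tmul_tι (b : B) (n : ℕ) (x : K.cx.X n) :
    (K.zeroDGAlg (liftAux g) h h').tensD (b ⊗ₜ K.tι n x) = b ⊗ₜ K.totD (K.tι n x) +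
      ∑ pq ∈ Finset.HasAntidiagonal.antidiagonal n,
        TensorProduct.map (LinearMap.mulLeft R b ∘ₗ (liftAux g).toLinearMap ∘ₗ K.br pq.1)
          (K.tι pq.2) (K.comul pq.1 pq.2 n x) := by
  rw [DGAlg.tensD_tmul, DGAlg.δ_apply, totComul_tι, zeroDGAlg_d, LinearMap.zero_apply, zero_tmul,
    zero_add, map_add, DGAlg.lmul_tmul, map_sum, map_sum, zeroDGAlg_σ, AlgHom.id_apply, mul_one]
  congr 1
  refine Finset.sum_congr rfl fun pq _ => ?_
  generalize K.comul pq.1 pq.2 n x = w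
  induction w using TensorProduct.induction_on with
  | zero => simp
  | add x y hx hy => simp only [map_add, hx, hy]
  | tmul x y => simp [DGAlg.t_apply, tw_tι]

/-- The twisting cochain with values in `B` vanishes outside degree one of `K`, so only the
component `(1, n)` of the coproduct contributes. Hence the twisted differential lowers the degree by
exactly one. -/
lemma tensD_homog : (K.totDecomp.lTensor B).Homog (K.zeroDGAlg (liftAux g) h h').tensD
    (degTensD g) where
  zero u := by
    change _ = _
    induction u using TensorProduct.induction_on with
    | zero => simp
    | add x y hx hy => simp only [map_add, hx, hy, add_zero]
    | tmul b x =>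
      refine (tensD_tmul_tι g h h' b 0 x).trans ?_
      have e : (liftAux g).toLinearMap ∘ₗ K.br 0 = 0 := LinearMap.ext fun x => by simp [br_zero]
      simp [totD_tι_zero, e]
  succ n u := by
    induction u using TensorProduct.induction_on with
    | zero => simp
    | add x y hx hy => simp only [map_add, hx, hy]
    | tmul b x =>
      refine (tensD_tmul_tι g h h' b (n + 1) x).trans ?_
      rw [Finset.sum_eq_single (1, n)]
      · rw [degTensD_tmul, map_add, totD_tι]
        congr 1
        have e : (liftAux g).toLinearMap ∘ₗ K.br 1 = g := LinearMap.ext fun x => liftAux_one g x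
        rw [e]
        change _ = (K.tι n).lTensor B _
        rw [LinearMap.lTensor, LinearMap.rTensor, TensorProduct.map_map]
        rfl
      · rintro ⟨p, q⟩ hpq hne
        have hp : p ≠ 1 := by
          rintro rfl
          refine hne (Prod.ext rfl ?_)
          have := Finset.HasAntidiagonal.mem_antidiagonal.1 hpq
          dsimp only at this ⊢
          omega
        have e : (liftAux g).toLinearMap ∘ₗ K.br p = 0 :=
          LinearMap.ext fun x => liftAux_ne g p hp x
        simp [e]
      · intro hn
        exact absurd (Finset.HasAntidiagonal.mem_antidiagonal.2 (by dsimp only; omega)) hn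

end Graded

lemma rTensor_tensD {B B' : Type*} [Ring B] [Algebra R B] [Ring B'] [Algebra R B']
    (θ : K.Cobar →ₐ[R] B) (h : ∀ a, θ (K.diff a) = 0) (h' : ∀ a, θ (K.sgn a) = θ a)
    (θ' : K.Cobar →ₐ[R] B') (k : ∀ a, θ' (K.diff a) = 0) (k' : ∀ a, θ' (K.sgn a) = θ' a)
    (q : B →ₐ[R] B') (hq : ∀ a, q (θ a) = θ' a) (z : B ⊗[R] K.Tot) :
    q.toLinearMap.rTensor K.Tot ((K.zeroDGAlg θ h h').tensD z) =
      (K.zeroDGAlg θ' k k').tensD (q.toLinearMap.rTensor K.Tot z) := by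
  induction z using TensorProduct.induction_on with
  | zero => simp
  | add x y hx hy => simp only [map_add, hx, hy]
  | tmul b x =>
    rw [LinearMap.rTensor_tmul, DGAlg.tensD_tmul, DGAlg.tensD_tmul, DGAlg.δ_apply, DGAlg.δ_apply]
    simp only [zeroDGAlg_d, zeroDGAlg_σ, LinearMap.zero_apply, zero_tmul, zero_add, map_add,
      AlgHom.id_apply, DGAlg.lmul_tmul, LinearMap.rTensor_tmul, AlgHom.toLinearMap_apply, mul_one]
    congr 1
    generalize K.totComul x = w
    induction w using TensorProduct.induction_on with
    | zero => simp
    | add x y hx hy => simp only [map_add, hx, hy]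
    | tmul x y => simp [DGAlg.t_apply, hq]

lemma lTensor_totMap_tensD {B : Type*} [Ring B] [Algebra R B] (f : Hom K K')
    (θ : K'.Cobar →ₐ[R] B) (h : ∀ a, θ (K'.diff a) = 0) (h' : ∀ a, θ (K'.sgn a) = θ a)
    (z : B ⊗[R] K.Tot) : f.totMap.lTensor B ((pullComod f θ h h').D z) =
      (K'.zeroDGAlg θ h h').tensD (f.totMap.lTensor B z) := by
  change f.totMap.lTensor B ((K.zeroDGAlg _ _ _).tensD z) = _
  induction z using TensorProduct.induction_on with
  | zero => simp
  | add x y hx hy => simp only [map_add, hx, hy]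
  | tmul b x =>
    rw [LinearMap.lTensor_tmul, DGAlg.tensD_tmul, DGAlg.tensD_tmul, DGAlg.δ_apply, DGAlg.δ_apply,
      ← f.totMap_totD, f.totMap_totComul]
    simp only [zeroDGAlg_d, zeroDGAlg_σ, LinearMap.zero_apply, zero_tmul, zero_add, map_add,
      AlgHom.id_apply, DGAlg.lmul_tmul, LinearMap.lTensor_tmul, mul_one]
    congr 1
    generalize K.totComul x = w
    induction w using TensorProduct.induction_on with
    | zero => simp
    | add x y hx hy => simp only [map_add, hx, hy]
    | tmul x y => simp [DGAlg.t_apply, ← f.cobarAlgHom_tw]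

/-- The comparison of twisted tensor products with the fundamental algebras. -/
lemma qi_map_totMap {B B' : Type (max u v)} [Ring B] [Algebra R B] [Ring B'] [Algebra R B']
    (f : Hom K K') (g : K.cx.X 1 →ₗ[R] B) (g' : K'.cx.X 1 →ₗ[R] B')
    (h : ∀ a, liftAux g (K.diff a) = 0) (h' : ∀ a, liftAux g' (K'.diff a) = 0)
    (q : B →ₐ[R] B') (hq : ∀ x, q (g x) = g' ((f.f.f 1).hom x)) (hb : Function.Bijective q)
    (hf : f.IsOmegaQuasiIso) (hK : ∀ n, Module.Flat R (K.cx.X n))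
    (hK' : ∀ n, Module.Flat R (K'.cx.X n)) :
    QI (K.zeroDGAlg (liftAux g) h (liftAux_sgn g)).tensD
      (K'.zeroDGAlg (liftAux g') h' (liftAux_sgn g')).tensD
      (TensorProduct.map q.toLinearMap f.totMap) := by
  have hc := rTensor_tensD (K := K) (liftAux g) h (liftAux_sgn g) ((liftAux g').comp f.cobarAlgHom)
    (comp_diff_eq_zero f _ h') (comp_sgn_eq f _ (liftAux_sgn g')) q (comp_liftAux f g g' q hq)
  -- The map factors as `q ⊗ 1` followed by `1 ⊗ f`. The first is an isomorphism of twisted tensor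
  -- products, and it brings both sides over the same algebra.
  have h1 : QI _ (pullComod f (liftAux g') h' (liftAux_sgn g')).D (q.toLinearMap.rTensor K.Tot) :=
    QI.of_bijective (((LinearEquiv.ofBijective q.toLinearMap hb).rTensor K.Tot).bijective) hc
  have h2 := qi_totMap f (liftAux g') h' (liftAux_sgn g') hf hK hK'
  have e : TensorProduct.map q.toLinearMap f.totMap =
      f.totMap.lTensor B' ∘ₗ q.toLinearMap.rTensor K.Tot := by
    rw [LinearMap.lTensor, LinearMap.rTensor, ← TensorProduct.map_comp]; rfl
  rw [e]
  exact h1.comp h2 hc (lTensor_totMap_tensD f _ h' _)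

end Fundamental

end ConnDGCoalg

/-! ### Return from total modules to chain complexes. -/

namespace DiffMod

lemma chainComplex_quasiIso_of_qi {R : Type u} [CommRing R] {X Y : ChainComplex (ModuleCat.{v} R) ℕ}
    (f : X ⟶ Y) {A B : Type*} [AddCommGroup A] [Module R A] [AddCommGroup B] [Module R B]
    {U V : ℕ → Type*} [∀ n, AddCommGroup (U n)] [∀ n, Module R (U n)]
    [∀ n, AddCommGroup (V n)] [∀ n, Module R (V n)] {P : Decomp R A U} {Q : Decomp R B V}
    {D : A →ₗ[R] A} {E : B →ₗ[R] B} {g : A →ₗ[R] B} {d : ∀ n, U (n + 1) →ₗ[R] U n}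
    {e : ∀ n, V (n + 1) →ₗ[R] V n} {φ : ∀ n, U n →ₗ[R] V n}
    (hD : P.Homog D d) (hE : Q.Homog E e) (hg : ∀ n u, g (P.ι n u) = Q.ι n (φ n u))
    (eX : ∀ n, X.X n ≃ₗ[R] U n) (eY : ∀ n, Y.X n ≃ₗ[R] V n)
    (hX : ∀ n x, eX n ((X.d (n + 1) n).hom x) = d n (eX (n + 1) x))
    (hY : ∀ n y, eY n ((Y.d (n + 1) n).hom y) = e n (eY (n + 1) y))
    (hf : ∀ n x, eY n ((f.f n).hom x) = φ n (eX n x)) (h : QI D E g) : QuasiIso f := by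
  obtain ⟨h0, h1⟩ := (QI.iff_graded hD hE hg).1 h
  refine (chainComplex_quasiIso_iff f).2 ⟨fun y => ?_, fun n x y hx hy => ?_⟩
  · obtain ⟨x, y', hy⟩ := h0 (eY 0 y)
    refine ⟨(eX 0).symm x, (eY 1).symm y', (eY 0).injective ?_⟩
    simp [hf, hY, hy]
  · have hx' : D (P.ι n (eX n x)) = 0 := by
      cases n with
      | zero => exact hD.zero _
      | succ n => rw [hD.succ, ← hX]; simp at hx; rw [hx, map_zero, map_zero]
    obtain ⟨x', y', e1, e2⟩ := h1 n (eX n x) (eY (n + 1) y) hx' (by rw [← hf, hy, hY])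
    refine ⟨(eX (n + 1)).symm x', (eY (n + 2)).symm y', (eX n).injective ?_,
      (eY (n + 1)).injective ?_⟩
    · simp [hX, e1]
    · simp [hf, hY, e2]

end DiffMod

namespace SimplicialCoalg

/-! ### Flatness of normalized chains. -/

section Flat

open AlgebraicTopology.DoldKan

variable {R : Type u} [CommRing R] (X : SimplicialObject (ModuleCat.{v} R))

lemma PInfty_degenerate (n : ℕ) (x : X _⦋n⦌) (hx : x ∈ degenerateSubmodule X n) :
    (PInfty.f n : X _⦋n⦌ ⟶ X _⦋n⦌).hom x = 0 := by
  cases n with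
  | zero =>
    obtain rfl : x = 0 := hx
    exact map_zero _
  | succ n =>
    have h : degenerateSubmodule X (n + 1) ≤
        LinearMap.ker (PInfty.f (n + 1) : X _⦋n + 1⦌ ⟶ X _⦋n + 1⦌).hom := by
      refine iSup_le fun i => ?_
      rintro _ ⟨y, rfl⟩
      exact LinearMap.congr_fun (congrArg ModuleCat.Hom.hom (σ_comp_PInfty X i)) y
    exact h hx

lemma QInfty_mem (n : ℕ) (x : X _⦋n⦌) :
    (QInfty.f n : X _⦋n⦌ ⟶ X _⦋n⦌).hom x ∈ degenerateSubmodule X n := by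
  cases n with
  | zero => rw [QInfty_f_0]; exact zero_mem _
  | succ n =>
    rw [QInfty_f, decomposition_Q, ModuleCat.hom_sum, LinearMap.sum_apply]
    refine sum_mem fun i _ => Submodule.mem_iSup_of_mem (Fin.rev i) ?_
    exact ⟨_, rfl⟩

/-- The Dold–Kan projector `PInfty` kills degenerate simplices, and its complement `QInfty` has
degenerate values. So it splits the projection to normalized chains, which are a retract of all
chains. -/
lemma flat_normalizedComplex (n : ℕ) (h : Module.Flat R (X _⦋n⦌)) :
    Module.Flat R ((normalizedComplex X).X n) := by
  let i : (normalizedComplex X).X n →ₗ[R] X _⦋n⦌ := (degenerateSubmodule X n).liftQ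
    (PInfty.f n : X _⦋n⦌ ⟶ X _⦋n⦌).hom (PInfty_degenerate X n)
  refine Module.Flat.of_retract i (toNormalized X n) (Submodule.linearMap_qext _ ?_)
  refine LinearMap.ext fun x => ?_
  change toNormalized X n ((PInfty.f n : X _⦋n⦌ ⟶ X _⦋n⦌).hom x) = toNormalized X n x
  have h := LinearMap.congr_fun (congrArg ModuleCat.Hom.hom (PInfty_f_add_QInfty_f (X := X) n)) x
  have h' : (PInfty.f n : X _⦋n⦌ ⟶ X _⦋n⦌).hom x + (QInfty.f n : X _⦋n⦌ ⟶ X _⦋n⦌).hom x = x := h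
  conv_rhs => rw [← h', map_add, toNormalized_eq_zero X (QInfty_mem X n x), add_zero]

end Flat

/-! ### Normalized chains on the universal cover as a twisted tensor product. -/

section Cover

open Coalgebra DiffMod

variable {R : Type u} [CommRing R]

section Obj

variable (C : SimplicialObject (CoalgCat.{v} R)) (hC : IsConnectedCoalg C)

lemma lastFace_one (n : ℕ) : lastFace (show 1 + n = n + 1 by omega) = natδ 0 :=
  hom_ext_val fun j => by
    rw [natδ_apply 0 (by omega)]
    rfl

/-- The map `x ⊗ g ↦ g ⊗ [x]`. -/
def swapMk (n : ℕ) : (C _⦋n⦌ : Type v) ⊗[R] FundBialg C hC →ₗ[R]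
    FundBialg C hC ⊗[R] (normalizedComplex (underlyingModule C)).X n :=
  (nmk C n).lTensor (FundBialg C hC) ∘ₗ
    (TensorProduct.comm R (C _⦋n⦌ : Type v) (FundBialg C hC)).toLinearMap

lemma swapMk_tmul (n : ℕ) (x : C _⦋n⦌) (g : FundBialg C hC) :
    swapMk C hC n (x ⊗ₜ[R] g) = g ⊗ₜ[R] nmk C n x := rfl

/-- The components of the differential of the twisted tensor product. -/
def coverTensD (n : ℕ) :
    FundBialg C hC ⊗[R] (normalizedComplex (underlyingModule C)).X (n + 1) →ₗ[R]
    FundBialg C hC ⊗[R] (normalizedComplex (underlyingModule C)).X n :=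
  ConnDGCoalg.degTensD (K := normalizedCoalg C hC) (FundBialg.cls C hC) n

lemma coverTensD_tmul (n : ℕ) (g : FundBialg C hC)
    (x : (normalizedComplex (underlyingModule C)).X (n + 1)) :
    coverTensD C hC n (g ⊗ₜ x) =
      g ⊗ₜ ((normalizedComplex (underlyingModule C)).d (n + 1) n).hom x +
      (LinearMap.mulLeft R g ∘ₗ FundBialg.cls C hC).rTensor _ (awComul C 1 n (n + 1) x) :=
  ConnDGCoalg.degTensD_tmul (K := normalizedCoalg C hC) (FundBialg.cls C hC) n g x

/-- Degeneracy operators fix the vertex `0` and are not injective. The first property makes them act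
on the coalgebra factor alone in the universal cover, and the second makes their values degenerate.
-/
lemma linearMap_ndeg_eq_zero {n : ℕ} {M : Type*}
    [AddCommGroup M] [Module R M] (f : (C _⦋n⦌ : Type v) →ₗ[R] M)
    (hf : ∀ (m : ℕ) (φ : ⦋n⦌ ⟶ ⦋m⦌), φ.toOrderHom 0 = 0 → ¬ Function.Injective φ.toOrderHom →
      ∀ y : C _⦋m⦌, f (act C φ y) = 0)
    (x : C _⦋n⦌) (hx : x ∈ ndeg C n) : f x = 0 := by
  cases n with
  | zero =>
    obtain rfl : x = 0 := hx
    exact map_zero f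
  | succ n =>
    refine linearMap_ndeg C f (fun j y => hf n _ ?_ (fun h => ?_) y) x hx
    · change Fin.predAbove j 0 = 0
      simp
    · have e : (SimplexCategory.σ j).toOrderHom j.castSucc =
          (SimplexCategory.σ j).toOrderHom j.succ := by
        change Fin.predAbove j j.castSucc = Fin.predAbove j j.succ
        simp
      exact (Fin.castSucc_lt_succ (i := j)).ne (h e)

variable [∀ n : ℕ, IsCocomm R (C _⦋n⦌ : Type v)]

/-- The projection to normalized chains on the universal cover. -/
def coverMk (n : ℕ) : (C _⦋n⦌ : Type v) ⊗[R] FundBialg C hC →ₗ[R]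
    (normalizedComplex (underlyingModule (coverObj C hC))).X n :=
  nmk (coverObj C hC) n

lemma coverMk_surjective (n : ℕ) : Function.Surjective (coverMk C hC n) :=
  nmk_surjective (coverObj C hC) n

lemma coverMk_d (n : ℕ) (y : (C _⦋n + 1⦌ : Type v) ⊗[R] FundBialg C hC) :
    ((normalizedComplex (underlyingModule (coverObj C hC))).d (n + 1) n).hom
        (coverMk C hC (n + 1) y) =
      ∑ i ∈ Finset.range (n + 2), (-1 : R) ^ i • coverMk C hC n (coverMap C hC (natδ i) y) :=
  nd_nmk (coverObj C hC) n y

lemma swapMk_coverMap {m n : ℕ} (φ : ⦋n⦌ ⟶ ⦋m⦌) (h0 : φ.toOrderHom 0 = 0)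
    (h : ¬ Function.Injective φ.toOrderHom) (y : (C _⦋m⦌ : Type v) ⊗[R] FundBialg C hC) :
    swapMk C hC n (coverMap C hC φ y) = 0 := by
  induction y using TensorProduct.induction_on with
  | zero => simp only [map_zero]
  | add x y hx hy => simp only [map_add, hx, hy, add_zero]
  | tmul x g =>
    rw [coverMap_of_zero C hC φ h0 x g]
    change g ⊗ₜ[R] nact C φ x = 0
    rw [nact_of_not_injective C φ h]
    simp

/-- The map from normalized chains on the universal cover to the twisted tensor product. -/
def coverToTwisted (n : ℕ) : (normalizedComplex (underlyingModule (coverObj C hC))).X n →ₗ[R]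
    FundBialg C hC ⊗[R] (normalizedComplex (underlyingModule C)).X n :=
  nlift (coverObj C hC) (swapMk C hC n)
    (linearMap_ndeg_eq_zero _ _ fun _ φ h0 h y => swapMk_coverMap C hC φ h0 h y)

/-- The map from the twisted tensor product to normalized chains on the universal cover. -/
def twistedToCover (n : ℕ) : FundBialg C hC ⊗[R] (normalizedComplex (underlyingModule C)).X n →ₗ[R]
    (normalizedComplex (underlyingModule (coverObj C hC))).X n :=
  TensorProduct.lift (LinearMap.flip (nlift C
    ((LinearMap.compRight R (coverMk C hC n)) ∘ₗ
      TensorProduct.mk R (C _⦋n⦌ : Type v) (FundBialg C hC))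
    (linearMap_ndeg_eq_zero _ _ fun m φ h0 h y => by
      refine LinearMap.ext fun g => ?_
      change coverMk C hC n (act C φ y ⊗ₜ[R] g) = 0
      -- Since `φ` fixes the vertex `0`, the element is the value of an operator of the universal
      -- cover, and therefore degenerate there.
      rw [← coverMap_of_zero C hC φ h0 y g]
      exact LinearMap.congr_fun (nact_of_not_injective (coverObj C hC) φ h) (y ⊗ₜ[R] g))))

@[elab_as_elim]
lemma cover_induction {n : ℕ}
    {P : (normalizedComplex (underlyingModule (coverObj C hC))).X n → Prop}
    (z : (normalizedComplex (underlyingModule (coverObj C hC))).X n) (zero : P 0)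
    (add : ∀ x y, P x → P y → P (x + y))
    (tmul : ∀ (x : C _⦋n⦌) (g : FundBialg C hC), P (coverMk C hC n (x ⊗ₜ[R] g))) : P z := by
  obtain ⟨y, rfl⟩ := coverMk_surjective C hC n z
  induction y using TensorProduct.induction_on with
  | zero => rw [map_zero]; exact zero
  | add x y hx hy => rw [map_add]; exact add _ _ hx hy
  | tmul x g => exact tmul x g

/-- Normalized chains on the universal cover are a twisted tensor product. -/
def coverEquiv (n : ℕ) : (normalizedComplex (underlyingModule (coverObj C hC))).X n ≃ₗ[R]
    FundBialg C hC ⊗[R] (normalizedComplex (underlyingModule C)).X n :=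
  LinearEquiv.ofLinearMap (coverToTwisted C hC n) (twistedToCover C hC n)
    (TensorProduct.ext' fun g x => by
      obtain ⟨x, rfl⟩ := nmk_surjective C n x
      rfl)
    (LinearMap.ext fun z => by
      induction z using cover_induction with
      | zero => simp only [map_zero]
      | add x y hx hy => simp only [map_add, hx, hy]
      | tmul x g => rfl)

lemma coverEquiv_coverMk (n : ℕ) (y : (C _⦋n⦌ : Type v) ⊗[R] FundBialg C hC) :
    coverEquiv C hC n (coverMk C hC n y) = swapMk C hC n y := rfl

/-- The twisting cochain is the class of the front edge plus the counit. The counit part gives the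
ordinary face `d_0`, and the class part gives the Alexander-Whitney component `(1, n)`. In `d_0` the
edge is taken from the second factor of the coproduct and in the Alexander-Whitney map from the
first, so cocommutativity is needed. -/
lemma swapMk_coverMap_zero (n : ℕ) (x : C _⦋n + 1⦌) (g : FundBialg C hC) :
    swapMk C hC n (coverMap C hC (natδ 0) (x ⊗ₜ[R] g)) =
      g ⊗ₜ[R] nact C (natδ 0) x + (LinearMap.mulLeft R g ∘ₗ FundBialg.cls C hC).rTensor _
        (awComul C 1 n (n + 1) (nmk C (n + 1) x)) := by
  have e2 : ∀ w : (C _⦋n + 1⦌ : Type v) ⊗[R] (C _⦋n + 1⦌ : Type v),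
      swapMk C hC n (TensorProduct.map
        (act C (SimplexCategory.δ (n := n) 0)).toLinearMap
        (LinearMap.mulLeft R g ∘ₗ twistingCochain C hC n) w) =
      TensorProduct.map (LinearMap.mulLeft R g ∘ₗ FundBialg.cls C hC)
        LinearMap.id (TensorProduct.map (nact C (frontFace (by omega))) (nact C (natδ 0))
          (TensorProduct.comm R _ _ w)) +
      g ⊗ₜ[R] nact C (natδ 0) (TensorProduct.rid R _ (counit.lTensor (C _⦋n + 1⦌ : Type v) w)) := by
    intro w
    induction w using TensorProduct.induction_on with
    | zero => simp
    | add x y hx hy => simp only [map_add, tmul_add, hx, hy]; abel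
    | tmul x y =>
      rw [TensorProduct.map_tmul, swapMk_tmul]
      have e : (LinearMap.mulLeft R g ∘ₗ twistingCochain C hC n) y =
          g * FundBialg.cls C hC (nact C (frontFace (by omega)) y) + counit (R := R) y • g := by
        simp [twistingCochain, mul_add, Algebra.algebraMap_eq_smul_one]
      rw [e, add_tmul, smul_tmul]
      simp only [TensorProduct.comm_tmul, TensorProduct.map_tmul, LinearMap.lTensor_tmul,
        TensorProduct.rid_tmul, map_smul]
      rfl
  have e1 : coverMap C hC (natδ 0) (x ⊗ₜ[R] g) =
      coverMap C hC (SimplexCategory.δ 0) (x ⊗ₜ[R] g) := rfl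
  rw [e1, coverMap_δ_zero, e2, comm_comul, lTensor_counit_comul, awComul_nmk C (by omega),
    lastFace_one, add_comm, TensorProduct.rid_tmul, one_smul]
  rfl

/-- Faces with positive index fix the vertex `0`, so they act on the coalgebra factor only. Together
with the untwisted part of `d_0` they form the differential of normalized chains, and the rest of
`d_0` is the twisting term. -/
lemma coverEquiv_d (n : ℕ) (z : (normalizedComplex (underlyingModule (coverObj C hC))).X (n + 1)) :
    coverEquiv C hC n
        (((normalizedComplex (underlyingModule (coverObj C hC))).d (n + 1) n).hom z) =
      coverTensD C hC n (coverEquiv C hC (n + 1) z) := by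
  induction z using cover_induction with
  | zero => simp only [map_zero]
  | add x y hx hy => simp only [map_add, hx, hy]
  | tmul x g =>
    have e : ∀ i ∈ Finset.range (n + 1), (-1 : R) ^ (i + 1) •
        swapMk C hC n (coverMap C hC (natδ (i + 1)) (x ⊗ₜ[R] g)) =
        g ⊗ₜ[R] ((-1 : R) ^ (i + 1) • nact C (natδ (i + 1)) x) := fun i hi => by
      have h0 : (natδ (n := n) (i + 1)).toOrderHom 0 = 0 := Fin.ext (by
        rw [natδ_apply _ (by have := Finset.mem_range.1 hi; omega)]
        simp)
      rw [coverMap_of_zero C hC _ h0, tmul_smul]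
      rfl
    rw [coverEquiv_coverMk, swapMk_tmul, coverTensD_tmul, coverMk_d, nd_nmk, map_sum]
    simp only [map_smul, coverEquiv_coverMk]
    rw [Finset.sum_range_succ', Finset.sum_congr rfl e, swapMk_coverMap_zero,
      Finset.sum_range_succ' _ (n + 1), tmul_add, tmul_sum]
    simp only [pow_zero, one_smul]
    abel

end Obj

variable {C C' : SimplicialObject (CoalgCat.{v} R)} (hC : IsConnectedCoalg C)
  (hC' : IsConnectedCoalg C') [∀ n : ℕ, IsCocomm R (C _⦋n⦌ : Type v)]
  [∀ n : ℕ, IsCocomm R (C' _⦋n⦌ : Type v)] (f : C ⟶ C')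

lemma coverEquiv_map (n : ℕ) (z : (normalizedComplex (underlyingModule (coverObj C hC))).X n) :
    coverEquiv C' hC' n
        (((normalizedMap (underlyingMap (coverObjMap hC hC' f))).f n).hom z) =
      TensorProduct.map (FundBialg.mapAlg hC hC' f).toLinearMap
        ((normalizedMap (underlyingMap f)).f n).hom (coverEquiv C hC n z) := by
  induction z using cover_induction with
  | zero => simp only [map_zero]
  | add x y hx hy => simp only [map_add, hx, hy]
  | tmul x g => rfl

/-- The universal cover functor sends quasi-isomorphisms of cobar constructions to
quasi-isomorphisms. -/
theorem quasiIso_cover (h : IsFlatCoalg C) (h' : IsFlatCoalg C')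
    (hf : (normalizedCoalgMap hC hC' f).IsOmegaQuasiIso) :
    QuasiIso (normalizedMap (underlyingMap (coverObjMap hC hC' f))) := by
  have hq : ∀ x, FundBialg.mapAlg hC hC' f (FundBialg.cls C hC x) =
      FundBialg.cls C' hC' (((normalizedMap (underlyingMap f)).f 1).hom x) := fun x => by
    obtain ⟨x, rfl⟩ := nmk_surjective C 1 x
    exact FundBialg.mapAlg_cls hC hC' f x
  have key := ConnDGCoalg.qi_map_totMap (normalizedCoalgMap hC hC' f)
    (normalizedCoalg C hC).cls (normalizedCoalg C' hC').cls
    (normalizedCoalg C hC).liftAux_cls_diff (normalizedCoalg C' hC').liftAux_cls_diff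
    (FundBialg.mapAlg hC hC' f) hq
    (ConnDGCoalg.bijective_hZero _ hf (FundBialg.mapAlg hC hC' f) hq) hf
    (fun n => flat_normalizedComplex (underlyingModule C) n (h n))
    (fun n => flat_normalizedComplex (underlyingModule C') n (h' n))
  -- The twisted tensor products are homogeneous of degree `-1`, so the quasi-isomorphism of total
  -- modules can be read degree by degree and carried along `coverEquiv` to the normalized chains of
  -- the covers.
  refine chainComplex_quasiIso_of_qi _ (ConnDGCoalg.tensD_homog _ _ _)
    (ConnDGCoalg.tensD_homog _ _ _) (φ := fun n => TensorProduct.map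
      (FundBialg.mapAlg hC hC' f).toLinearMap ((normalizedMap (underlyingMap f)).f n).hom)
    (fun n u => ?_) (coverEquiv C hC) (coverEquiv C' hC') (coverEquiv_d C hC)
    (coverEquiv_d C' hC') (coverEquiv_map hC hC' f) key
  induction u using TensorProduct.induction_on with
  | zero => simp only [map_zero]
  | add x y hx hy => simp only [map_add, hx, hy]
  | tmul g x =>
    exact congrArg (FundBialg.mapAlg hC hC' f g ⊗ₜ[R] ·)
      ((normalizedCoalgMap hC hC' f).totMap_tι n x)

end Cover

end SimplicialCoalg

end

theorem mainTheorem6 {R : Type u} [CommRing R] [IsDomain R]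
    {C C' : SimplicialCoalg.ConnSCCoalg.{u, v} R} (f : C ⟶ C')
    (hC : SimplicialCoalg.IsFlatCoalg C.obj) (hC' : SimplicialCoalg.IsFlatCoalg C'.obj)
    (hf : SimplicialCoalg.IsOmegaQuasiIso f) :
    SimplicialCoalg.IsQuasiIso ((SimplicialCoalg.universalCover R).map f) :=
  SimplicialCoalg.quasiIso_cover C.property.2 C'.property.2 f.hom hC hC' hf
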